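/- Throughout, a measure is a non-negative Borel measure on $\mathbb{C}$, $B(z,r)$ is the open disc with centre $z$ and radius $r>0$, and $\langle f,g\rangle_\mu=\int_{\mathbb{C}} fg\,d\mu$. Let $\mathcal{D}$ be the set of dyadic squares $[k2^j,(k+1)2^j)\times[l2^j,(l+1)2^j)$ with $j,k,l\in\mathbb{Z}$; for $Q\in\mathcal{D}$ let $z_Q$ be its centre and $\ell(Q)$ its side-length. For $\delta>0$ put $K_\delta(z)=\bar z/\max(\delta,|z|)^2$ and $\mathcal{C}_{\mu,\delta}(f)(z)=\int_{\mathbb{C}}K_\delta(z-\xi)f(\xi)\,d\mu(\xi)$. A measure $\mu$ is *$C_0$-good* if $\mu(B(z,r))\le C_0r$ for every disc $B(z,r)$ and $\sup_{\delta>0}\|\mathcal{C}_{\mu,\delta}\|_{L^2(\mu)\to L^2(\mu)}\le C_0$. It has *AD-regularity constant* $c_0>0$ if $\mu(B(z,r))\ge c_0r$ for every $z\in\operatorname{supp}(\mu)$ and $r>0$. For a $C_0$-good measure $\mu$, $\mathcal{C}_\mu:L^2(\mu)\to L^2(\mu)$ denotes the bounded linear operator which is the weak limit of $\mathcal{C}_{\mu,\delta}$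 as $\delta\to0^+$, that is, $\langle\mathcal{C}_\mu(f),g\rangle_\mu=\lim_{\delta\to0^+}\langle\mathcal{C}_{\mu,\delta}(f),g\rangle_\mu$ for all $f,g\in L^2(\mu)$. For $A>1$ and $Q\in\mathcal{D}$ let $\Psi^\mu_{Q,A}$ be the set of functions $\psi:\mathbb{C}\to\mathbb{C}$ with $\operatorname{supp}(\psi)\subset B(z_Q,A\ell(Q))$, $\|\psi\|_{\mathrm{Lip}}\le\ell(Q)^{-3/2}$ and $\int_{\mathbb{C}}\psi\,d\mu=0$, and for $A'\ge A$ put $$\Theta^\mu_{A,A'}(Q)=\inf_{F\supset B(z_Q,A'\ell(Q))}\ \sup_{\psi\in\Psi^\mu_{Q,A}}\ell(Q)^{-1/2}\,\bigl|\langle\mathcal{C}_\mu(\chi_F),\psi\rangle_\mu\bigr|,$$ where the infimum is over Borel sets $F$ with $\mu(F)<\infty$. Fix $\tau\in(0,1)$. A square $Q\in\mathcal{D}$ is *$\mu$-bad* if there are $\zeta,\xi\in B(z_Q,10\ell(Q))\cap\operatorname{supp}(\mu)$ with $|\zeta-\xi|\ge\ell(Q)/2$ and a point $z$ of the segment $[\zeta,\xi]$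 such that $B(z,\tau\ell(Q))\cap\operatorname{supp}(\mu)=\varnothing$. **Proposition.** Let $C_0,c_0>0$ and $\tau\in(0,1)$. There are constants $A,A'>1$ with $A'\ge A$, and $\gamma>0$, depending only on $C_0$, $c_0$ and $\tau$, such that for every $C_0$-good measure $\mu$ with AD-regularity constant $c_0$ and every $\mu$-bad square $Q\in\mathcal{D}$, $$\Theta^\mu_{A,A'}(Q)\ge\gamma.$$ -/

import Mathlib

open MeasureTheory Filter
open scoped NNReal ENNReal Topology

/-- The dyadic square `[k 2^j, (k+1) 2^j) × [l 2^j, (l+1) 2^j)` of the complex plane, given by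
its scale `j` and its position `(k, l)`. -/
structure DyadicSquare where
  j : ℤ
  k : ℤ
  l : ℤ

/-- The side-length of a dyadic square. -/
noncomputable def DyadicSquare.side (Q : DyadicSquare) : ℝ := (2 : ℝ) ^ Q.j

/-- The centre of a dyadic square. -/
noncomputable def DyadicSquare.center (Q : DyadicSquare) : ℂ :=
  ⟨((Q.k : ℝ) + 1 / 2) * Q.side, ((Q.l : ℝ) + 1 / 2) * Q.side⟩

/-- The regularized Cauchy kernel `K_δ(z) = conj z / max(δ, |z|)²`. -/
noncomputable def regCauchyKernel (δ : ℝ) (z : ℂ) : ℂ :=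
  (starRingEnd ℂ) z / ((max δ ‖z‖ ^ 2 : ℝ) : ℂ)

/-- The regularized Cauchy transform `C_{μ,δ}(f)(z) = ∫ K_δ(z - ξ) f(ξ) dμ(ξ)`. -/
noncomputable def regCauchyTransform (μ : Measure ℂ) (δ : ℝ) (f : ℂ → ℂ) (z : ℂ) : ℂ :=
  ∫ ξ, regCauchyKernel δ (z - ξ) * f ξ ∂μ

/-- `μ` is `C₀`-nice: `μ(B(z,r)) ≤ C₀ r` for every disc. -/
def IsNiceMeasure (μ : Measure ℂ) (C₀ : ℝ) : Prop :=
  ∀ (z : ℂ) (r : ℝ), 0 < r → μ (Metric.ball z r) ≤ ENNReal.ofReal (C₀ * r)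

/-- `μ` is `C₀`-good: it is `C₀`-nice, and all the operators `C_{μ,δ}`, `δ > 0`, are bounded on
`L²(μ)` with norm at most `C₀`. -/
def IsGoodMeasure (μ : Measure ℂ) (C₀ : ℝ) : Prop :=
  IsNiceMeasure μ C₀ ∧
    ∀ δ : ℝ, 0 < δ → ∀ f : ℂ → ℂ, MemLp f 2 μ →
      MemLp (regCauchyTransform μ δ f) 2 μ ∧
        eLpNorm (regCauchyTransform μ δ f) 2 μ ≤ ENNReal.ofReal C₀ * eLpNorm f 2 μ

/-- The lower Ahlfors-David condition with constant `c₀`: `μ(B(z,r)) ≥ c₀ r` for every disc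
centred on the support of `μ`. -/
def IsADRegularMeasure (μ : Measure ℂ) (c₀ : ℝ) : Prop :=
  ∀ z ∈ μ.support, ∀ r : ℝ, 0 < r → ENNReal.ofReal (c₀ * r) ≤ μ (Metric.ball z r)

/-- The bilinear pairing `⟨f, g⟩_μ = ∫ f g dμ`. -/
noncomputable def measurePairing (μ : Measure ℂ) (f g : ℂ → ℂ) : ℂ :=
  ∫ z, f z * g z ∂μ

/-- `T` is the weak limit in `L²(μ)` of the operators `C_{μ,δ}` as `δ → 0⁺`. -/
def IsWeakCauchyLimit (μ : Measure ℂ) (T : Lp ℂ 2 μ →L[ℂ] Lp ℂ 2 μ) : Prop :=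
  ∀ f g : Lp ℂ 2 μ,
    Tendsto (fun δ : ℝ => measurePairing μ (regCauchyTransform μ δ f) g) (𝓝[>] (0 : ℝ))
      (𝓝 (measurePairing μ (T f) g))

open Classical in
/-- The Cauchy transform operator `C_μ : L²(μ) → L²(μ)`, the (unique) weak limit of the operators
`C_{μ,δ}` as `δ → 0⁺`; it exists whenever `μ` is good, and is set to be `0` if it does not exist. -/
noncomputable def cauchyOperator (μ : Measure ℂ) : Lp ℂ 2 μ →L[ℂ] Lp ℂ 2 μ :=
  if h : ∃ T : Lp ℂ 2 μ →L[ℂ] Lp ℂ 2 μ, IsWeakCauchyLimit μ T then h.choose else 0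

/-- The family `Ψ_{Q,A}` of Lipschitz bumps of `μ`-mean zero adapted to the square `Q`. -/
def bumpFamily (μ : Measure ℂ) (A : ℝ) (Q : DyadicSquare) : Set (ℂ → ℂ) :=
  {ψ | tsupport ψ ⊆ Metric.ball Q.center (A * Q.side) ∧
    LipschitzWith (Real.toNNReal (Q.side ^ (-(3 / 2) : ℝ))) ψ ∧
    ∫ z, ψ z ∂μ = 0}

/-- `Θ_{A,A'}(Q) = inf_F sup_ψ ℓ(Q)^{-1/2} |⟨C_μ(χ_F), ψ⟩_μ|`, where `ψ` runs over `Ψ_{Q,A}` and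
`F` over the Borel sets containing `B(z_Q, A' ℓ(Q))` with `χ_F ∈ L²(μ)`, that is, `μ(F) < ∞`. -/
noncomputable def cauchyTheta (μ : Measure ℂ) (A A' : ℝ) (Q : DyadicSquare) : ℝ≥0∞ :=
  ⨅ (F : Set ℂ) (hF : MeasurableSet F) (hμF : μ F ≠ ∞)
    (_ : Metric.ball Q.center (A' * Q.side) ⊆ F),
  ⨆ ψ ∈ bumpFamily μ A Q,
    ENNReal.ofReal (Q.side ^ (-(1 / 2) : ℝ) *
      ‖measurePairing μ (cauchyOperator μ (indicatorConstLp 2 hF hμF (1 : ℂ))) ψ‖)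

/-- `Q` is a bad square for `μ`, with parameter `τ`. -/
def IsBadSquare (μ : Measure ℂ) (τ : ℝ) (Q : DyadicSquare) : Prop :=
  ∃ ζ ∈ Metric.ball Q.center (10 * Q.side) ∩ μ.support,
  ∃ ξ ∈ Metric.ball Q.center (10 * Q.side) ∩ μ.support,
    Q.side / 2 ≤ ‖ζ - ξ‖ ∧
    ∃ z ∈ segment ℝ ζ ξ, Metric.ball z (τ * Q.side) ∩ μ.support = ∅

/-! ### Measures of linear growth and differences of their Cauchy transforms off the support. -/

section NiceMeasures

variable {μ : Measure ℂ} {C₀ : ℝ}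

/-! The object of study is the Cauchy transform off the support, up to an additive constant: H(x) =
∫ (1/(x-w) - 1/(b-w)) dμ(w), which is `cauchyDiff μ x b`, for a base point b in a hole of the
support. The argument is by contradiction and compactness, and rests on three facts.

Algebra. If Θ(Q) is small, then H takes approximately at most one non-zero value in the holes near
Q. Let φ be a cutoff at a large scale and g = φ·(1/(a-·) - 1/(b-·)). Antisymmetry of the kernel and
(1/(z-w))(1/(a-z) - 1/(a-w)) = 1/((a-z)(a-w)) give ⟨Cφ, g⟩ = (U_a² - U_b²)/2 with U_x = ∫ φ(w)/(x-w)
dμ(w) (`symmCauchyForm_eq`). The mean m = U_a - U_b of g is close to H(a). Subtracting m times a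
fixed normalized bump makes g admissible, and smallness of Θ becomes m(m - κ) ≈ 0 with κ independent
of a (`exists_forall_norm_mul_sub_le`). Two poles a, a' share κ; eliminating it gives H(a)H(a')(H(a)
- H(a')) ≈ 0 (`exists_cauchyTheta_threshold`).

Jumps. Let p be a support point nearest to x, d = |x - p| and e = (x - p)/d. If H varies little
between x and a point of the radius very close to p, then at some scale s comparable to d the
support lies in a narrow double cone about the line through p orthogonal to e. Otherwise, at each of
many scales, support points on the side away from x would by AD-regularity add a fixed amount to
Re(e·H) near p, and nothing could cancel it because the disc B(x,d) is empty (`exists_cone_scale`).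
In the cone situation the difference of H across p is essentially a Poisson integral, so e(H(p+se) -
H(p-se)) has real part at least c₀/4 and tiny imaginary part (`jump_of_cone`).

Rigidity. In the limit H is locally constant with at most one non-zero value. Hence H(x) determines
the value across the jump, hence the jump, hence e. Moving from x along e inside the empty disc
changes neither H nor e, so the nearest support point stays behind and the empty disc grows by the
factor 3/2. Iterating, it exhausts a half-plane containing x (`exists_half_plane`), which is
impossible when x lies on a segment between two support points.

A sequence of counterexamples with degenerating constants, rescaled to unit size, has an ultrafilter
limit to which rigidity applies (`false_of_jump_sequence`). -/

theorem IsNiceMeasure.isLocallyFiniteMeasure (h : IsNiceMeasure μ C₀) :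
    IsLocallyFiniteMeasure μ :=
  ⟨fun z => ⟨Metric.ball z 1, Metric.ball_mem_nhds z one_pos,
    (h z 1 one_pos).trans_lt ENNReal.ofReal_lt_top⟩⟩

theorem IsNiceMeasure.measure_singleton (h : IsNiceMeasure μ C₀) (z : ℂ) : μ {z} = 0 := by
  have h1 : ∀ r : ℝ, 0 < r → μ {z} ≤ ENNReal.ofReal (C₀ * r) := fun r hr =>
    (measure_mono (by simpa using hr)).trans (h z r hr)
  have h2 : Tendsto (fun r : ℝ => ENNReal.ofReal (C₀ * r)) (𝓝[>] 0) (𝓝 0) := by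
    have : Tendsto (fun r : ℝ => ENNReal.ofReal (C₀ * r)) (𝓝 0) (𝓝 (ENNReal.ofReal (C₀ * 0))) :=
      (ENNReal.continuous_ofReal.comp (continuous_const.mul continuous_id)).tendsto 0
    simpa using this.mono_left nhdsWithin_le_nhds
  exact le_antisymm (ge_of_tendsto h2 (eventually_mem_nhdsWithin.mono h1)) bot_le

theorem IsNiceMeasure.measure_ball_lt_top (h : IsNiceMeasure μ C₀) (z : ℂ) (r : ℝ) :
    μ (Metric.ball z r) < ∞ := by
  rcases le_or_gt r 0 with hr | hr
  · simp [Metric.ball_eq_empty.2 hr]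
  · exact (h z r hr).trans_lt ENNReal.ofReal_lt_top

theorem IsNiceMeasure.measureReal_ball_le (h : IsNiceMeasure μ C₀) (hC : 0 < C₀) (z : ℂ) {r : ℝ}
    (hr : 0 < r) : μ.real (Metric.ball z r) ≤ C₀ * r :=
  ENNReal.toReal_le_of_le_ofReal (by positivity) (h z r hr)

/-- Dyadic annuli about `z`: the one of inner radius `2 ^ n * r` contributes at most `2 * C₀ / r *
(1 / 2) ^ n`, and the geometric series sums. The tail estimates below reduce to this. -/
theorem IsNiceMeasure.setLIntegral_inv_sq_le (h : IsNiceMeasure μ C₀) (hC : 0 < C₀) (z : ℂ)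
    {r : ℝ} (hr : 0 < r) :
    ∫⁻ w in {w | r ≤ ‖w - z‖}, ENNReal.ofReal (1 / ‖w - z‖ ^ 2) ∂μ ≤
      ENNReal.ofReal (4 * C₀ / r) := by
  set s : ℕ → Set ℂ := fun n => {w | 2 ^ n * r ≤ ‖w - z‖ ∧ ‖w - z‖ < 2 ^ (n + 1) * r} with hs
  have hsub : {w : ℂ | r ≤ ‖w - z‖} ⊆ ⋃ n, s n := by
    intro w hw
    have hw' : 1 ≤ ‖w - z‖ / r := by rw [le_div_iff₀ hr]; simpa using hw
    obtain ⟨n, h1, h2⟩ := exists_nat_pow_near hw' one_lt_two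
    rw [le_div_iff₀ hr] at h1
    rw [div_lt_iff₀ hr] at h2
    exact Set.mem_iUnion.2 ⟨n, h1, h2⟩
  have hbd : ∀ n, ∫⁻ w in s n, ENNReal.ofReal (1 / ‖w - z‖ ^ 2) ∂μ ≤
      ENNReal.ofReal (2 * C₀ / r * (1 / 2) ^ n) := by
    intro n
    have hp : (0 : ℝ) < 2 ^ n * r := by positivity
    have hms : MeasurableSet (s n) := by
      have hm : Measurable fun w : ℂ => ‖w - z‖ := by fun_prop
      exact (measurableSet_le measurable_const hm).inter (measurableSet_lt hm measurable_const)
    calc ∫⁻ w in s n, ENNReal.ofReal (1 / ‖w - z‖ ^ 2) ∂μ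
        ≤ ∫⁻ _ in s n, ENNReal.ofReal (1 / (2 ^ n * r) ^ 2) ∂μ := by
          refine setLIntegral_mono' hms fun w hw => ENNReal.ofReal_le_ofReal ?_
          have := hw.1
          gcongr
      _ = ENNReal.ofReal (1 / (2 ^ n * r) ^ 2) * μ (s n) := by simp
      _ ≤ ENNReal.ofReal (1 / (2 ^ n * r) ^ 2) * ENNReal.ofReal (C₀ * (2 ^ (n + 1) * r)) := by
          gcongr
          refine (measure_mono ?_).trans (h z _ (by positivity))
          intro w hw
          simpa [dist_eq_norm] using hw.2
      _ = ENNReal.ofReal (2 * C₀ / r * (1 / 2) ^ n) := by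
          rw [← ENNReal.ofReal_mul (by positivity)]
          congr 1
          rw [one_div_pow]
          field_simp
          ring
  calc ∫⁻ w in {w | r ≤ ‖w - z‖}, ENNReal.ofReal (1 / ‖w - z‖ ^ 2) ∂μ
      ≤ ∫⁻ w in ⋃ n, s n, ENNReal.ofReal (1 / ‖w - z‖ ^ 2) ∂μ := lintegral_mono_set hsub
    _ ≤ ∑' n, ∫⁻ w in s n, ENNReal.ofReal (1 / ‖w - z‖ ^ 2) ∂μ := lintegral_iUnion_le _ _
    _ ≤ ∑' n : ℕ, ENNReal.ofReal (2 * C₀ / r * (1 / 2) ^ n) := ENNReal.tsum_le_tsum hbd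
    _ = ENNReal.ofReal (4 * C₀ / r) := by
        rw [← ENNReal.ofReal_tsum_of_nonneg (fun n => by positivity)
          (summable_geometric_two.mul_left _), tsum_mul_left, tsum_geometric_two]
        congr 1
        ring

theorem measurableSet_le_norm_sub (z : ℂ) (r : ℝ) : MeasurableSet {w : ℂ | r ≤ ‖w - z‖} :=
  measurableSet_le measurable_const (by fun_prop)

theorem IsNiceMeasure.integrableOn_inv_sq (h : IsNiceMeasure μ C₀) (hC : 0 < C₀) (z : ℂ)
    {r : ℝ} (hr : 0 < r) :
    IntegrableOn (fun w => 1 / ‖w - z‖ ^ 2) {w | r ≤ ‖w - z‖} μ := by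
  have hm : Measurable fun w : ℂ => 1 / ‖w - z‖ ^ 2 := by fun_prop
  refine ⟨hm.aestronglyMeasurable, ?_⟩
  rw [hasFiniteIntegral_iff_ofReal (ae_of_all _ fun w => by positivity)]
  exact (h.setLIntegral_inv_sq_le hC z hr).trans_lt ENNReal.ofReal_lt_top

theorem IsNiceMeasure.setIntegral_inv_sq_le (h : IsNiceMeasure μ C₀) (hC : 0 < C₀) (z : ℂ)
    {r : ℝ} (hr : 0 < r) :
    ∫ w in {w | r ≤ ‖w - z‖}, 1 / ‖w - z‖ ^ 2 ∂μ ≤ 4 * C₀ / r := by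
  rw [integral_eq_lintegral_of_nonneg_ae (ae_of_all _ fun w => by positivity)
    (by fun_prop : Measurable fun w : ℂ => 1 / ‖w - z‖ ^ 2).aestronglyMeasurable]
  exact ENNReal.toReal_le_of_le_ofReal (by positivity) (h.setLIntegral_inv_sq_le hC z hr)

theorem ae_le_norm_sub {a : ℂ} {η : ℝ} (ha : ∀ w ∈ μ.support, η ≤ ‖w - a‖) :
    ∀ᵐ w ∂μ, η ≤ ‖w - a‖ := by
  filter_upwards [Measure.support_mem_ae (μ := μ)] with w hw using ha w hw

theorem IsNiceMeasure.integrable_inv_sq (h : IsNiceMeasure μ C₀) (hC : 0 < C₀) {a : ℂ} {η : ℝ}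
    (hη : 0 < η) (ha : ∀ w ∈ μ.support, η ≤ ‖w - a‖) :
    Integrable (fun w => 1 / ‖w - a‖ ^ 2) μ := by
  have := h.integrableOn_inv_sq hC a hη
  rwa [IntegrableOn, Measure.restrict_eq_self_of_ae_mem (s := {w | η ≤ ‖w - a‖}) (ae_le_norm_sub ha)] at this

theorem IsNiceMeasure.integral_inv_sq_le (h : IsNiceMeasure μ C₀) (hC : 0 < C₀) {a : ℂ} {η : ℝ}
    (hη : 0 < η) (ha : ∀ w ∈ μ.support, η ≤ ‖w - a‖) :
    ∫ w, 1 / ‖w - a‖ ^ 2 ∂μ ≤ 4 * C₀ / η := by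
  have := h.setIntegral_inv_sq_le hC a hη
  rwa [Measure.restrict_eq_self_of_ae_mem (s := {w | η ≤ ‖w - a‖}) (ae_le_norm_sub ha)] at this

/-- The difference of the values at `a` and `b` of the Cauchy transform of `μ`. -/
noncomputable def cauchyDiff (μ : Measure ℂ) (a b : ℂ) : ℂ :=
  ∫ w, (1 / (a - w) - 1 / (b - w)) ∂μ

/-- The difference is a multiple of the product of the two kernels, and AM-GM splits that product
into inverse squares. This gives absolute convergence of `cauchyDiff`, although a single kernel need
not be integrable. -/
theorem norm_inv_sub_inv_le {a b w : ℂ} (ha : a ≠ w) (hb : b ≠ w) :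
    ‖1 / (a - w) - 1 / (b - w)‖ ≤ ‖a - b‖ / 2 * (1 / ‖w - a‖ ^ 2 + 1 / ‖w - b‖ ^ 2) := by
  have ha' : a - w ≠ 0 := sub_ne_zero.2 ha
  have hb' : b - w ≠ 0 := sub_ne_zero.2 hb
  have h1 : 1 / (a - w) - 1 / (b - w) = (b - a) * (1 / (a - w)) * (1 / (b - w)) := by
    field_simp
    ring
  rw [h1, norm_mul, norm_mul, norm_sub_rev b a, norm_div, norm_div, norm_one, norm_sub_rev a w,
    norm_sub_rev b w]
  have h2 := two_mul_le_add_sq (1 / ‖w - a‖) (1 / ‖w - b‖)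
  rw [one_div_pow, one_div_pow] at h2
  nlinarith [norm_nonneg (a - b)]

theorem ne_of_le_norm_sub {a w : ℂ} {η : ℝ} (hη : 0 < η) (h : η ≤ ‖w - a‖) : a ≠ w := by
  rintro rfl
  simp at h
  linarith

theorem IsNiceMeasure.integrable_cauchyDiff (h : IsNiceMeasure μ C₀) (hC : 0 < C₀) {a b : ℂ}
    {η : ℝ} (hη : 0 < η) (ha : ∀ w ∈ μ.support, η ≤ ‖w - a‖) (hb : ∀ w ∈ μ.support, η ≤ ‖w - b‖) :
    Integrable (fun w => 1 / (a - w) - 1 / (b - w)) μ := by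
  refine (((h.integrable_inv_sq hC hη ha).add (h.integrable_inv_sq hC hη hb)).const_mul
    (‖a - b‖ / 2)).mono' (by fun_prop) ?_
  filter_upwards [ae_le_norm_sub ha, ae_le_norm_sub hb] with w h1 h2
  exact norm_inv_sub_inv_le (ne_of_le_norm_sub hη h1) (ne_of_le_norm_sub hη h2)

theorem IsNiceMeasure.integral_norm_cauchyDiff_le (h : IsNiceMeasure μ C₀) (hC : 0 < C₀) {a b : ℂ}
    {η : ℝ} (hη : 0 < η) (ha : ∀ w ∈ μ.support, η ≤ ‖w - a‖) (hb : ∀ w ∈ μ.support, η ≤ ‖w - b‖) :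
    ∫ w, ‖1 / (a - w) - 1 / (b - w)‖ ∂μ ≤ 4 * C₀ / η * ‖a - b‖ := by
  have h1 := h.integrable_inv_sq hC hη ha
  have h2 := h.integrable_inv_sq hC hη hb
  calc ∫ w, ‖1 / (a - w) - 1 / (b - w)‖ ∂μ
      ≤ ∫ w, ‖a - b‖ / 2 * (1 / ‖w - a‖ ^ 2 + 1 / ‖w - b‖ ^ 2) ∂μ := by
        refine integral_mono_ae (h.integrable_cauchyDiff hC hη ha hb).norm
          ((h1.add h2).const_mul _) ?_
        filter_upwards [ae_le_norm_sub ha, ae_le_norm_sub hb] with w h1 h2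
        exact norm_inv_sub_inv_le (ne_of_le_norm_sub hη h1) (ne_of_le_norm_sub hη h2)
    _ ≤ ‖a - b‖ / 2 * (4 * C₀ / η + 4 * C₀ / η) := by
        rw [integral_const_mul, integral_add h1 h2]
        gcongr
        · exact h.integral_inv_sq_le hC hη ha
        · exact h.integral_inv_sq_le hC hη hb
    _ = 4 * C₀ / η * ‖a - b‖ := by ring

theorem IsNiceMeasure.norm_cauchyDiff_le (h : IsNiceMeasure μ C₀) (hC : 0 < C₀) {a b : ℂ}
    {η : ℝ} (hη : 0 < η) (ha : ∀ w ∈ μ.support, η ≤ ‖w - a‖) (hb : ∀ w ∈ μ.support, η ≤ ‖w - b‖) :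
    ‖cauchyDiff μ a b‖ ≤ 4 * C₀ / η * ‖a - b‖ :=
  (norm_integral_le_integral_norm _).trans (h.integral_norm_cauchyDiff_le hC hη ha hb)

theorem IsNiceMeasure.cauchyDiff_sub (h : IsNiceMeasure μ C₀) (hC : 0 < C₀) {a b c : ℂ}
    {η : ℝ} (hη : 0 < η) (ha : ∀ w ∈ μ.support, η ≤ ‖w - a‖) (hb : ∀ w ∈ μ.support, η ≤ ‖w - b‖)
    (hc : ∀ w ∈ μ.support, η ≤ ‖w - c‖) :
    cauchyDiff μ a c - cauchyDiff μ b c = cauchyDiff μ a b := by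
  rw [cauchyDiff, cauchyDiff, cauchyDiff, ← integral_sub (h.integrable_cauchyDiff hC hη ha hc)
    (h.integrable_cauchyDiff hC hη hb hc)]
  congr 1
  ext w
  ring

theorem cauchyDiff_self (μ : Measure ℂ) (a : ℂ) : cauchyDiff μ a a = 0 := by simp [cauchyDiff]

end NiceMeasures

/-! ### The regularized kernel: size, Lipschitz bound, agreement with `1 / z` away from the origin.
-/

section Kernel

variable {δ : ℝ}

theorem norm_regCauchyKernel (hδ : 0 < δ) (z : ℂ) :
    ‖regCauchyKernel δ z‖ = ‖z‖ / max δ ‖z‖ ^ 2 := by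
  rw [regCauchyKernel, norm_div, RCLike.norm_conj, Complex.norm_real, Real.norm_of_nonneg]
  positivity

theorem norm_regCauchyKernel_le (hδ : 0 < δ) (z : ℂ) :
    ‖regCauchyKernel δ z‖ ≤ 1 / max δ ‖z‖ := by
  have h : 0 < max δ ‖z‖ := lt_max_of_lt_left hδ
  rw [norm_regCauchyKernel hδ, div_le_div_iff₀ (by positivity) h]
  nlinarith [le_max_right δ ‖z‖]

theorem norm_regCauchyKernel_le_inv (hδ : 0 < δ) (z : ℂ) : ‖regCauchyKernel δ z‖ ≤ 1 / δ :=
  (norm_regCauchyKernel_le hδ z).trans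
    (one_div_le_one_div_of_le hδ (le_max_left _ _))

theorem norm_regCauchyKernel_le_inv_norm (hδ : 0 < δ) (z : ℂ) :
    ‖regCauchyKernel δ z‖ ≤ 1 / ‖z‖ := by
  rcases eq_or_ne z 0 with rfl | hz
  · simp [regCauchyKernel]
  · exact (norm_regCauchyKernel_le hδ z).trans
      (one_div_le_one_div_of_le (norm_pos_iff.2 hz) (le_max_right _ _))

theorem regCauchyKernel_neg (δ : ℝ) (z : ℂ) : regCauchyKernel δ (-z) = -regCauchyKernel δ z := by
  simp [regCauchyKernel, neg_div]

theorem regCauchyKernel_of_le (hδ : 0 < δ) {z : ℂ} (hz : δ ≤ ‖z‖) : regCauchyKernel δ z = 1 / z := by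
  have hz0 : z ≠ 0 := norm_pos_iff.1 (hδ.trans_le hz)
  have hc : (starRingEnd ℂ) z ≠ 0 := by simpa using hz0
  rw [regCauchyKernel, max_eq_right hz, Complex.ofReal_pow, ← Complex.mul_conj']
  field_simp

/-- Numerators are compared first, then denominators, the truncation `max δ ‖z‖` being 1-Lipschitz.
The global bound lets a regularized kernel enter a Lipschitz test function; it agrees with the true
kernel on the support once the pole has clearance `δ`. -/
theorem norm_regCauchyKernel_sub_le (hδ : 0 < δ) (z w : ℂ) :
    ‖regCauchyKernel δ z - regCauchyKernel δ w‖ ≤ 3 / δ ^ 2 * ‖z - w‖ := by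
  set a := max δ ‖z‖ with ha
  set b := max δ ‖w‖ with hb
  have ha0 : δ ≤ a := le_max_left _ _
  have hb0 : δ ≤ b := le_max_left _ _
  have hap : 0 < a := hδ.trans_le ha0
  have hbp : 0 < b := hδ.trans_le hb0
  have hab : |b - a| ≤ ‖z - w‖ := by
    rw [ha, hb, norm_sub_rev, max_comm δ, max_comm δ]
    exact (abs_max_sub_max_le_abs ‖w‖ ‖z‖ δ).trans (abs_norm_sub_norm_le w z)
  have key : regCauchyKernel δ z - regCauchyKernel δ w =
      (starRingEnd ℂ) (z - w) * ((1 / a ^ 2 : ℝ) : ℂ) +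
        (starRingEnd ℂ) w * (((b - a) * ((a + b) / (a ^ 2 * b ^ 2)) : ℝ) : ℂ) := by
    have e1 : ((b - a) * ((a + b) / (a ^ 2 * b ^ 2)) : ℝ) = 1 / a ^ 2 - 1 / b ^ 2 := by
      field_simp
      ring
    rw [e1]
    simp only [regCauchyKernel, ← ha, ← hb, map_sub]
    push_cast
    ring
  have hw : ‖w‖ ≤ b := le_max_right _ _
  have hδ2 : (1 : ℝ) / a ^ 2 ≤ 1 / δ ^ 2 := by gcongr
  have hδ3 : ‖w‖ * ((a + b) / (a ^ 2 * b ^ 2)) ≤ 2 / δ ^ 2 := by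
    calc ‖w‖ * ((a + b) / (a ^ 2 * b ^ 2)) ≤ b * ((a + b) / (a ^ 2 * b ^ 2)) := by gcongr
      _ = 1 / (a * b) + 1 / (a * a) := by field_simp
      _ ≤ 1 / (δ * δ) + 1 / (δ * δ) := by gcongr
      _ = 2 / δ ^ 2 := by ring
  rw [key]
  refine (norm_add_le _ _).trans ?_
  rw [norm_mul, norm_mul, RCLike.norm_conj, RCLike.norm_conj, Complex.norm_real, Complex.norm_real,
    norm_mul, Real.norm_of_nonneg (by positivity : (0 : ℝ) ≤ 1 / a ^ 2),
    Real.norm_of_nonneg (by positivity : (0 : ℝ) ≤ (a + b) / (a ^ 2 * b ^ 2)), Real.norm_eq_abs]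
  calc ‖z - w‖ * (1 / a ^ 2) + ‖w‖ * (|b - a| * ((a + b) / (a ^ 2 * b ^ 2)))
      = ‖z - w‖ * (1 / a ^ 2) + |b - a| * (‖w‖ * ((a + b) / (a ^ 2 * b ^ 2))) := by ring
    _ ≤ ‖z - w‖ * (1 / δ ^ 2) + ‖z - w‖ * (2 / δ ^ 2) := by gcongr
    _ = 3 / δ ^ 2 * ‖z - w‖ := by ring

theorem continuous_regCauchyKernel (hδ : 0 < δ) : Continuous (regCauchyKernel δ) :=
  (LipschitzWith.of_dist_le' fun z w => by
    simpa [dist_eq_norm] using norm_regCauchyKernel_sub_le hδ z w).continuous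

end Kernel

/-! ### The bilinear form of the Cauchy transform and its antisymmetrization. -/

section Form

variable {μ : Measure ℂ} {C₀ δ : ℝ}

theorem integrable_regCauchyKernel_mul_prod [SFinite μ] (hδ : 0 < δ) {f g : ℂ → ℂ}
    (hf : Integrable f μ) (hg : Integrable g μ) :
    Integrable (fun p : ℂ × ℂ => regCauchyKernel δ (p.1 - p.2) * (f p.2 * g p.1)) (μ.prod μ) := by
  refine Integrable.bdd_mul (c := 1 / δ) ?_
    ((continuous_regCauchyKernel hδ).comp (by fun_prop : Continuous fun p : ℂ × ℂ => p.1 - p.2)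
      ).aestronglyMeasurable (ae_of_all _ fun p => norm_regCauchyKernel_le_inv hδ _)
  simpa [mul_comm] using hg.mul_prod hf

theorem measurePairing_regCauchyTransform [SFinite μ] (hδ : 0 < δ) {f g : ℂ → ℂ}
    (hf : Integrable f μ) (hg : Integrable g μ) :
    measurePairing μ (regCauchyTransform μ δ f) g =
      ∫ p : ℂ × ℂ, regCauchyKernel δ (p.1 - p.2) * (f p.2 * g p.1) ∂(μ.prod μ) := by
  rw [integral_prod _ (integrable_regCauchyKernel_mul_prod hδ hf hg)]
  simp only [measurePairing, regCauchyTransform]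
  congr 1
  ext z
  rw [← integral_mul_const]
  congr 1
  ext w
  ring

/-- The kernel is odd, so averaging over the swap of variables keeps only the antisymmetric part of
the product, which vanishes on the diagonal and compensates the singularity as `δ` tends to 0. -/
theorem measurePairing_regCauchyTransform_eq_symm [SFinite μ] (hδ : 0 < δ) {f g : ℂ → ℂ}
    (hf : Integrable f μ) (hg : Integrable g μ) :
    measurePairing μ (regCauchyTransform μ δ f) g =
      1 / 2 * ∫ p : ℂ × ℂ,
        regCauchyKernel δ (p.1 - p.2) * (f p.2 * g p.1 - f p.1 * g p.2) ∂(μ.prod μ) := by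
  have h1 := integrable_regCauchyKernel_mul_prod hδ hf hg
  have h2 := h1.swap
  have h3 := integral_prod_swap (μ := μ) (ν := μ)
    (fun p : ℂ × ℂ => regCauchyKernel δ (p.1 - p.2) * (f p.2 * g p.1))
  have h4 : (fun p : ℂ × ℂ => regCauchyKernel δ (p.1 - p.2) * (f p.2 * g p.1 - f p.1 * g p.2)) =
      fun p => regCauchyKernel δ (p.1 - p.2) * (f p.2 * g p.1) +
        ((fun p : ℂ × ℂ => regCauchyKernel δ (p.1 - p.2) * (f p.2 * g p.1)) ∘ Prod.swap) p := by
    ext p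
    simp only [Function.comp, Prod.fst_swap, Prod.snd_swap]
    rw [← neg_sub p.1 p.2, regCauchyKernel_neg]
    ring
  rw [measurePairing_regCauchyTransform hδ hf hg, h4, integral_add h1 h2]
  simp only [Function.comp] at h3 ⊢
  rw [h3]
  ring

theorem norm_antisymm_le {f g : ℂ → ℂ} {Kf Kg : ℝ≥0} {Mf Mg : ℝ} (hf : LipschitzWith Kf f)
    (hg : LipschitzWith Kg g) (hMf : ∀ z, ‖f z‖ ≤ Mf) (hMg : ∀ z, ‖g z‖ ≤ Mg) (z w : ℂ) :
    ‖f w * g z - f z * g w‖ ≤ (Mf * Kg + Mg * Kf) * ‖z - w‖ := by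
  have h1 : f w * g z - f z * g w = f w * (g z - g w) - g w * (f z - f w) := by ring
  have hf' := hf.norm_sub_le z w
  have hg' := hg.norm_sub_le z w
  have hMf0 := (norm_nonneg _).trans (hMf 0)
  have hMg0 := (norm_nonneg _).trans (hMg 0)
  rw [h1]
  calc _ ≤ ‖f w‖ * ‖g z - g w‖ + ‖g w‖ * ‖f z - f w‖ := by
        refine (norm_sub_le _ _).trans ?_
        rw [norm_mul, norm_mul]
    _ ≤ Mf * (Kg * ‖z - w‖) + Mg * (Kf * ‖z - w‖) := by
        gcongr
        · exact hMf w
        · exact hMg w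
    _ = _ := by ring

/-- The antisymmetrized form of the pairing of the Cauchy transform of `f` with `g`. -/
noncomputable def symmCauchyForm (μ : Measure ℂ) (f g : ℂ → ℂ) : ℂ :=
  1 / 2 * ∫ p : ℂ × ℂ, 1 / (p.1 - p.2) * (f p.2 * g p.1 - f p.1 * g p.2) ∂(μ.prod μ)

theorem tendsto_regCauchyKernel (z : ℂ) :
    Tendsto (fun δ : ℝ => regCauchyKernel δ z) (𝓝[>] 0) (𝓝 (1 / z)) := by
  rcases eq_or_ne z 0 with rfl | hz
  · simp [regCauchyKernel]
  · refine tendsto_const_nhds.congr' ?_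
    filter_upwards [Ioc_mem_nhdsGT (norm_pos_iff.2 hz)] with δ hδ
    rw [regCauchyKernel_of_le hδ.1 hδ.2]

/-- The Lipschitz increment cancels the singularity uniformly in `δ`, so the integrands are
dominated by a constant on a compact product. The limit is explicit, which the quadratic identity
exploits later. -/
theorem tendsto_measurePairing_of_lipschitz [IsLocallyFiniteMeasure μ] {f g : ℂ → ℂ}
    {Kf Kg : ℝ≥0} (hf : LipschitzWith Kf f) (hg : LipschitzWith Kg g)
    (hfc : HasCompactSupport f) (hgc : HasCompactSupport g) :
    Tendsto (fun δ : ℝ => measurePairing μ (regCauchyTransform μ δ f) g) (𝓝[>] 0)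
      (𝓝 (symmCauchyForm μ f g)) := by
  have hfi : Integrable f μ := hf.continuous.integrable_of_hasCompactSupport hfc
  have hgi : Integrable g μ := hg.continuous.integrable_of_hasCompactSupport hgc
  obtain ⟨Mf, hMf⟩ := hf.continuous.bounded_above_of_compact_support hfc
  obtain ⟨Mg, hMg⟩ := hg.continuous.bounded_above_of_compact_support hgc
  have hMf0 := (norm_nonneg _).trans (hMf 0)
  have hMg0 := (norm_nonneg _).trans (hMg 0)
  have hcongr : (fun δ : ℝ => 1 / 2 * ∫ p : ℂ × ℂ,
        regCauchyKernel δ (p.1 - p.2) * (f p.2 * g p.1 - f p.1 * g p.2) ∂(μ.prod μ)) =ᶠ[𝓝[>] 0]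
      fun δ : ℝ => measurePairing μ (regCauchyTransform μ δ f) g := by
    filter_upwards [self_mem_nhdsWithin] with δ hδ
    exact (measurePairing_regCauchyTransform_eq_symm hδ hfi hgi).symm
  refine Tendsto.congr' hcongr (Tendsto.const_mul _ ?_)
  set K : Set ℂ := tsupport f ∪ tsupport g with hK
  have hKc : IsCompact K := hfc.union hgc
  set M := Mf * Kg + Mg * Kf with hM
  have hM0 : 0 ≤ M := by positivity
  refine tendsto_integral_filter_of_dominated_convergence
    ((K ×ˢ K).indicator fun _ => M) ?_ ?_ ?_ ?_
  · filter_upwards [self_mem_nhdsWithin] with δ hδ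
    have h1 := continuous_regCauchyKernel hδ
    have h2 := hf.continuous
    have h3 := hg.continuous
    exact (by fun_prop : Continuous fun p : ℂ × ℂ =>
      regCauchyKernel δ (p.1 - p.2) * (f p.2 * g p.1 - f p.1 * g p.2)).aestronglyMeasurable
  · filter_upwards [self_mem_nhdsWithin] with δ hδ
    refine ae_of_all _ fun p => ?_
    by_cases hp : p ∈ K ×ˢ K
    · rw [Set.indicator_of_mem hp, norm_mul]
      have h1 := norm_regCauchyKernel_le_inv_norm hδ (p.1 - p.2)
      have h2 := norm_antisymm_le hf hg hMf hMg p.1 p.2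
      calc _ ≤ 1 / ‖p.1 - p.2‖ * (M * ‖p.1 - p.2‖) := by gcongr
        _ = M * (‖p.1 - p.2‖ / ‖p.1 - p.2‖) := by ring
        -- Only an inequality, since on the diagonal the quotient is `0 / 0 = 0`.
        _ ≤ M * 1 := by gcongr; exact div_self_le_one _
        _ = M := mul_one M
    · rw [Set.indicator_of_notMem hp]
      have h0 : f p.2 * g p.1 - f p.1 * g p.2 = 0 := by
        rw [Set.mem_prod, not_and_or] at hp
        have hz : ∀ x ∉ K, f x = 0 ∧ g x = 0 := fun x hx =>
          ⟨image_eq_zero_of_notMem_tsupport fun h => hx (Or.inl h),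
            image_eq_zero_of_notMem_tsupport fun h => hx (Or.inr h)⟩
        rcases hp with hp | hp <;> simp [hz _ hp]
      simp [h0]
  · rw [integrable_indicator_iff (hKc.measurableSet.prod hKc.measurableSet)]
    exact continuousOn_const.integrableOn_compact (hKc.prod hKc)
  · exact ae_of_all _ fun p => (tendsto_regCauchyKernel _).mul_const _

end Form

/-! ### Existence of the weak limit that defines the Cauchy operator. -/

section WeakLimit

variable {μ : Measure ℂ} {C₀ δ : ℝ}

theorem IsNiceMeasure.memLp_regCauchyKernel (h : IsNiceMeasure μ C₀) (hC : 0 < C₀) (hδ : 0 < δ)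
    (z : ℂ) : MemLp (fun w => regCauchyKernel δ (z - w)) 2 μ := by
  have hm : Continuous fun w => regCauchyKernel δ (z - w) :=
    (continuous_regCauchyKernel hδ).comp (by fun_prop)
  have hm2 : Continuous fun w => ‖regCauchyKernel δ (z - w)‖ ^ 2 := hm.norm.pow 2
  rw [memLp_two_iff_integrable_sq_norm hm.aestronglyMeasurable]
  have h1 := h.integrableOn_inv_sq hC z hδ
  have h2 : IntegrableOn (fun _ : ℂ => 1 / δ ^ 2) (Metric.ball z δ) μ :=
    integrableOn_const (h.measure_ball_lt_top z δ).ne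
  have hcov : Metric.ball z δ ∪ {w | δ ≤ ‖w - z‖} = Set.univ := by
    ext w
    simpa [dist_eq_norm] using lt_or_ge ‖w - z‖ δ
  rw [← integrableOn_univ, ← hcov]
  refine IntegrableOn.union ?_ ?_
  · refine h2.mono' hm2.aestronglyMeasurable (ae_of_all _ fun w => ?_)
    rw [Real.norm_of_nonneg (by positivity), ← one_div_pow]
    exact pow_le_pow_left₀ (norm_nonneg _) (norm_regCauchyKernel_le_inv hδ _) 2
  · refine h1.mono' hm2.aestronglyMeasurable (ae_of_all _ fun w => ?_)
    rw [Real.norm_of_nonneg (by positivity), ← one_div_pow, norm_sub_rev w z]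
    exact pow_le_pow_left₀ (norm_nonneg _) (norm_regCauchyKernel_le_inv_norm hδ _) 2

theorem regCauchyTransform_congr {f g : ℂ → ℂ} (h : f =ᵐ[μ] g) (δ : ℝ) :
    regCauchyTransform μ δ f = regCauchyTransform μ δ g := by
  ext z
  refine integral_congr_ae ?_
  filter_upwards [h] with w hw
  rw [hw]

theorem IsNiceMeasure.integrable_regCauchyKernel_mul (h : IsNiceMeasure μ C₀) (hC : 0 < C₀)
    (hδ : 0 < δ) {f : ℂ → ℂ} (hf : MemLp f 2 μ) (z : ℂ) :
    Integrable (fun w => regCauchyKernel δ (z - w) * f w) μ :=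
  (h.memLp_regCauchyKernel hC hδ z).integrable_mul hf

theorem IsNiceMeasure.regCauchyTransform_add (h : IsNiceMeasure μ C₀) (hC : 0 < C₀) (hδ : 0 < δ)
    {f g : ℂ → ℂ} (hf : MemLp f 2 μ) (hg : MemLp g 2 μ) :
    regCauchyTransform μ δ (f + g) = regCauchyTransform μ δ f + regCauchyTransform μ δ g := by
  ext z
  simp only [regCauchyTransform, Pi.add_apply, mul_add]
  exact integral_add (h.integrable_regCauchyKernel_mul hC hδ hf z)
    (h.integrable_regCauchyKernel_mul hC hδ hg z)

theorem regCauchyTransform_smul (c : ℂ) (f : ℂ → ℂ) :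
    regCauchyTransform μ δ (c • f) = c • regCauchyTransform μ δ f := by
  ext z
  simp only [regCauchyTransform, Pi.smul_apply, smul_eq_mul]
  rw [← integral_const_mul]
  congr 1
  ext w
  ring

/-- The regularized Cauchy transform as a bounded operator on `L²(μ)`. -/
noncomputable def regCauchyOperator (h : IsGoodMeasure μ C₀) (hC : 0 < C₀) (hδ : 0 < δ) :
    Lp ℂ 2 μ →L[ℂ] Lp ℂ 2 μ :=
  LinearMap.mkContinuous
    { toFun := fun f => (h.2 δ hδ f (Lp.memLp f)).1.toLp
      map_add' := fun f g => by
        rw [← MemLp.toLp_add]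
        refine MemLp.toLp_congr _ _ ?_
        rw [regCauchyTransform_congr (Lp.coeFn_add f g),
          h.1.regCauchyTransform_add hC hδ (Lp.memLp f) (Lp.memLp g)]
      map_smul' := fun c f => by
        rw [RingHom.id_apply, ← MemLp.toLp_const_smul]
        refine MemLp.toLp_congr _ _ ?_
        rw [regCauchyTransform_congr (Lp.coeFn_smul c f), regCauchyTransform_smul] }
    C₀ (fun f => by
      rw [LinearMap.coe_mk, AddHom.coe_mk, Lp.norm_toLp, Lp.norm_def]
      refine ENNReal.toReal_le_of_le_ofReal (by positivity) ?_
      rw [ENNReal.ofReal_mul hC.le, ENNReal.ofReal_toReal (Lp.eLpNorm_ne_top f)]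
      exact (h.2 δ hδ f (Lp.memLp f)).2)

theorem norm_regCauchyOperator_apply_le (h : IsGoodMeasure μ C₀) (hC : 0 < C₀) (hδ : 0 < δ)
    (f : Lp ℂ 2 μ) : ‖regCauchyOperator h hC hδ f‖ ≤ C₀ * ‖f‖ :=
  ContinuousLinearMap.le_of_opNorm_le _ (LinearMap.mkContinuous_norm_le _ hC.le _) f

theorem measurePairing_congr {f f' g g' : ℂ → ℂ} (hf : f =ᵐ[μ] f') (hg : g =ᵐ[μ] g') :
    measurePairing μ f g = measurePairing μ f' g' := by
  refine integral_congr_ae ?_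
  filter_upwards [hf, hg] with z h1 h2
  rw [h1, h2]

theorem measurePairing_star_eq_inner (u g : Lp ℂ 2 μ) :
    measurePairing μ u (star g : Lp ℂ 2 μ) = inner ℂ g u := by
  rw [L2.inner_def, measurePairing]
  refine integral_congr_ae ?_
  filter_upwards [Lp.coeFn_star g] with z hz
  simp [hz]

theorem measurePairing_eq_inner (u g : Lp ℂ 2 μ) :
    measurePairing μ u g = inner ℂ (star g) u := by
  rw [← measurePairing_star_eq_inner, star_star]

theorem norm_lpStar (g : Lp ℂ 2 μ) : ‖star g‖ = ‖g‖ := by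
  rw [Lp.norm_def, Lp.norm_def]
  congr 1
  refine eLpNorm_congr_norm_ae ?_
  filter_upwards [Lp.coeFn_star g] with z hz
  simp [hz]

theorem lpStar_sub (g g' : Lp ℂ 2 μ) : star (g - g') = star g - star g' := by
  refine Lp.ext ?_
  filter_upwards [Lp.coeFn_star g, Lp.coeFn_star g', Lp.coeFn_star (g - g'), Lp.coeFn_sub g g',
    Lp.coeFn_sub (star g) (star g')] with z h1 h2 h3 h4 h5
  rw [h3, h5, Pi.star_apply, h4, Pi.sub_apply, Pi.sub_apply, h1, h2, star_sub, Pi.star_apply,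
    Pi.star_apply]

theorem norm_measurePairing_le (u g : Lp ℂ 2 μ) : ‖measurePairing μ u g‖ ≤ ‖u‖ * ‖g‖ := by
  rw [measurePairing_eq_inner, mul_comm, ← norm_lpStar g]
  exact norm_inner_le_norm _ _

theorem measurePairing_regCauchyOperator (h : IsGoodMeasure μ C₀) (hC : 0 < C₀) (hδ : 0 < δ)
    (f g : Lp ℂ 2 μ) :
    measurePairing μ (regCauchyOperator h hC hδ f) g =
      measurePairing μ (regCauchyTransform μ δ f) g :=
  measurePairing_congr (MemLp.coeFn_toLp (h.2 δ hδ f (Lp.memLp f)).1) EventuallyEq.rfl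

/-- Completeness: approximation by convergent functions to any precision makes `u` Cauchy along the
filter. This is the abstract half of the density argument. -/
theorem exists_tendsto_of_approx {ι : Type*} {l : Filter ι} [l.NeBot] {u : ι → ℂ}
    (h : ∀ ε > 0, ∃ v : ι → ℂ, (∃ a, Tendsto v l (𝓝 a)) ∧ ∀ᶠ i in l, ‖u i - v i‖ ≤ ε) :
    ∃ a, Tendsto u l (𝓝 a) := by
  rw [← cauchy_map_iff_exists_tendsto, Metric.cauchy_iff]
  refine ⟨inferInstance, fun ε hε => ?_⟩
  obtain ⟨v, ⟨a, hv⟩, huv⟩ := h (ε / 8) (by positivity)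
  have h1 : ∀ᶠ i in l, v i ∈ Metric.ball a (ε / 8) := hv (Metric.ball_mem_nhds a (by positivity))
  refine ⟨Metric.ball a (ε / 2), ?_, fun x hx y hy => ?_⟩
  · rw [mem_map]
    filter_upwards [huv, h1] with i h2 h3
    rw [Set.mem_preimage]
    rw [Metric.mem_ball, dist_eq_norm] at *
    calc ‖u i - a‖ = ‖(u i - v i) + (v i - a)‖ := by ring_nf
      _ ≤ ‖u i - v i‖ + ‖v i - a‖ := norm_add_le _ _
      _ < ε / 2 := by linarith
  · rw [Metric.mem_ball] at hx hy
    linarith [dist_triangle_right x y a]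

theorem exists_lipschitz_approx [IsLocallyFiniteMeasure μ] (f : Lp ℂ 2 μ) {ε : ℝ} (hε : 0 < ε) :
    ∃ (f' : Lp ℂ 2 μ) (g : ℂ → ℂ) (K : ℝ≥0), ‖f - f'‖ ≤ ε ∧ f' =ᵐ[μ] g ∧ HasCompactSupport g ∧
      LipschitzWith K g := by
  obtain ⟨f', ⟨g, hg1, hg2, hg3⟩, hf'⟩ :=
    (MeasureTheory.Lp.dense_hasCompactSupport_contDiff (E := ℂ) (F := ℂ) (μ := μ) (p := 2)
      (by norm_num)).exists_dist_lt f hε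
  obtain ⟨K, hK⟩ := ContDiff.lipschitzWith_of_hasCompactSupport hg2 hg3 (by simp)
  exact ⟨f', g, K, by rw [← dist_eq_norm]; exact hf'.le, hg1, hg2, hK⟩

/-- Density of compactly supported Lipschitz functions, for which the limit is known, together with
the operator bound uniform in `δ`. -/
theorem IsGoodMeasure.exists_tendsto (h : IsGoodMeasure μ C₀) (hC : 0 < C₀) (f g : Lp ℂ 2 μ) :
    ∃ a, Tendsto (fun δ : ℝ => measurePairing μ (regCauchyTransform μ δ f) g) (𝓝[>] 0) (𝓝 a) := by
  have := h.1.isLocallyFiniteMeasure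
  refine exists_tendsto_of_approx fun ε hε => ?_
  -- `g` is approximated first, because the precision required for `f` involves the norm of `g'`.
  obtain ⟨g', gl, Kg, hg1, hg2, hg3, hg4⟩ := exists_lipschitz_approx g
    (ε := ε / (2 * C₀ * (‖f‖ + 1))) (by positivity)
  obtain ⟨f', fl, Kf, hf1, hf2, hf3, hf4⟩ := exists_lipschitz_approx f
    (ε := ε / (2 * C₀ * (‖g'‖ + 1))) (by positivity)
  refine ⟨fun δ => measurePairing μ (regCauchyTransform μ δ f') g',
    ⟨symmCauchyForm μ fl gl, ?_⟩, ?_⟩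
  · have := tendsto_measurePairing_of_lipschitz (μ := μ) hf4 hg4 hf3 hg3
    refine this.congr fun δ => ?_
    rw [regCauchyTransform_congr hf2]
    exact measurePairing_congr EventuallyEq.rfl hg2.symm
  · filter_upwards [self_mem_nhdsWithin] with δ hδ
    rw [← measurePairing_regCauchyOperator h hC hδ, ← measurePairing_regCauchyOperator h hC hδ,
      measurePairing_eq_inner, measurePairing_eq_inner]
    set T := regCauchyOperator h hC hδ with hT
    have hT' : ∀ x, ‖T x‖ ≤ C₀ * ‖x‖ := norm_regCauchyOperator_apply_le h hC hδ
    have e1 : inner ℂ (star g) (T f) - inner ℂ (star g') (T f') =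
        inner ℂ (star (g - g')) (T f) + inner ℂ (star g') (T (f - f')) := by
      rw [lpStar_sub, inner_sub_left, map_sub, inner_sub_right]
      ring
    rw [e1]
    calc _ ≤ ‖star (g - g')‖ * ‖T f‖ + ‖star g'‖ * ‖T (f - f')‖ :=
          (norm_add_le _ _).trans (add_le_add (norm_inner_le_norm _ _) (norm_inner_le_norm _ _))
      _ ≤ (ε / (2 * C₀ * (‖f‖ + 1))) * (C₀ * (‖f‖ + 1)) +
          (‖g'‖ + 1) * (C₀ * (ε / (2 * C₀ * (‖g'‖ + 1)))) := by
          rw [norm_lpStar, norm_lpStar]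
          have a1 := hT' f
          have a2 := hT' (f - f')
          gcongr
          · exact a1.trans (by gcongr; linarith)
          · linarith
          · exact a2.trans (by gcongr)
      _ = ε := by
          field_simp
          norm_num

/-- The limits form a bounded bilinear form. Inserting `star` makes it sesquilinear, and the Riesz
representation yields the operator, as an adjoint because the test function occupies the first slot.
-/
theorem IsGoodMeasure.exists_isWeakCauchyLimit (h : IsGoodMeasure μ C₀) (hC : 0 < C₀) :
    ∃ T : Lp ℂ 2 μ →L[ℂ] Lp ℂ 2 μ, IsWeakCauchyLimit μ T := by
  choose L hL using h.exists_tendsto hC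
  have hpos : ∀ᶠ δ : ℝ in 𝓝[>] 0, 0 < δ := self_mem_nhdsWithin
  have hLb : ∀ f g, ‖L f g‖ ≤ C₀ * ‖g‖ * ‖f‖ := by
    intro f g
    refine le_of_tendsto (hL f g).norm ?_
    filter_upwards [hpos] with δ hδ
    rw [← measurePairing_regCauchyOperator h hC hδ]
    refine (norm_measurePairing_le _ _).trans ?_
    have := norm_regCauchyOperator_apply_le h hC hδ f
    nlinarith [norm_nonneg g]
  have hadd_left : ∀ f f' g, L (f + f') g = L f g + L f' g := by
    intro f f' g
    refine tendsto_nhds_unique (hL (f + f') g) (((hL f g).add (hL f' g)).congr' ?_)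
    filter_upwards [hpos] with δ hδ
    simp only [← measurePairing_regCauchyOperator h hC hδ, measurePairing_eq_inner, map_add,
      inner_add_right]
  have hsmul_left : ∀ (c : ℂ) f g, L (c • f) g = c * L f g := by
    intro c f g
    refine tendsto_nhds_unique (hL (c • f) g) (((hL f g).const_mul c).congr' ?_)
    filter_upwards [hpos] with δ hδ
    simp only [← measurePairing_regCauchyOperator h hC hδ, measurePairing_eq_inner, map_smul,
      inner_smul_right]
  have hadd_right : ∀ f g g', L f (star (g + g')) = L f (star g) + L f (star g') := by
    intro f g g'
    refine tendsto_nhds_unique (hL f _) (((hL f _).add (hL f _)).congr' ?_)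
    filter_upwards [hpos] with δ hδ
    simp only [← measurePairing_regCauchyOperator h hC hδ, measurePairing_eq_inner, star_star,
      inner_add_left]
  have hsmul_right : ∀ (c : ℂ) f g, L f (star (c • g)) = (starRingEnd ℂ) c * L f (star g) := by
    intro c f g
    refine tendsto_nhds_unique (hL f _) (((hL f _).const_mul _).congr' ?_)
    filter_upwards [hpos] with δ hδ
    simp only [← measurePairing_regCauchyOperator h hC hδ, measurePairing_eq_inner, star_star,
      inner_smul_left]
  let B : Lp ℂ 2 μ →L⋆[ℂ] Lp ℂ 2 μ →L[ℂ] ℂ :=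
    LinearMap.mkContinuous₂
      (LinearMap.mk₂'ₛₗ (starRingEnd ℂ) (RingHom.id ℂ) (fun g f => L f (star g))
        (fun g g' f => hadd_right f g g') (fun c g f => hsmul_right c f g)
        (fun g f f' => hadd_left f f' _) (fun c g f => hsmul_left c f _)) C₀
      (fun g f => by simpa [norm_lpStar] using hLb f (star g))
  refine ⟨(InnerProductSpace.continuousLinearMapOfBilin B).adjoint, fun f g => ?_⟩
  rw [measurePairing_eq_inner, ContinuousLinearMap.adjoint_inner_right,
    InnerProductSpace.continuousLinearMapOfBilin_apply]
  simpa [B] using hL f g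

/-- Rules out the default value `0` in the definition of `cauchyOperator`. -/
theorem IsGoodMeasure.isWeakCauchyLimit_cauchyOperator (h : IsGoodMeasure μ C₀) (hC : 0 < C₀) :
    IsWeakCauchyLimit μ (cauchyOperator μ) := by
  have hex := h.exists_isWeakCauchyLimit hC
  rw [cauchyOperator, dif_pos hex]
  exact hex.choose_spec

end WeakLimit

/-! ### Errors from far away, and the quadratic identity. -/

section Estimates

variable {μ : Measure ℂ} {C₀ δ : ℝ}

theorem measurePairing_regCauchyTransform_add_left [SFinite μ] (hδ : 0 < δ) {f f' g : ℂ → ℂ}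
    (hf : Integrable f μ) (hf' : Integrable f' μ) (hg : Integrable g μ) :
    measurePairing μ (regCauchyTransform μ δ (fun z => f z + f' z)) g =
      measurePairing μ (regCauchyTransform μ δ f) g +
        measurePairing μ (regCauchyTransform μ δ f') g := by
  rw [measurePairing_regCauchyTransform (f := fun z => f z + f' z) hδ (hf.add hf') hg,
    measurePairing_regCauchyTransform hδ hf hg, measurePairing_regCauchyTransform hδ hf' hg,
    ← integral_add (integrable_regCauchyKernel_mul_prod hδ hf hg)
      (integrable_regCauchyKernel_mul_prod hδ hf' hg)]
  congr 1
  ext p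
  ring

theorem measurePairing_regCauchyTransform_add_right [SFinite μ] (hδ : 0 < δ) {f g g' : ℂ → ℂ}
    (hf : Integrable f μ) (hg : Integrable g μ) (hg' : Integrable g' μ) :
    measurePairing μ (regCauchyTransform μ δ f) (fun z => g z + g' z) =
      measurePairing μ (regCauchyTransform μ δ f) g +
        measurePairing μ (regCauchyTransform μ δ f) g' := by
  rw [measurePairing_regCauchyTransform (g := fun z => g z + g' z) hδ hf (hg.add hg'),
    measurePairing_regCauchyTransform hδ hf hg, measurePairing_regCauchyTransform hδ hf hg',
    ← integral_add (integrable_regCauchyKernel_mul_prod hδ hf hg)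
      (integrable_regCauchyKernel_mul_prod hδ hf hg')]
  congr 1
  ext p
  ring

theorem measurePairing_const_mul_right (f g : ℂ → ℂ) (c : ℂ) :
    measurePairing μ f (fun z => c * g z) = c * measurePairing μ f g := by
  simp only [measurePairing]
  rw [← integral_const_mul]
  congr 1
  ext z
  ring

theorem IsNiceMeasure.integral_norm_le_of_bounded (h : IsNiceMeasure μ C₀) (hC : 0 < C₀) {c : ℂ}
    {r F : ℝ} (hr : 0 < r) (hF : 0 ≤ F) {f : ℂ → ℂ}
    (hf : ∀ᵐ w ∂μ, ‖f w‖ ≤ F) (hf0 : ∀ w ∉ Metric.ball c r, f w = 0) :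
    ∫ w, ‖f w‖ ∂μ ≤ F * (C₀ * r) := by
  have h1 : Integrable ((Metric.ball c r).indicator fun _ => F) μ :=
    (integrable_indicator_iff Metric.isOpen_ball.measurableSet).2
      (integrableOn_const (h.measure_ball_lt_top c r).ne)
  calc ∫ w, ‖f w‖ ∂μ ≤ ∫ w, (Metric.ball c r).indicator (fun _ => F) w ∂μ := by
        refine integral_mono_of_nonneg (ae_of_all _ fun w => norm_nonneg _) h1 ?_
        filter_upwards [hf] with w hw
        by_cases hb : w ∈ Metric.ball c r
        · rwa [Set.indicator_of_mem hb]
        · rw [Set.indicator_of_notMem hb, hf0 w hb, norm_zero]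
    _ = μ.real (Metric.ball c r) * F := by
        rw [integral_indicator Metric.isOpen_ball.measurableSet, setIntegral_const, smul_eq_mul]
    _ ≤ F * (C₀ * r) := by
        rw [mul_comm]
        gcongr
        exact h.measureReal_ball_le hC c hr

theorem IsNiceMeasure.norm_toLp_le_of_bounded (h : IsNiceMeasure μ C₀) (hC : 0 < C₀) {c : ℂ}
    {r F : ℝ} (hr : 0 < r) (hF : 0 ≤ F) {f : ℂ → ℂ} (hfm : AEStronglyMeasurable f μ)
    (hf : ∀ᵐ w ∂μ, ‖f w‖ ≤ F) (hf0 : ∀ w ∉ Metric.ball c r, f w = 0) :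
    ∃ hm : MemLp f 2 μ, ‖hm.toLp‖ ≤ F * √(C₀ * r) := by
  have key : eLpNorm f 2 μ ≤ ENNReal.ofReal (F * √(C₀ * r)) := by
    calc eLpNorm f 2 μ ≤ eLpNorm ((Metric.ball c r).indicator fun _ => F) 2 μ := by
          refine eLpNorm_mono_ae ?_
          filter_upwards [hf] with w hw
          by_cases hb : w ∈ Metric.ball c r
          · rwa [Set.indicator_of_mem hb, Real.norm_of_nonneg hF]
          · rw [Set.indicator_of_notMem hb, hf0 w hb, norm_zero, norm_zero]
      _ = ENNReal.ofReal F * μ (Metric.ball c r) ^ (1 / 2 : ℝ) := by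
          rw [eLpNorm_indicator_const Metric.isOpen_ball.measurableSet (by norm_num) (by norm_num),
            Real.enorm_of_nonneg hF]
          norm_num
      _ ≤ ENNReal.ofReal F * ENNReal.ofReal (C₀ * r) ^ (1 / 2 : ℝ) := by
          gcongr
          exact h c r hr
      _ = ENNReal.ofReal (F * √(C₀ * r)) := by
          rw [ENNReal.ofReal_rpow_of_nonneg (by positivity) (by norm_num), ← ENNReal.ofReal_mul hF,
            Real.sqrt_eq_rpow]
  have hm : MemLp f 2 μ := ⟨hfm, key.trans_lt ENNReal.ofReal_lt_top⟩
  refine ⟨hm, ?_⟩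
  rw [Lp.norm_toLp]
  exact ENNReal.toReal_le_of_le_ofReal (by positivity) key

/-- Cauchy-Schwarz and the `L²` bound, for pairs whose supports may overlap: each function has norm
at most its sup times `√(C₀ * r)`. -/
theorem IsGoodMeasure.norm_pairing_le_of_bounded (h : IsGoodMeasure μ C₀) (hC : 0 < C₀)
    (hδ : 0 < δ) {c : ℂ} {r F G : ℝ} (hr : 0 < r) (hF : 0 ≤ F) (hG : 0 ≤ G) {f g : ℂ → ℂ}
    (hfm : AEStronglyMeasurable f μ) (hgm : AEStronglyMeasurable g μ)
    (hf : ∀ᵐ w ∂μ, ‖f w‖ ≤ F) (hg : ∀ᵐ w ∂μ, ‖g w‖ ≤ G)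
    (hf0 : ∀ w ∉ Metric.ball c r, f w = 0) (hg0 : ∀ w ∉ Metric.ball c r, g w = 0) :
    ‖measurePairing μ (regCauchyTransform μ δ f) g‖ ≤ C₀ ^ 2 * F * G * r := by
  obtain ⟨hf2, hfn⟩ := h.1.norm_toLp_le_of_bounded hC hr hF hfm hf hf0
  obtain ⟨hg2, hgn⟩ := h.1.norm_toLp_le_of_bounded hC hr hG hgm hg hg0
  have e1 : measurePairing μ (regCauchyTransform μ δ f) g =
      measurePairing μ (regCauchyOperator h hC hδ hf2.toLp) hg2.toLp := by
    rw [measurePairing_regCauchyOperator, regCauchyTransform_congr hf2.coeFn_toLp]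
    exact measurePairing_congr EventuallyEq.rfl hg2.coeFn_toLp.symm
  rw [e1]
  calc _ ≤ (C₀ * ‖hf2.toLp‖) * ‖hg2.toLp‖ := by
        refine (norm_measurePairing_le _ _).trans ?_
        gcongr
        exact norm_regCauchyOperator_apply_le h hC hδ _
    _ ≤ (C₀ * (F * √(C₀ * r))) * (G * √(C₀ * r)) := by gcongr
    _ = C₀ * F * G * (√(C₀ * r) * √(C₀ * r)) := by ring
    _ = C₀ ^ 2 * F * G * r := by
        rw [Real.mul_self_sqrt (by positivity)]
        ring

/-- The kernel is frozen at the centre of `g`. On separated supports the error is at most `2 * ‖w -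
c‖ / ‖ξ - c‖ ^ 2`, integrable in `ξ`, and the frozen kernel leaves the factor `∫ g`. Truncating the
frozen kernel at `r` changes nothing where `f` is non-zero. -/
theorem IsNiceMeasure.norm_pairing_le_of_separated (h : IsNiceMeasure μ C₀) (hC : 0 < C₀)
    (hδ : 0 < δ) {c : ℂ} {r : ℝ} (hδr : δ ≤ r) {f g : ℂ → ℂ}
    (hfi : Integrable f μ) (hgi : Integrable g μ) (hf1 : ∀ w, ‖f w‖ ≤ 1)
    (hf0 : ∀ w, ‖w - c‖ < 2 * r → f w = 0) (hg0 : ∀ w, r < ‖w - c‖ → g w = 0) :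
    ‖measurePairing μ (regCauchyTransform μ δ f) g‖ ≤
      4 * C₀ / r * ∫ w, ‖w - c‖ * ‖g w‖ ∂μ +
        ‖∫ w, regCauchyKernel r (w - c) * f w ∂μ‖ * ‖∫ w, g w ∂μ‖ := by
  have := h.isLocallyFiniteMeasure
  have hr : 0 < r := hδ.trans_le hδr
  have hfr : Integrable (fun w => regCauchyKernel r (w - c) * f w) μ :=
    hfi.bdd_mul (c := 1 / r) ((continuous_regCauchyKernel hr).comp
      (by fun_prop : Continuous fun w : ℂ => w - c)).aestronglyMeasurable
      (ae_of_all _ fun p => norm_regCauchyKernel_le_inv hr _)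
  have hgw : Integrable (fun w => ‖w - c‖ * ‖g w‖) μ := by
    refine (hgi.norm.const_mul r).mono'
      ((by fun_prop : Continuous fun w : ℂ => ‖w - c‖).aestronglyMeasurable.mul
        hgi.aestronglyMeasurable.norm) (ae_of_all _ fun w => ?_)
    rw [Real.norm_of_nonneg (by positivity)]
    rcases le_or_gt ‖w - c‖ r with hw | hw
    · gcongr
    · simp [hg0 w hw]
  have hK := integrable_regCauchyKernel_mul_prod hδ hfi hgi
  have hR : Integrable (fun p : ℂ × ℂ => g p.1 * (regCauchyKernel r (p.2 - c) * f p.2))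
      (μ.prod μ) := hgi.mul_prod hfr
  set s : Set ℂ := {w | 2 * r ≤ ‖w - c‖} with hs
  have hsm : MeasurableSet s := measurableSet_le_norm_sub c (2 * r)
  have hsi : Integrable (s.indicator fun w => 1 / ‖w - c‖ ^ 2) μ :=
    (integrable_indicator_iff hsm).2 (h.integrableOn_inv_sq hC c (by positivity))
  have e1 : measurePairing μ (regCauchyTransform μ δ f) g =
      (∫ p : ℂ × ℂ, (regCauchyKernel δ (p.1 - p.2) * (f p.2 * g p.1) +
        g p.1 * (regCauchyKernel r (p.2 - c) * f p.2)) ∂(μ.prod μ)) -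
      (∫ w, g w ∂μ) * ∫ w, regCauchyKernel r (w - c) * f w ∂μ := by
    rw [integral_add hK hR, integral_prod_mul (μ := μ) (ν := μ) g
      (fun w => regCauchyKernel r (w - c) * f w), measurePairing_regCauchyTransform hδ hfi hgi]
    ring
  have hpt : ∀ p : ℂ × ℂ, ‖regCauchyKernel δ (p.1 - p.2) * (f p.2 * g p.1) +
      g p.1 * (regCauchyKernel r (p.2 - c) * f p.2)‖ ≤
      2 * ((‖p.1 - c‖ * ‖g p.1‖) * s.indicator (fun w => 1 / ‖w - c‖ ^ 2) p.2) := by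
    rintro ⟨w, ξ⟩
    have hind : 0 ≤ s.indicator (fun w => 1 / ‖w - c‖ ^ 2) ξ :=
      Set.indicator_nonneg (fun _ _ => by positivity) _
    rcases le_or_gt ‖w - c‖ r with hw | hw
    · rcases lt_or_ge ‖ξ - c‖ (2 * r) with hξ | hξ
      · simp only [hf0 ξ hξ, zero_mul, mul_zero, add_zero, norm_zero]
        positivity
      · have hd : ‖ξ - c‖ / 2 ≤ ‖w - ξ‖ := by
          have : ‖ξ - c‖ ≤ ‖w - ξ‖ + ‖w - c‖ := by
            rw [norm_sub_rev w ξ]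
            simpa using norm_add_le (ξ - w) (w - c)
          linarith
        have hξ0 : 0 < ‖ξ - c‖ := by linarith
        have hne : w - ξ ≠ 0 := norm_pos_iff.1 (by linarith)
        have hne' : ξ - c ≠ 0 := norm_pos_iff.1 hξ0
        rw [regCauchyKernel_of_le hδ (by linarith), regCauchyKernel_of_le hr (by linarith),
          Set.indicator_of_mem (show ξ ∈ s from hξ)]
        have e2 : 1 / (w - ξ) * (f ξ * g w) + g w * (1 / (ξ - c) * f ξ) =
            f ξ * (g w * ((w - c) / ((w - ξ) * (ξ - c)))) := by
          field_simp
          ring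
        rw [e2, norm_mul, norm_mul, norm_div, norm_mul]
        calc ‖f ξ‖ * (‖g w‖ * (‖w - c‖ / (‖w - ξ‖ * ‖ξ - c‖)))
            ≤ 1 * (‖g w‖ * (‖w - c‖ / (‖ξ - c‖ / 2 * ‖ξ - c‖))) := by
              gcongr
              exact hf1 ξ
          _ = 2 * ((‖w - c‖ * ‖g w‖) * (1 / ‖ξ - c‖ ^ 2)) := by
              field_simp
    · simp [hg0 w hw]
  have hgs := hgw.mul_prod hsi
  rw [e1]
  refine (norm_sub_le _ _).trans (add_le_add ?_ ?_)
  · calc _ ≤ ∫ p : ℂ × ℂ, 2 * ((‖p.1 - c‖ * ‖g p.1‖) *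
          s.indicator (fun w => 1 / ‖w - c‖ ^ 2) p.2) ∂(μ.prod μ) :=
          norm_integral_le_of_norm_le (hgs.const_mul 2) (ae_of_all _ hpt)
      _ = 2 * ((∫ w, ‖w - c‖ * ‖g w‖ ∂μ) * ∫ w in s, 1 / ‖w - c‖ ^ 2 ∂μ) := by
          rw [integral_const_mul, ← integral_indicator hsm]
          congr 1
          exact integral_prod_mul (fun w => ‖w - c‖ * ‖g w‖) (s.indicator fun w => 1 / ‖w - c‖ ^ 2)
      _ ≤ 2 * ((∫ w, ‖w - c‖ * ‖g w‖ ∂μ) * (4 * C₀ / (2 * r))) := by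
          gcongr
          exact h.setIntegral_inv_sq_le hC c (by positivity)
      _ = _ := by
          ring
  · rw [norm_mul, mul_comm]

/-- Meant for `f` equal to `χ_F` minus a cutoff and `g` a mean-zero test function. The inner part of
`g` against the near part of `f`, and all of `g` against the far part of `f`, are separated pairs;
the remaining overlap involves only values of `g` bounded by `G` and is left to the `L²` bound. -/
theorem IsGoodMeasure.norm_pairing_le_of_integral_eq_zero (h : IsGoodMeasure μ C₀) (hC : 0 < C₀)
    (hδ : 0 < δ) {c : ℂ} {ρ G : ℝ} (hδρ : δ ≤ ρ / 2) (hG : 0 ≤ G) {f g : ℂ → ℂ}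
    (hfi : Integrable f μ) (hgi : Integrable g μ) (hf1 : ∀ w, ‖f w‖ ≤ 1)
    (hf0 : ∀ w, ‖w - c‖ < ρ → f w = 0) (hg0 : ∀ w, 2 * ρ < ‖w - c‖ → g w = 0)
    (hgG : ∀ᵐ w ∂μ, ρ / 2 < ‖w - c‖ → ‖g w‖ ≤ G) (hgint : ∫ w, g w ∂μ = 0) :
    ‖measurePairing μ (regCauchyTransform μ δ f) g‖ ≤
      20 * C₀ ^ 2 * ρ * G + 10 * C₀ / ρ * ∫ w, ‖w - c‖ * ‖g w‖ ∂μ := by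
  have := h.1.isLocallyFiniteMeasure
  have hρ : 0 < ρ := by linarith
  set B := Metric.ball c (4 * ρ) with hB
  set D := Metric.closedBall c (ρ / 2) with hD
  have hBm : MeasurableSet B := Metric.isOpen_ball.measurableSet
  have hDm : MeasurableSet D := Metric.isClosed_closedBall.measurableSet
  set f₁ := B.indicator f with hf₁
  set f₂ := Bᶜ.indicator f with hf₂
  set g₁ := D.indicator g with hg₁
  set g₂ := Dᶜ.indicator g with hg₂
  have hfs : f = fun z => f₁ z + f₂ z := by
    ext z
    exact (congrFun (Set.indicator_self_add_compl B f) z).symm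
  have hgs : g = fun z => g₁ z + g₂ z := by
    ext z
    exact (congrFun (Set.indicator_self_add_compl D g) z).symm
  have hf₁i : Integrable f₁ μ := hfi.indicator hBm
  have hf₂i : Integrable f₂ μ := hfi.indicator hBm.compl
  have hg₁i : Integrable g₁ μ := hgi.indicator hDm
  have hg₂i : Integrable g₂ μ := hgi.indicator hDm.compl
  have hf₁b : ∀ w, ‖f₁ w‖ ≤ 1 := fun w => (norm_indicator_le_norm_self _ _).trans (hf1 w)
  have hf₂b : ∀ w, ‖f₂ w‖ ≤ 1 := fun w => (norm_indicator_le_norm_self _ _).trans (hf1 w)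
  have hf₁0 : ∀ w, ‖w - c‖ < ρ → f₁ w = 0 := fun w hw => by
    simp [hf₁, hf0 w hw]
  have hf₁s : ∀ w ∉ B, f₁ w = 0 := fun w hw => Set.indicator_of_notMem hw _
  have hg₂0 : ∀ w ∉ B, g₂ w = 0 := fun w hw => by
    have : 2 * ρ < ‖w - c‖ := by
      rw [hB, Metric.mem_ball, dist_eq_norm, not_lt] at hw
      linarith
    simp [hg₂, hg0 w this]
  have hg₂G : ∀ᵐ w ∂μ, ‖g₂ w‖ ≤ G := by
    filter_upwards [hgG] with w hw
    by_cases hwD : w ∈ D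
    · simpa [hg₂, hwD] using hG
    · rw [hg₂, Set.indicator_of_mem (by simpa using hwD)]
      refine hw ?_
      rwa [hD, Metric.mem_closedBall, dist_eq_norm, not_le] at hwD
  have hWle : ∫ w, ‖w - c‖ * ‖g₁ w‖ ∂μ ≤ ∫ w, ‖w - c‖ * ‖g w‖ ∂μ := by
    refine integral_mono_of_nonneg (ae_of_all _ fun w => by positivity) ?_
      (ae_of_all _ fun w => ?_)
    · refine (hgi.norm.const_mul (2 * ρ)).mono'
        ((by fun_prop : Continuous fun w : ℂ => ‖w - c‖).aestronglyMeasurable.mul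
          hgi.aestronglyMeasurable.norm) (ae_of_all _ fun w => ?_)
      rw [Real.norm_of_nonneg (by positivity)]
      rcases le_or_gt ‖w - c‖ (2 * ρ) with hw | hw
      · gcongr
      · simp [hg0 w hw]
    · dsimp only
      gcongr
      exact norm_indicator_le_norm_self _ _
  have hg₂int : ∫ w, ‖g₂ w‖ ∂μ ≤ G * (C₀ * (4 * ρ)) :=
    h.1.integral_norm_le_of_bounded hC (by positivity) hG hg₂G hg₂0
  have hg₁int : ‖∫ w, g₁ w ∂μ‖ ≤ G * (C₀ * (4 * ρ)) := by
    have e : ∫ w, g₁ w ∂μ = -∫ w, g₂ w ∂μ := by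
      rw [eq_neg_iff_add_eq_zero, ← integral_add hg₁i hg₂i, ← hgint]
      conv_rhs => rw [hgs]
    rw [e, norm_neg]
    -- As `g` has mean zero, the integral of its inner part is controlled by that of its small outer
    -- part.
    exact (norm_integral_le_integral_norm _).trans hg₂int
  have hJ : ‖∫ w, regCauchyKernel (ρ / 2) (w - c) * f₁ w ∂μ‖ ≤ 1 / ρ * (C₀ * (4 * ρ)) := by
    refine (norm_integral_le_integral_norm _).trans ?_
    refine h.1.integral_norm_le_of_bounded (c := c) hC (by positivity) (by positivity)
      (ae_of_all _ fun w => ?_) fun w hw => by simp [hf₁s w hw]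
    rcases lt_or_ge ‖w - c‖ ρ with hw | hw
    · rw [hf₁0 w hw, mul_zero, norm_zero]
      positivity
    · rw [norm_mul]
      calc _ ≤ 1 / ‖w - c‖ * 1 := by
            gcongr
            · exact norm_regCauchyKernel_le_inv_norm (by positivity) _
            · exact hf₁b w
        _ ≤ 1 / ρ := by
            rw [mul_one]
            exact one_div_le_one_div_of_le hρ hw
  have b1 := h.norm_pairing_le_of_bounded (f := f₁) (g := g₂) hC hδ (by positivity : 0 < 4 * ρ)
    zero_le_one hG hf₁i.aestronglyMeasurable hg₂i.aestronglyMeasurable (ae_of_all _ hf₁b) hg₂G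
    hf₁s hg₂0
  have b2 := h.1.norm_pairing_le_of_separated (c := c) hC hδ hδρ hf₁i hg₁i hf₁b
    (fun w hw => hf₁0 w (by linarith)) (fun w hw => by
      refine Set.indicator_of_notMem ?_ _
      simpa [hD, dist_eq_norm] using hw)
  have b3 := h.1.norm_pairing_le_of_separated (c := c) (r := 2 * ρ) hC hδ (by linarith) hf₂i hgi
    hf₂b (fun w hw => by
      refine Set.indicator_of_notMem ?_ _
      rw [Set.notMem_compl_iff, hB, Metric.mem_ball, dist_eq_norm]
      linarith) hg0
  rw [hgint, norm_zero, mul_zero, add_zero] at b3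
  have e1 : measurePairing μ (regCauchyTransform μ δ f) g =
      measurePairing μ (regCauchyTransform μ δ f₁) g₁ +
        measurePairing μ (regCauchyTransform μ δ f₁) g₂ +
        measurePairing μ (regCauchyTransform μ δ f₂) g := by
    rw [← measurePairing_regCauchyTransform_add_right hδ hf₁i hg₁i hg₂i, ← hgs,
      ← measurePairing_regCauchyTransform_add_left hδ hf₁i hf₂i hgi, ← hfs]
  rw [e1]
  set W := ∫ w, ‖w - c‖ * ‖g w‖ ∂μ with hW
  have b4 : ‖measurePairing μ (regCauchyTransform μ δ f₁) g₁‖ ≤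
      4 * C₀ / (ρ / 2) * W + 1 / ρ * (C₀ * (4 * ρ)) * (G * (C₀ * (4 * ρ))) := by
    refine b2.trans ?_
    gcongr
  refine (norm_add₃_le).trans ((add_le_add_three b4 b1 b3).trans (le_of_eq ?_))
  field_simp
  ring

theorem IsNiceMeasure.ae_prod_ne (h : IsNiceMeasure μ C₀) : ∀ᵐ p : ℂ × ℂ ∂(μ.prod μ), p.1 ≠ p.2 := by
  have := h.isLocallyFiniteMeasure
  have hm : MeasurableSet {p : ℂ × ℂ | p.1 ≠ p.2} :=
    (measurableSet_eq_fun measurable_fst measurable_snd).compl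
  rw [Measure.ae_prod_iff_ae_ae hm]
  refine ae_of_all _ fun w => ?_
  rw [ae_iff]
  have : {y : ℂ | ¬(w, y).1 ≠ (w, y).2} = {w} := by
    ext y
    simp [eq_comm]
  rw [this]
  exact h.measure_singleton w

/-- Since `1/(a-z) - 1/(a-w) = (z-w)/((a-z)(a-w))`, the singular factor cancels and the double
integral splits into squares. The regularization at `η` is invisible on the support, and the
diagonal, where the cancellation fails, is null. -/
theorem IsNiceMeasure.symmCauchyForm_eq (h : IsNiceMeasure μ C₀) {φ : ℂ → ℂ}
    (hφ : Continuous φ) (hφc : HasCompactSupport φ) {a b : ℂ} {η : ℝ} (hη : 0 < η)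
    (ha : ∀ w ∈ μ.support, η ≤ ‖w - a‖) (hb : ∀ w ∈ μ.support, η ≤ ‖w - b‖) :
    symmCauchyForm μ φ (fun w => φ w * (regCauchyKernel η (a - w) - regCauchyKernel η (b - w))) =
      1 / 2 * ((∫ w, φ w * regCauchyKernel η (a - w) ∂μ) ^ 2 -
        (∫ w, φ w * regCauchyKernel η (b - w) ∂μ) ^ 2) := by
  have := h.isLocallyFiniteMeasure
  have hint : ∀ x : ℂ, Integrable (fun w => φ w * regCauchyKernel η (x - w)) μ := fun x =>
    (hφ.mul ((continuous_regCauchyKernel hη).comp (by fun_prop))).integrable_of_hasCompactSupport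
      hφc.mul_right
  have hpr : ∀ x : ℂ, (∫ w, φ w * regCauchyKernel η (x - w) ∂μ) ^ 2 =
      ∫ p : ℂ × ℂ, (φ p.1 * regCauchyKernel η (x - p.1)) * (φ p.2 * regCauchyKernel η (x - p.2))
        ∂(μ.prod μ) := fun x => by
    rw [sq]
    exact (integral_prod_mul (μ := μ) (ν := μ) (fun w => φ w * regCauchyKernel η (x - w))
      (fun w => φ w * regCauchyKernel η (x - w))).symm
  have hker : ∀ x : ℂ, (∀ w ∈ μ.support, η ≤ ‖w - x‖) → ∀ w ∈ μ.support,
      x - w ≠ 0 ∧ regCauchyKernel η (x - w) = 1 / (x - w) := fun x hx w hw => by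
    have := hx w hw
    rw [norm_sub_rev] at this
    exact ⟨norm_pos_iff.1 (hη.trans_le this), regCauchyKernel_of_le hη this⟩
  rw [symmCauchyForm, hpr a, hpr b, ← integral_sub ((hint a).mul_prod (hint a))
    ((hint b).mul_prod (hint b))]
  congr 1
  refine integral_congr_ae ?_
  filter_upwards [h.ae_prod_ne,
    Measure.quasiMeasurePreserving_fst.ae (Measure.support_mem_ae (μ := μ)),
    Measure.quasiMeasurePreserving_snd.ae (Measure.support_mem_ae (μ := μ))] with p hp h1 h2
  obtain ⟨n1, k1⟩ := hker a ha _ h1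
  obtain ⟨n2, k2⟩ := hker a ha _ h2
  obtain ⟨n3, k3⟩ := hker b hb _ h1
  obtain ⟨n4, k4⟩ := hker b hb _ h2
  have n5 : p.1 - p.2 ≠ 0 := sub_ne_zero.2 hp
  rw [k1, k2, k3, k4]
  field_simp
  ring

end Estimates

/-! ### A Lipschitz radial cutoff. -/

section Cutoff

/-- The piecewise linear radial function equal to `1` at distance at most `r` from `c` and to `0` at
distance at least `2 r`. -/
noncomputable def radialCutoff (c : ℂ) (r : ℝ) (w : ℂ) : ℝ :=
  max 0 (min 1 (2 - ‖w - c‖ / r))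

variable {c w : ℂ} {r : ℝ}

theorem radialCutoff_nonneg (c : ℂ) (r : ℝ) (w : ℂ) : 0 ≤ radialCutoff c r w := le_max_left _ _

theorem radialCutoff_le_one (c : ℂ) (r : ℝ) (w : ℂ) : radialCutoff c r w ≤ 1 :=
  max_le zero_le_one (min_le_left _ _)

theorem radialCutoff_eq_one (hr : 0 < r) (hw : ‖w - c‖ ≤ r) : radialCutoff c r w = 1 := by
  have : ‖w - c‖ / r ≤ 1 := (div_le_one hr).2 hw
  rw [radialCutoff, min_eq_left (by linarith), max_eq_right zero_le_one]

theorem radialCutoff_eq_zero (hr : 0 < r) (hw : 2 * r ≤ ‖w - c‖) : radialCutoff c r w = 0 := by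
  have : 2 ≤ ‖w - c‖ / r := (le_div_iff₀ hr).2 hw
  rw [radialCutoff, max_eq_left]
  exact (min_le_right _ _).trans (by linarith)

theorem abs_radialCutoff_sub_le (hr : 0 < r) (c w w' : ℂ) :
    |radialCutoff c r w - radialCutoff c r w'| ≤ 1 / r * ‖w - w'‖ := by
  have h1 : |‖w' - c‖ - ‖w - c‖| ≤ ‖w - w'‖ := by
    have := abs_norm_sub_norm_le (w' - c) (w - c)
    rwa [sub_sub_sub_cancel_right, norm_sub_rev w' w] at this
  rw [radialCutoff, radialCutoff, max_comm 0, max_comm 0, min_comm 1, min_comm 1]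
  refine (abs_max_sub_max_le_abs _ _ _).trans ((abs_inf_sub_inf_le_abs _ _ _).trans ?_)
  rw [show 2 - ‖w - c‖ / r - (2 - ‖w' - c‖ / r) = 1 / r * (‖w' - c‖ - ‖w - c‖) by ring, abs_mul,
    abs_of_pos (by positivity : 0 < 1 / r)]
  gcongr

theorem lipschitzWith_radialCutoff (hr : 0 < r) (c : ℂ) :
    LipschitzWith (1 / r).toNNReal (fun w => (radialCutoff c r w : ℂ)) :=
  LipschitzWith.of_dist_le' fun w w' => by
    rw [dist_eq_norm, dist_eq_norm, ← Complex.ofReal_sub, Complex.norm_real]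
    exact abs_radialCutoff_sub_le hr c w w'

theorem tsupport_radialCutoff_subset (hr : 0 < r) (c : ℂ) :
    tsupport (fun w => (radialCutoff c r w : ℂ)) ⊆ Metric.closedBall c (2 * r) := by
  refine closure_minimal (fun w hw => ?_) Metric.isClosed_closedBall
  rw [Metric.mem_closedBall, dist_eq_norm]
  by_contra hlt
  exact hw (by simp [radialCutoff_eq_zero hr (not_le.1 hlt).le])

theorem hasCompactSupport_radialCutoff (hr : 0 < r) (c : ℂ) :
    HasCompactSupport (fun w => (radialCutoff c r w : ℂ)) :=
  (isCompact_closedBall c (2 * r)).of_isClosed_subset (isClosed_tsupport _)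
    (tsupport_radialCutoff_subset hr c)

theorem norm_radialCutoff_le_one (c : ℂ) (r : ℝ) (w : ℂ) : ‖(radialCutoff c r w : ℂ)‖ ≤ 1 := by
  rw [Complex.norm_real, Real.norm_of_nonneg (radialCutoff_nonneg c r w)]
  exact radialCutoff_le_one c r w

end Cutoff

/-! ### Size and decay of the difference of two Cauchy kernels. -/

section TestFunction

variable {μ : Measure ℂ} {C₀ c₀ : ℝ}

/-- The regularized difference of the Cauchy kernels with poles `a` and `b`. -/
noncomputable def kernelDiff (η : ℝ) (a b w : ℂ) : ℂ :=
  regCauchyKernel η (a - w) - regCauchyKernel η (b - w)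

theorem norm_kernelDiff_le {η : ℝ} (hη : 0 < η) (a b w : ℂ) : ‖kernelDiff η a b w‖ ≤ 2 / η := by
  refine (norm_sub_le _ _).trans ?_
  have h1 := norm_regCauchyKernel_le_inv hη (a - w)
  have h2 := norm_regCauchyKernel_le_inv hη (b - w)
  calc _ ≤ 1 / η + 1 / η := add_le_add h1 h2
    _ = 2 / η := by ring

theorem norm_kernelDiff_sub_le {η : ℝ} (hη : 0 < η) (a b w w' : ℂ) :
    ‖kernelDiff η a b w - kernelDiff η a b w'‖ ≤ 6 / η ^ 2 * ‖w - w'‖ := by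
  have h : ∀ x : ℂ, ‖regCauchyKernel η (x - w) - regCauchyKernel η (x - w')‖ ≤
      3 / η ^ 2 * ‖w - w'‖ := fun x => by
    have := norm_regCauchyKernel_sub_le hη (x - w) (x - w')
    rwa [sub_sub_sub_cancel_left, norm_sub_rev w' w] at this
  calc _ = ‖(regCauchyKernel η (a - w) - regCauchyKernel η (a - w')) -
        (regCauchyKernel η (b - w) - regCauchyKernel η (b - w'))‖ := by
        congr 1
        simp only [kernelDiff]
        ring
    _ ≤ 3 / η ^ 2 * ‖w - w'‖ + 3 / η ^ 2 * ‖w - w'‖ := (norm_sub_le _ _).trans (add_le_add (h a) (h b))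
    _ = _ := by ring

theorem continuous_kernelDiff {η : ℝ} (hη : 0 < η) (a b : ℂ) : Continuous (kernelDiff η a b) :=
  ((continuous_regCauchyKernel hη).comp (by fun_prop)).sub
    ((continuous_regCauchyKernel hη).comp (by fun_prop))

theorem kernelDiff_of_le {η : ℝ} (hη : 0 < η) {a b w : ℂ} (ha : η ≤ ‖w - a‖) (hb : η ≤ ‖w - b‖) :
    kernelDiff η a b w = 1 / (a - w) - 1 / (b - w) := by
  rw [kernelDiff, regCauchyKernel_of_le hη (by rwa [norm_sub_rev]),
    regCauchyKernel_of_le hη (by rwa [norm_sub_rev])]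

theorem norm_kernelDiff_le_of_far {η : ℝ} (hη : 0 < η) {a b c w : ℂ} (ha : η ≤ ‖w - a‖)
    (hb : η ≤ ‖w - b‖) {R : ℝ} (hac : ‖a - c‖ < R) (hbc : ‖b - c‖ < R) (hw : 2 * R ≤ ‖w - c‖) :
    ‖kernelDiff η a b w‖ ≤ 8 * R / ‖w - c‖ ^ 2 := by
  have hR : 0 < R := (norm_nonneg _).trans_lt hac
  have hwc : 0 < ‖w - c‖ := by linarith
  have h : ∀ x : ℂ, ‖x - c‖ < R → ‖w - c‖ / 2 ≤ ‖w - x‖ := fun x hx => by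
    have := norm_add_le (w - x) (x - c)
    rw [sub_add_sub_cancel] at this
    linarith
  have hab : ‖a - b‖ ≤ 2 * R := by
    have := norm_sub_le (a - c) (b - c)
    rw [sub_sub_sub_cancel_right] at this
    linarith
  rw [kernelDiff_of_le hη ha hb]
  refine (norm_inv_sub_inv_le (ne_of_le_norm_sub hη ha) (ne_of_le_norm_sub hη hb)).trans ?_
  calc _ ≤ 2 * R / 2 * (1 / (‖w - c‖ / 2) ^ 2 + 1 / (‖w - c‖ / 2) ^ 2) := by
        gcongr
        · exact h a hac
        · exact h b hbc
    _ = _ := by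
        field_simp
        ring

end TestFunction

/-! ### Ingredients of the test function: bump, normalization, truncation, first moment. -/

section TestFunction

variable {μ : Measure ℂ} {C₀ c₀ : ℝ}

/-- Lower regularity puts mass at least `c₀ * l / 2` under a cutoff at a support point, so
normalizing costs a controlled Lipschitz constant. A multiple of this bump will restore mean zero.
-/
theorem IsNiceMeasure.exists_normalized_bump (h : IsNiceMeasure μ C₀) (had : IsADRegularMeasure μ c₀)
    (hc : 0 < c₀) {ζ : ℂ} (hζ : ζ ∈ μ.support) {l : ℝ} (hl : 0 < l) :
    ∃ β : ℂ → ℂ, (∀ w w', ‖β w - β w'‖ ≤ 4 / (c₀ * l ^ 2) * ‖w - w'‖) ∧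
      (∀ w, l ≤ ‖w - ζ‖ → β w = 0) ∧ Integrable β μ ∧ ∫ w, β w ∂μ = 1 ∧ ∫ w, ‖β w‖ ∂μ = 1 := by
  have := h.isLocallyFiniteMeasure
  have hl2 : 0 < l / 2 := by positivity
  set θ : ℂ → ℝ := radialCutoff ζ (l / 2) with hθ
  have hcont : Continuous fun w => (θ w : ℂ) := (lipschitzWith_radialCutoff hl2 ζ).continuous
  have hint : Integrable (fun w => (θ w : ℂ)) μ :=
    hcont.integrable_of_hasCompactSupport (hasCompactSupport_radialCutoff hl2 ζ)
  have hintR : Integrable θ μ := by simpa using hint.re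
  set b := ∫ w, θ w ∂μ with hb
  have hbl : c₀ * l / 2 ≤ b := by
    have h1 : c₀ * (l / 2) ≤ μ.real (Metric.ball ζ (l / 2)) :=
      (ENNReal.ofReal_le_iff_le_toReal (h.measure_ball_lt_top _ _).ne).1 (had ζ hζ _ hl2)
    have h2 : μ.real (Metric.ball ζ (l / 2)) ≤ b := by
      rw [← integral_indicator_one Metric.isOpen_ball.measurableSet]
      refine integral_mono_of_nonneg (ae_of_all _ fun w => ?_) hintR (ae_of_all _ fun w => ?_)
      · exact Set.indicator_nonneg (fun _ _ => zero_le_one) w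
      · by_cases hx : w ∈ Metric.ball ζ (l / 2)
        · have hx' : ‖w - ζ‖ < l / 2 := by rwa [Metric.mem_ball, dist_eq_norm] at hx
          rw [Set.indicator_of_mem hx, hθ, radialCutoff_eq_one hl2 hx'.le, Pi.one_apply]
        · rw [Set.indicator_of_notMem hx]
          exact radialCutoff_nonneg _ _ _
    linarith
  have hbpos : 0 < b := lt_of_lt_of_le (by positivity) hbl
  refine ⟨fun w => ((b⁻¹ : ℝ) : ℂ) * (θ w : ℂ), fun w w' => ?_, fun w hw => ?_,
    hint.const_mul _, ?_, ?_⟩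
  · rw [← mul_sub, norm_mul, ← Complex.ofReal_sub, Complex.norm_real, Complex.norm_real,
      Real.norm_of_nonneg (by positivity : 0 ≤ b⁻¹), Real.norm_eq_abs]
    calc b⁻¹ * |θ w - θ w'| ≤ (c₀ * l / 2)⁻¹ * (1 / (l / 2) * ‖w - w'‖) := by
          gcongr
          exact abs_radialCutoff_sub_le hl2 ζ w w'
      _ = _ := by
          field_simp
          ring
  · have hz : θ w = 0 := radialCutoff_eq_zero hl2 (by linarith)
    simp [hz]
  · rw [integral_const_mul, integral_complex_ofReal, ← hb, ← Complex.ofReal_mul,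
      inv_mul_cancel₀ hbpos.ne', Complex.ofReal_one]
  · have : ∀ w, ‖((b⁻¹ : ℝ) : ℂ) * (θ w : ℂ)‖ = b⁻¹ * θ w := fun w => by
      rw [norm_mul, Complex.norm_real, Complex.norm_real,
        Real.norm_of_nonneg (by positivity : 0 ≤ b⁻¹),
        Real.norm_of_nonneg (radialCutoff_nonneg _ _ _)]
    simp only [this]
    rw [integral_const_mul, ← hb, inv_mul_cancel₀ hbpos.ne']

/-- A function with Lipschitz constant `N / l ^ 2` enters `bumpFamily` after multiplication by `l ^
(1/2) / N`, and the power of `l` cancels the one in Θ. The set `F` is fixed before the test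
function. -/
theorem exists_set_of_cauchyTheta_lt {A A' γ : ℝ} (hγ : 0 < γ) {Q : DyadicSquare}
    (hΘ : cauchyTheta μ A A' Q < ENNReal.ofReal γ) :
    ∃ (F : Set ℂ) (hF : MeasurableSet F) (hμF : μ F ≠ ∞), Metric.ball Q.center (A' * Q.side) ⊆ F ∧
      ∀ (N : ℝ) (ψ : ℂ → ℂ), 0 < N → tsupport ψ ⊆ Metric.ball Q.center (A * Q.side) →
        (∀ w w', ‖ψ w - ψ w'‖ ≤ N / Q.side ^ 2 * ‖w - w'‖) → ∫ w, ψ w ∂μ = 0 →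
        ‖measurePairing μ (cauchyOperator μ (indicatorConstLp 2 hF hμF (1 : ℂ))) ψ‖ ≤ N * γ := by
  simp only [cauchyTheta, iInf_lt_iff] at hΘ
  obtain ⟨F, hF, hμF, hball, hlt⟩ := hΘ
  refine ⟨F, hF, hμF, hball, fun N ψ hN hs hL h0 => ?_⟩
  have hl : 0 < Q.side := by
    rw [DyadicSquare.side]
    positivity
  set l := Q.side with hl'
  set t : ℝ := l ^ (1 / 2 : ℝ) / N with ht
  have hp : 0 < l ^ (1 / 2 : ℝ) := Real.rpow_pos_of_pos hl _
  have htp : 0 < t := by positivity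
  have hmem : (fun w => (t : ℂ) * ψ w) ∈ bumpFamily μ A Q := by
    have hsub : Function.support (fun w => (t : ℂ) * ψ w) ⊆ Function.support ψ :=
      Function.support_mul_subset_right _ _
    refine ⟨(closure_mono hsub).trans hs, LipschitzWith.of_dist_le' fun w w' => ?_, ?_⟩
    · rw [dist_eq_norm, dist_eq_norm, ← mul_sub, norm_mul, Complex.norm_real,
        Real.norm_of_nonneg htp.le]
      refine (mul_le_mul_of_nonneg_left (hL w w') htp.le).trans (le_of_eq ?_)
      have e : l ^ (-(3 / 2) : ℝ) = l ^ (1 / 2 : ℝ) / l ^ 2 := by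
        rw [← Real.rpow_natCast l 2, ← Real.rpow_sub hl]
        norm_num
      rw [e, ht]
      field_simp
    · simp only
      rw [integral_const_mul, h0, mul_zero]
  have h1 := (le_iSup₂ (f := fun ψ (_ : ψ ∈ bumpFamily μ A Q) =>
    ENNReal.ofReal (Q.side ^ (-(1 / 2) : ℝ) *
      ‖measurePairing μ (cauchyOperator μ (indicatorConstLp 2 hF hμF (1 : ℂ))) ψ‖)) _ hmem).trans_lt
      hlt
  rw [ENNReal.ofReal_lt_ofReal_iff hγ, measurePairing_const_mul_right, norm_mul, Complex.norm_real,
    Real.norm_of_nonneg htp.le, Real.rpow_neg hl.le, ht] at h1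
  have e2 : (l ^ (1 / 2 : ℝ))⁻¹ * (l ^ (1 / 2 : ℝ) / N *
      ‖measurePairing μ (cauchyOperator μ (indicatorConstLp 2 hF hμF (1 : ℂ))) ψ‖) =
      ‖measurePairing μ (cauchyOperator μ (indicatorConstLp 2 hF hμF (1 : ℂ))) ψ‖ / N := by
    field_simp
  rw [e2, div_lt_iff₀ hN] at h1
  linarith

theorem IsNiceMeasure.integral_norm_cutoff_kernelDiff_le (h : IsNiceMeasure μ C₀) (hC : 0 < C₀)
    {a b c : ℂ} {η ρ : ℝ} (hη : 0 < η) (ha : ∀ w ∈ μ.support, η ≤ ‖w - a‖)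
    (hb : ∀ w ∈ μ.support, η ≤ ‖w - b‖) :
    ∫ w, ‖(radialCutoff c ρ w : ℂ) * kernelDiff η a b w‖ ∂μ ≤ 4 * C₀ / η * ‖a - b‖ := by
  refine le_trans (integral_mono_of_nonneg (ae_of_all _ fun w => norm_nonneg _)
    (h.integrable_cauchyDiff hC hη ha hb).norm ?_) (h.integral_norm_cauchyDiff_le hC hη ha hb)
  filter_upwards [ae_le_norm_sub ha, ae_le_norm_sub hb] with w h1 h2
  rw [norm_mul, kernelDiff_of_le hη h1 h2]
  exact mul_le_of_le_one_left (norm_nonneg _) (norm_radialCutoff_le_one _ _ _)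

theorem integrable_cutoff_kernelDiff [IsLocallyFiniteMeasure μ] {a b c : ℂ} {η ρ : ℝ} (hη : 0 < η)
    (hρ : 0 < ρ) : Integrable (fun w => (radialCutoff c ρ w : ℂ) * kernelDiff η a b w) μ :=
  ((lipschitzWith_radialCutoff hρ c).continuous.mul
    (continuous_kernelDiff hη a b)).integrable_of_hasCompactSupport
    (hasCompactSupport_radialCutoff hρ c).mul_right

/-- The cutoff only affects points beyond `ρ`, where the kernel difference decays quadratically. -/
theorem IsNiceMeasure.norm_cauchyDiff_sub_cutoff_le (h : IsNiceMeasure μ C₀) (hC : 0 < C₀)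
    {a b c : ℂ} {η ρ R : ℝ} (hη : 0 < η) (ha : ∀ w ∈ μ.support, η ≤ ‖w - a‖)
    (hb : ∀ w ∈ μ.support, η ≤ ‖w - b‖) (hac : ‖a - c‖ < R) (hbc : ‖b - c‖ < R)
    (hR : 2 * R ≤ ρ) :
    ‖cauchyDiff μ a b - ∫ w, (radialCutoff c ρ w : ℂ) * kernelDiff η a b w ∂μ‖ ≤
      32 * R * C₀ / ρ := by
  have := h.isLocallyFiniteMeasure
  have hR0 : 0 < R := (norm_nonneg _).trans_lt hac
  have hρ : 0 < ρ := by linarith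
  set s : Set ℂ := {w | ρ ≤ ‖w - c‖} with hs
  have hsm : MeasurableSet s := measurableSet_le_norm_sub c ρ
  have hsi : Integrable (s.indicator fun w => 1 / ‖w - c‖ ^ 2) μ :=
    (integrable_indicator_iff hsm).2 (h.integrableOn_inv_sq hC c hρ)
  rw [cauchyDiff, ← integral_sub (h.integrable_cauchyDiff hC hη ha hb)
    (integrable_cutoff_kernelDiff hη hρ)]
  calc _ ≤ ∫ w, 8 * R * s.indicator (fun w => 1 / ‖w - c‖ ^ 2) w ∂μ := by
        refine norm_integral_le_of_norm_le (hsi.const_mul _) ?_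
        filter_upwards [ae_le_norm_sub ha, ae_le_norm_sub hb] with w h1 h2
        rw [← kernelDiff_of_le hη h1 h2]
        by_cases hw : w ∈ s
        · have e : kernelDiff η a b w - (radialCutoff c ρ w : ℂ) * kernelDiff η a b w =
              ((1 - radialCutoff c ρ w : ℝ) : ℂ) * kernelDiff η a b w := by
            push_cast
            ring
          rw [Set.indicator_of_mem hw, e, norm_mul, Complex.norm_real, Real.norm_of_nonneg
            (by linarith [radialCutoff_le_one c ρ w])]
          have hw' : ρ ≤ ‖w - c‖ := hw
          have h3 := norm_kernelDiff_le_of_far hη h1 h2 hac hbc (by linarith)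
          calc _ ≤ 1 * (8 * R / ‖w - c‖ ^ 2) := by
                gcongr
                linarith [radialCutoff_nonneg c ρ w]
            _ = _ := by ring
        · have hw' : ‖w - c‖ < ρ := not_le.1 hw
          rw [radialCutoff_eq_one hρ hw'.le, Set.indicator_of_notMem hw]
          simp
    _ = 8 * R * ∫ w in s, 1 / ‖w - c‖ ^ 2 ∂μ := by
        rw [integral_const_mul, integral_indicator hsm]
    _ ≤ 8 * R * (4 * C₀ / ρ) := by
        gcongr
        exact h.setIntegral_inv_sq_le hC c hρ
    _ = _ := by ring

/-- Avoids the logarithm in the integral of `1 / ‖w - x‖` over a large ball: it is traded for the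
mass of the ball and an inverse-square integral, with a free weight `θ`. -/
theorem inv_le_amgm {x θ l : ℝ} (hx : 0 < x) (hθ : 0 < θ) (hl : 0 < l) :
    1 / x ≤ θ / l + l / θ * (1 / x ^ 2) := by
  have h : θ / l + l / θ * (1 / x ^ 2) - 1 / x =
      ((θ * x - l) ^ 2 + θ * x * l) / (θ * l * x ^ 2) := by
    field_simp
    ring
  have : 0 ≤ ((θ * x - l) ^ 2 + θ * x * l) / (θ * l * x ^ 2) := by positivity
  linarith

theorem IsNiceMeasure.integral_weight_cutoff_kernelDiff_le (h : IsNiceMeasure μ C₀) (hC : 0 < C₀)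
    {a b c : ℂ} {η ρ R θ l : ℝ} (hη : 0 < η) (hρ : 0 < ρ) (hθ : 0 < θ) (hl : 0 < l)
    (ha : ∀ w ∈ μ.support, η ≤ ‖w - a‖) (hb : ∀ w ∈ μ.support, η ≤ ‖w - b‖)
    (hac : ‖a - c‖ < R) (hbc : ‖b - c‖ < R) :
    ∫ w, ‖w - c‖ * ‖(radialCutoff c ρ w : ℂ) * kernelDiff η a b w‖ ∂μ ≤
      2 * R * (θ / l * (C₀ * (3 * ρ)) + (l / θ + R) * (4 * C₀ / η)) := by
  have := h.isLocallyFiniteMeasure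
  have hR0 : 0 < R := (norm_nonneg _).trans_lt hac
  have hab : ‖a - b‖ ≤ 2 * R := by
    have := norm_sub_le (a - c) (b - c)
    rw [sub_sub_sub_cancel_right] at this
    linarith
  set B := Metric.ball c (3 * ρ) with hB
  have hBm : MeasurableSet B := Metric.isOpen_ball.measurableSet
  have hBi : Integrable (B.indicator fun _ => θ / l) μ :=
    (integrable_indicator_iff hBm).2 (integrableOn_const (h.measure_ball_lt_top _ _).ne)
  have hia := (h.integrable_inv_sq hC hη ha).const_mul (l / θ + R)
  have hib := (h.integrable_inv_sq hC hη hb).const_mul (l / θ + R)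
  have hpt : ∀ x w : ℂ, ‖x - c‖ < R → η ≤ ‖w - x‖ → w ∈ B →
      ‖w - c‖ * (1 / ‖w - x‖ ^ 2) ≤
        B.indicator (fun _ => θ / l) w + (l / θ + R) * (1 / ‖w - x‖ ^ 2) := by
    intro x w hx hwx hwB
    have hpos : 0 < ‖w - x‖ := hη.trans_le hwx
    have h1 := norm_add_le (w - x) (x - c)
    rw [sub_add_sub_cancel] at h1
    rw [Set.indicator_of_mem hwB]
    have h2 := inv_le_amgm hpos hθ hl
    calc ‖w - c‖ * (1 / ‖w - x‖ ^ 2) ≤ (‖w - x‖ + R) * (1 / ‖w - x‖ ^ 2) := by gcongr; linarith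
      _ = 1 / ‖w - x‖ + R * (1 / ‖w - x‖ ^ 2) := by field_simp
      _ ≤ _ := by linarith
  calc _ ≤ ∫ w, R * ((B.indicator (fun _ => θ / l) w + (l / θ + R) * (1 / ‖w - a‖ ^ 2)) +
        (B.indicator (fun _ => θ / l) w + (l / θ + R) * (1 / ‖w - b‖ ^ 2))) ∂μ := by
        refine integral_mono_of_nonneg (ae_of_all _ fun w => by positivity)
          (((hBi.add hia).add (hBi.add hib)).const_mul R) ?_
        filter_upwards [ae_le_norm_sub ha, ae_le_norm_sub hb] with w h1 h2
        by_cases hw : w ∈ B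
        · have h3 := norm_inv_sub_inv_le (ne_of_le_norm_sub hη h1) (ne_of_le_norm_sub hη h2)
          have h4 := hpt a w hac h1 hw
          have h5 := hpt b w hbc h2 hw
          rw [norm_mul, kernelDiff_of_le hη h1 h2]
          have h6 := norm_radialCutoff_le_one c ρ w
          calc _ ≤ ‖w - c‖ * (1 * (‖a - b‖ / 2 * (1 / ‖w - a‖ ^ 2 + 1 / ‖w - b‖ ^ 2))) := by gcongr
            _ ≤ ‖w - c‖ * (1 * (2 * R / 2 * (1 / ‖w - a‖ ^ 2 + 1 / ‖w - b‖ ^ 2))) := by gcongr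
            _ = R * (‖w - c‖ * (1 / ‖w - a‖ ^ 2) + ‖w - c‖ * (1 / ‖w - b‖ ^ 2)) := by ring
            _ ≤ _ := by gcongr
        · have hw' : 2 * ρ ≤ ‖w - c‖ := by
            rw [hB, Metric.mem_ball, dist_eq_norm, not_lt] at hw
            linarith
          rw [radialCutoff_eq_zero hρ hw', Set.indicator_of_notMem hw]
          simp only [Complex.ofReal_zero, zero_mul, norm_zero, mul_zero]
          positivity
    _ = R * ((θ / l * μ.real B + (l / θ + R) * ∫ w, 1 / ‖w - a‖ ^ 2 ∂μ) +
          (θ / l * μ.real B + (l / θ + R) * ∫ w, 1 / ‖w - b‖ ^ 2 ∂μ)) := by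
        have e1 := integral_add (hBi.add hia) (hBi.add hib)
        have e2 := integral_add hBi hia
        have e3 := integral_add hBi hib
        simp only [Pi.add_apply] at e1 e2 e3
        rw [integral_const_mul, e1, e2, e3, integral_indicator hBm, setIntegral_const, integral_const_mul,
          integral_const_mul, smul_eq_mul, mul_comm (θ / l)]
    _ ≤ R * ((θ / l * (C₀ * (3 * ρ)) + (l / θ + R) * (4 * C₀ / η)) +
          (θ / l * (C₀ * (3 * ρ)) + (l / θ + R) * (4 * C₀ / η))) := by
        have h1 := h.measureReal_ball_le hC c (by positivity : 0 < 3 * ρ)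
        have h2 := h.integral_inv_sq_le hC hη ha
        have h3 := h.integral_inv_sq_le hC hη hb
        gcongr
    _ = _ := by ring

end TestFunction

/-! ### The approximate quadratic relation satisfied by the mean of the test function. -/

section TestFunction

variable {μ : Measure ℂ} {C₀ c₀ : ℝ}

theorem norm_cutoff_kernelDiff_sub_le {η ρ : ℝ} (hη : 0 < η) (hρ : 0 < ρ) (a b c w w' : ℂ) :
    ‖(radialCutoff c ρ w : ℂ) * kernelDiff η a b w - radialCutoff c ρ w' * kernelDiff η a b w'‖ ≤
      (6 / η ^ 2 + 2 / η * (1 / ρ)) * ‖w - w'‖ := by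
  have e : (radialCutoff c ρ w : ℂ) * kernelDiff η a b w -
      radialCutoff c ρ w' * kernelDiff η a b w' =
      radialCutoff c ρ w * (kernelDiff η a b w - kernelDiff η a b w') +
        kernelDiff η a b w' * ((radialCutoff c ρ w - radialCutoff c ρ w' : ℝ) : ℂ) := by
    push_cast
    ring
  rw [e]
  refine (norm_add_le _ _).trans ?_
  rw [norm_mul, norm_mul, Complex.norm_real (_ - _), Real.norm_eq_abs]
  have h1 := norm_radialCutoff_le_one c ρ w
  have h2 := norm_kernelDiff_sub_le hη a b w w'
  have h3 := norm_kernelDiff_le hη a b w'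
  have h4 := abs_radialCutoff_sub_le hρ c w w'
  calc _ ≤ 1 * (6 / η ^ 2 * ‖w - w'‖) + 2 / η * (1 / ρ * ‖w - w'‖) := by gcongr
    _ = _ := by ring

/-- Let `φ` be the cutoff at scale `X ^ 2 * l`, `g` its product with the kernel difference, `m` the
mean of `g`. Then `ψ = g - m β` is admissible, and replacing `χ_F` by `φ` in the pairing costs `O(1
/ X)`. What remains is `(U_a² - U_b²)/2 - m S`, where `S` is the form of `φ` and `β`; as `m = U_a -
U_b`, it equals `m (m - κ)/2`. -/
theorem IsGoodMeasure.exists_forall_norm_mul_sub_le (h : IsGoodMeasure μ C₀)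
    (had : IsADRegularMeasure μ c₀) (hC : 0 < C₀) (hc : 0 < c₀) {Q : DyadicSquare} {ζ : ℂ}
    (hζ : ζ ∈ Metric.ball Q.center (10 * Q.side) ∩ μ.support) {R η X γ : ℝ} (hR : 0 < R)
    (hη : 0 < η) (hη1 : η ≤ 1) (hX : 5 ≤ X) (hXR : 2 * R ≤ X)
    {F : Set ℂ} (hF : MeasurableSet F) (hμF : μ F ≠ ∞)
    (hFQ : Metric.ball Q.center (3 * X ^ 2 * Q.side) ⊆ F)
    (hψ : ∀ (N : ℝ) (ψ : ℂ → ℂ), 0 < N → tsupport ψ ⊆ Metric.ball Q.center (3 * X ^ 2 * Q.side) →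
        (∀ w w', ‖ψ w - ψ w'‖ ≤ N / Q.side ^ 2 * ‖w - w'‖) → ∫ w, ψ w ∂μ = 0 →
        ‖measurePairing μ (cauchyOperator μ (indicatorConstLp 2 hF hμF (1 : ℂ))) ψ‖ ≤ N * γ)
    {b : ℂ} (hbQ : ‖b - Q.center‖ < R * Q.side) (hb : ∀ w ∈ μ.support, η * Q.side ≤ ‖w - b‖) :
    ∃ κ : ℂ, ∀ a : ℂ, ‖a - Q.center‖ < R * Q.side → (∀ w ∈ μ.support, η * Q.side ≤ ‖w - a‖) →
      ‖(∫ w, (radialCutoff Q.center (X ^ 2 * Q.side) w : ℂ) * kernelDiff (η * Q.side) a b w ∂μ) *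
        ((∫ w, (radialCutoff Q.center (X ^ 2 * Q.side) w : ℂ) * kernelDiff (η * Q.side) a b w ∂μ)
          - κ)‖ ≤
      2 * ((8 / η ^ 2 + 32 * R * C₀ / (η * c₀)) * γ +
        (640 * C₀ ^ 2 * R + 20 * R * C₀ ^ 2 * (3 + 8 / η) + 880 * R * C₀ ^ 2 / η) / X) := by
  have hlf := h.1.isLocallyFiniteMeasure
  have hl : 0 < Q.side := by
    rw [DyadicSquare.side]
    positivity
  set l := Q.side with hl'
  set c := Q.center with hc'
  have hX0 : 0 < X := by linarith
  set ρ := X ^ 2 * l with hρ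
  have hρ0 : 0 < ρ := by positivity
  have hηl : 0 < η * l := by positivity
  have hX2 : 25 ≤ X ^ 2 := by nlinarith
  have hXR2 : 10 * R ≤ X ^ 2 := by nlinarith
  have hρ25 : 25 * l ≤ ρ := by
    rw [hρ]
    gcongr
  have hρR : 10 * (R * l) ≤ ρ := by
    rw [hρ, ← mul_assoc]
    gcongr
  obtain ⟨β, hβL, hβ0, hβi, hβ1, hβn⟩ := h.1.exists_normalized_bump had hc hζ.2 hl
  have hζc : ‖ζ - c‖ < 10 * l := by
    have := hζ.1
    rwa [Metric.mem_ball, dist_eq_norm] at this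
  have hβ0' : ∀ w, 11 * l ≤ ‖w - c‖ → β w = 0 := fun w hw => hβ0 w (by
    have := norm_add_le (w - ζ) (ζ - c)
    rw [sub_add_sub_cancel] at this
    linarith)
  set φ : ℂ → ℂ := fun w => (radialCutoff c ρ w : ℂ) with hφ
  have hφL : LipschitzWith (1 / ρ).toNNReal φ := lipschitzWith_radialCutoff hρ0 c
  have hφs : HasCompactSupport φ := hasCompactSupport_radialCutoff hρ0 c
  have hφi : Integrable φ μ := hφL.continuous.integrable_of_hasCompactSupport hφs
  have hβLip : LipschitzWith (4 / (c₀ * l ^ 2)).toNNReal β :=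
    LipschitzWith.of_dist_le' fun w w' => by
      rw [dist_eq_norm, dist_eq_norm]
      exact hβL w w'
  have hβs : HasCompactSupport β := HasCompactSupport.of_support_subset_isCompact
    (isCompact_closedBall c (11 * l)) fun w hw => by
      rw [Metric.mem_closedBall, dist_eq_norm]
      by_contra hlt
      exact hw (hβ0' w (not_le.1 hlt).le)
  -- `κ = 2 S - 2 U_b` does not involve `a`, so different poles can be compared.
  refine ⟨2 * symmCauchyForm μ φ β - 2 * ∫ w, φ w * regCauchyKernel (η * l) (b - w) ∂μ,
    fun a haQ ha => ?_⟩
  set k : ℂ → ℂ := kernelDiff (η * l) a b with hk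
  set g : ℂ → ℂ := fun w => φ w * k w with hg
  have hgi : Integrable g μ := integrable_cutoff_kernelDiff hηl hρ0
  have hgs : HasCompactSupport g := hφs.mul_right
  set m := ∫ w, g w ∂μ with hm
  have hab : ‖a - b‖ ≤ 2 * (R * l) := by
    have := norm_sub_le (a - c) (b - c)
    rw [sub_sub_sub_cancel_right] at this
    linarith
  have hmn : ‖m‖ ≤ 8 * R * C₀ / η := by
    refine (norm_integral_le_integral_norm _).trans
      ((h.1.integral_norm_cutoff_kernelDiff_le hC hηl ha hb).trans ?_)
    calc _ ≤ 4 * C₀ / (η * l) * (2 * (R * l)) := by gcongr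
      _ = _ := by
        field_simp
        ring
  have hgL : ∀ w w', ‖g w - g w'‖ ≤ 8 / η ^ 2 / l ^ 2 * ‖w - w'‖ := fun w w' => by
    refine (norm_cutoff_kernelDiff_sub_le hηl hρ0 a b c w w').trans ?_
    gcongr
    have h1 : 2 / (η * l) * (1 / ρ) ≤ 2 / (η ^ 2 * l) * (1 / l) := by
      gcongr
      · nlinarith
      · linarith
    calc 6 / (η * l) ^ 2 + 2 / (η * l) * (1 / ρ)
        ≤ 6 / (η * l) ^ 2 + 2 / (η ^ 2 * l) * (1 / l) := by gcongr
      _ = 8 / η ^ 2 / l ^ 2 := by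
        field_simp
        norm_num
  have hgLip : LipschitzWith (8 / η ^ 2 / l ^ 2).toNNReal g :=
    LipschitzWith.of_dist_le' fun w w' => by
      rw [dist_eq_norm, dist_eq_norm]
      exact hgL w w'
  set ψ : ℂ → ℂ := fun w => g w + (-m) * β w with hψdef
  have hψi : Integrable ψ μ := hgi.add (hβi.const_mul _)
  have hψ0 : ∫ w, ψ w ∂μ = 0 := by
    rw [hψdef, integral_add hgi (hβi.const_mul _), integral_const_mul, hβ1, ← hm]
    ring
  have hψz : ∀ w, 2 * ρ ≤ ‖w - c‖ → ψ w = 0 := fun w hw => by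
    simp only [hψdef, hg, hφ, radialCutoff_eq_zero hρ0 hw, hβ0' w (by linarith)]
    simp
  have hψs : tsupport ψ ⊆ Metric.closedBall c (2 * ρ) :=
    closure_minimal (fun w hw => by
      rw [Metric.mem_closedBall, dist_eq_norm]
      by_contra hlt
      exact hw (hψz w (not_le.1 hlt).le)) Metric.isClosed_closedBall
  have hψL : ∀ w w', ‖ψ w - ψ w'‖ ≤
      (8 / η ^ 2 + 32 * R * C₀ / (η * c₀)) / l ^ 2 * ‖w - w'‖ := fun w w' => by
    have e : ψ w - ψ w' = (g w - g w') - m * (β w - β w') := by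
      simp only [hψdef]
      ring
    rw [e]
    refine (norm_sub_le _ _).trans ?_
    rw [norm_mul]
    calc _ ≤ 8 / η ^ 2 / l ^ 2 * ‖w - w'‖ +
          8 * R * C₀ / η * (4 / (c₀ * l ^ 2) * ‖w - w'‖) := by
          gcongr
          · exact hgL w w'
          · exact hβL w w'
      _ = _ := by
          field_simp
          ring
  have hψsm : MemLp ψ 2 μ := by
    refine Continuous.memLp_of_hasCompactSupport ?_ ?_
    · exact hgLip.continuous.add (continuous_const.mul hβLip.continuous)
    · exact (isCompact_closedBall c (2 * ρ)).of_isClosed_subset (isClosed_tsupport _) hψs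
  set χ : ℂ → ℂ := F.indicator fun _ => (1 : ℂ) with hχ
  have hχi : Integrable χ μ := (integrable_indicator_iff hF).2 (integrableOn_const hμF)
  set f : ℂ → ℂ := fun w => χ w + (-1) * φ w with hf
  have hfi : Integrable f μ := hχi.add (hφi.const_mul _)
  have hin : ∀ w, w ∈ F → f w = ((1 - radialCutoff c ρ w : ℝ) : ℂ) := fun w hw => by
    simp only [hf, hχ, Set.indicator_of_mem hw, hφ]
    push_cast
    ring
  have hout : ∀ w, w ∉ F → f w = 0 := fun w hw => by
    have : 2 * ρ ≤ ‖w - c‖ := by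
      by_contra hlt
      refine hw (hFQ ?_)
      rw [Metric.mem_ball, dist_eq_norm, mul_assoc, ← hρ]
      linarith
    simp only [hf, hχ, Set.indicator_of_notMem hw, hφ, radialCutoff_eq_zero hρ0 this]
    simp
  have hf1 : ∀ w, ‖f w‖ ≤ 1 := fun w => by
    by_cases hw : w ∈ F
    · rw [hin w hw, Complex.norm_real, Real.norm_of_nonneg
        (by linarith [radialCutoff_le_one c ρ w])]
      linarith [radialCutoff_nonneg c ρ w]
    · rw [hout w hw, norm_zero]
      exact zero_le_one
  have hf0 : ∀ w, ‖w - c‖ < ρ → f w = 0 := fun w hw => by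
    by_cases hwF : w ∈ F
    · rw [hin w hwF, radialCutoff_eq_one hρ0 hw.le]
      simp
    · exact hout w hwF
  -- Quadratic decay of the kernel difference, evaluated at distance `ρ / 2`.
  set G := 32 * (R * l) / ρ ^ 2 with hG
  have hψG : ∀ᵐ w ∂μ, ρ / 2 < ‖w - c‖ → ‖ψ w‖ ≤ G := by
    filter_upwards [ae_le_norm_sub ha, ae_le_norm_sub hb] with w h1 h2 hw
    have h3 := norm_kernelDiff_le_of_far hηl h1 h2 haQ hbQ (by linarith)
    have h4 : ψ w = φ w * k w := by
      simp only [hψdef, hg, hβ0' w (by linarith)]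
      ring
    rw [h4, norm_mul]
    calc _ ≤ 1 * (8 * (R * l) / (ρ / 2) ^ 2) := by
          refine mul_le_mul (norm_radialCutoff_le_one c ρ w) (h3.trans ?_) (norm_nonneg _)
            zero_le_one
          gcongr
      _ = G := by
          rw [hG]
          field_simp
          norm_num
  have hW : ∫ w, ‖w - c‖ * ‖ψ w‖ ∂μ ≤
      l * (2 * R * C₀ * X * (3 + 8 / η) + 88 * R * C₀ / η) := by
    have hcn : Continuous fun w : ℂ => ‖w - c‖ := by fun_prop
    have i1 : Integrable (fun w => ‖w - c‖ * ‖g w‖) μ :=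
      (hcn.mul hgLip.continuous.norm).integrable_of_hasCompactSupport hgs.norm.mul_left
    have i2 : Integrable (fun w => 11 * l * ‖m‖ * ‖β w‖) μ := hβi.norm.const_mul _
    -- The weight `1 / X` makes the first moment `O(X * l)`; division by `ρ = X ^ 2 * l` then leaves
    -- `O(1 / X)`.
    have w1 := h.1.integral_weight_cutoff_kernelDiff_le (θ := 1 / X) hC hηl hρ0 (by positivity) hl
      ha hb haQ hbQ
    calc _ ≤ ∫ w, (‖w - c‖ * ‖g w‖ + 11 * l * ‖m‖ * ‖β w‖) ∂μ := by
          refine integral_mono_of_nonneg (ae_of_all _ fun w => by positivity) (i1.add i2)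
            (ae_of_all _ fun w => ?_)
          have h1 : ‖ψ w‖ ≤ ‖g w‖ + ‖m‖ * ‖β w‖ := by
            refine (norm_add_le _ _).trans ?_
            rw [norm_mul (-m), norm_neg]
          have h2 : ‖w - c‖ * ‖β w‖ ≤ 11 * l * ‖β w‖ := by
            rcases le_or_gt (11 * l) ‖w - c‖ with hw | hw
            · rw [hβ0' w hw]
              simp
            · gcongr
          calc ‖w - c‖ * ‖ψ w‖ ≤ ‖w - c‖ * (‖g w‖ + ‖m‖ * ‖β w‖) := by gcongr
            _ = ‖w - c‖ * ‖g w‖ + ‖m‖ * (‖w - c‖ * ‖β w‖) := by ring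
            _ ≤ ‖w - c‖ * ‖g w‖ + ‖m‖ * (11 * l * ‖β w‖) := by gcongr
            _ = _ := by ring
      _ = ∫ w, ‖w - c‖ * ‖g w‖ ∂μ + 11 * l * ‖m‖ := by
          rw [integral_add i1 i2, integral_const_mul, hβn, mul_one]
      _ ≤ 2 * (R * l) * (1 / X / l * (C₀ * (3 * ρ)) + (l / (1 / X) + R * l) *
            (4 * C₀ / (η * l))) + 11 * l * (8 * R * C₀ / η) := by gcongr
      _ = l * (2 * R * C₀ * (3 * X + (X + R) * 4 / η) + 88 * R * C₀ / η) := by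
          rw [hρ]
          field_simp
          ring
      _ ≤ _ := by
          have : (X + R) * 4 / η ≤ X * (8 / η) := by
            rw [← mul_div_assoc, div_le_div_iff_of_pos_right hη]
            linarith
          rw [mul_assoc _ X]
          gcongr
          linarith
  set N := 8 / η ^ 2 + 32 * R * C₀ / (η * c₀) with hN
  have hN0 : 0 < N := by positivity
  set T := cauchyOperator μ with hT
  have hlim := h.isWeakCauchyLimit_cauchyOperator hC (indicatorConstLp 2 hF hμF (1 : ℂ)) hψsm.toLp
  have hcoe : (indicatorConstLp 2 hF hμF (1 : ℂ) : ℂ → ℂ) =ᵐ[μ] χ := indicatorConstLp_coeFn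
  have hlim1 : Tendsto (fun δ : ℝ => measurePairing μ (regCauchyTransform μ δ χ) ψ) (𝓝[>] 0)
      (𝓝 (measurePairing μ (T (indicatorConstLp 2 hF hμF (1 : ℂ))) ψ)) := by
    rw [measurePairing_congr EventuallyEq.rfl hψsm.coeFn_toLp] at hlim
    refine hlim.congr fun δ => ?_
    rw [regCauchyTransform_congr hcoe]
    exact measurePairing_congr EventuallyEq.rfl hψsm.coeFn_toLp
  have hlim2 := tendsto_measurePairing_of_lipschitz (μ := μ) hφL hgLip hφs hgs
  have hlim3 := tendsto_measurePairing_of_lipschitz (μ := μ) hφL hβLip hφs hβs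
  have hpsi := hψ N ψ hN0 (hψs.trans (by
    rw [mul_assoc, ← hρ]
    exact Metric.closedBall_subset_ball (by linarith))) hψL hψ0
  set K := 640 * C₀ ^ 2 * R + 20 * R * C₀ ^ 2 * (3 + 8 / η) + 880 * R * C₀ ^ 2 / η with hK
  have herr : ∀ᶠ δ : ℝ in 𝓝[>] 0, ‖measurePairing μ (regCauchyTransform μ δ φ) g -
      m * measurePairing μ (regCauchyTransform μ δ φ) β -
      measurePairing μ (regCauchyTransform μ δ χ) ψ‖ ≤ K / X := by
    filter_upwards [Ioc_mem_nhdsGT (by positivity : 0 < ρ / 2)] with δ hδ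
    have p1 := h.norm_pairing_le_of_integral_eq_zero (G := G) hC hδ.1 hδ.2 (by positivity) hfi hψi
      hf1 hf0 (fun w hw => hψz w hw.le) hψG hψ0
    have e1 : measurePairing μ (regCauchyTransform μ δ φ) ψ =
        measurePairing μ (regCauchyTransform μ δ φ) g -
          m * measurePairing μ (regCauchyTransform μ δ φ) β := by
      rw [hψdef, measurePairing_regCauchyTransform_add_right hδ.1 hφi hgi (hβi.const_mul _),
        measurePairing_const_mul_right]
      ring
    have e2 : χ = fun w => f w + φ w := by
      ext w
      simp only [hf]
      ring
    have e3 : measurePairing μ (regCauchyTransform μ δ χ) ψ =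
        measurePairing μ (regCauchyTransform μ δ f) ψ +
          measurePairing μ (regCauchyTransform μ δ φ) ψ := by
      rw [← measurePairing_regCauchyTransform_add_left hδ.1 hfi hφi hψi, ← e2]
    rw [← e1, e3, sub_add_cancel_right, norm_neg]
    refine p1.trans ?_
    calc _ ≤ 20 * C₀ ^ 2 * ρ * G +
          10 * C₀ / ρ * (l * (2 * R * C₀ * X * (3 + 8 / η) + 88 * R * C₀ / η)) := by gcongr
      _ = (640 * C₀ ^ 2 * R / X + 20 * R * C₀ ^ 2 * (3 + 8 / η) + 880 * R * C₀ ^ 2 / η / X) / X := by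
          rw [hG, hρ]
          field_simp
          ring
      _ ≤ (640 * C₀ ^ 2 * R / 1 + 20 * R * C₀ ^ 2 * (3 + 8 / η) + 880 * R * C₀ ^ 2 / η / 1) / X := by
          gcongr <;> linarith
      _ = K / X := by rw [hK, div_one, div_one]
  have hfin := le_of_tendsto ((hlim2.sub (hlim3.const_mul m)).sub hlim1).norm herr
  set Ua := ∫ w, φ w * regCauchyKernel (η * l) (a - w) ∂μ with hUa
  set Ub := ∫ w, φ w * regCauchyKernel (η * l) (b - w) ∂μ with hUb
  have hsym : symmCauchyForm μ φ g = 1 / 2 * (Ua ^ 2 - Ub ^ 2) :=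
    h.1.symmCauchyForm_eq hφL.continuous hφs hηl ha hb
  have hmU : m = Ua - Ub := by
    have hint : ∀ x : ℂ, Integrable (fun w => φ w * regCauchyKernel (η * l) (x - w)) μ := fun x =>
      (hφL.continuous.mul ((continuous_regCauchyKernel hηl).comp
        (by fun_prop))).integrable_of_hasCompactSupport hφs.mul_right
    rw [hUa, hUb, ← integral_sub (hint a) (hint b), hm]
    congr 1
    ext w
    simp only [hg, hk, kernelDiff]
    ring
  rw [hsym] at hfin
  set P := measurePairing μ (T (indicatorConstLp 2 hF hμF (1 : ℂ))) ψ with hP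
  set S := symmCauchyForm μ φ β with hS
  have e : m * (m - (2 * S - 2 * Ub)) =
      2 * ((1 / 2 * (Ua ^ 2 - Ub ^ 2) - m * S - P) + P) := by
    rw [hmU]
    ring
  rw [e, norm_mul, Complex.norm_ofNat]
  have := norm_add_le (1 / 2 * (Ua ^ 2 - Ub ^ 2) - m * S - P) P
  linarith

end TestFunction

/-! ### Elimination of `κ`: approximately at most one non-zero value. -/

section TwoValued

/-- Exactly, `v * (u * (u - κ)) - u * (v * (v - κ)) = u * v * (u - v)`, so `κ` drops out. The other
terms pay for replacing `u`, `v` by `x`, `y`. -/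
theorem norm_mul_mul_sub_le {x y u v κ : ℂ} {M t e : ℝ} (hx : ‖x‖ ≤ M) (hy : ‖y‖ ≤ M)
    (hu : ‖u‖ ≤ M) (hv : ‖v‖ ≤ M) (hxu : ‖x - u‖ ≤ t) (hyv : ‖y - v‖ ≤ t)
    (h1 : ‖u * (u - κ)‖ ≤ e) (h2 : ‖v * (v - κ)‖ ≤ e) :
    ‖x * y * (x - y)‖ ≤ 2 * M * e + 6 * M ^ 2 * t := by
  have hM : 0 ≤ M := (norm_nonneg _).trans hx
  have ht : 0 ≤ t := (norm_nonneg _).trans hxu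
  have he : 0 ≤ e := (norm_nonneg _).trans h1
  have hxy : ‖x - y‖ ≤ M + M := (norm_sub_le _ _).trans (add_le_add hx hy)
  have e1 : x * y * (x - y) = v * (u * (u - κ)) - u * (v * (v - κ)) + (x - u) * (y * (x - y)) +
      (y - v) * (u * (x - y)) + (u * v) * ((x - u) - (y - v)) := by ring
  have b1 : ‖v * (u * (u - κ))‖ ≤ M * e := by rw [norm_mul]; gcongr
  have b2 : ‖u * (v * (v - κ))‖ ≤ M * e := by rw [norm_mul]; gcongr
  have b3 : ‖(x - u) * (y * (x - y))‖ ≤ t * (M * (M + M)) := by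
    rw [norm_mul, norm_mul]; gcongr
  have b4 : ‖(y - v) * (u * (x - y))‖ ≤ t * (M * (M + M)) := by
    rw [norm_mul, norm_mul]; gcongr
  have b5 : ‖(u * v) * ((x - u) - (y - v))‖ ≤ (M * M) * (t + t) := by
    rw [norm_mul, norm_mul]
    have := (norm_sub_le (x - u) (y - v)).trans (add_le_add hxu hyv)
    gcongr
  rw [e1]
  calc _ ≤ ‖v * (u * (u - κ)) - u * (v * (v - κ))‖ + ‖(x - u) * (y * (x - y))‖ +
        ‖(y - v) * (u * (x - y))‖ + ‖(u * v) * ((x - u) - (y - v))‖ :=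
        norm_add₄_le
    _ ≤ (M * e + M * e) + t * (M * (M + M)) + t * (M * (M + M)) + (M * M) * (t + t) := by
        gcongr
        exact (norm_sub_le _ _).trans (add_le_add b1 b2)
    _ = _ := by ring

theorem exists_cauchyTheta_threshold {C₀ c₀ : ℝ} (hC : 0 < C₀) (hc : 0 < c₀) {R η ε : ℝ}
    (hR : 0 < R) (hη : 0 < η) (hη1 : η ≤ 1) (hε : 0 < ε) :
    ∃ A γ : ℝ, 1 < A ∧ 0 < γ ∧ ∀ μ : Measure ℂ, IsGoodMeasure μ C₀ → IsADRegularMeasure μ c₀ →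
      ∀ Q : DyadicSquare, (Metric.ball Q.center (10 * Q.side) ∩ μ.support).Nonempty →
        cauchyTheta μ A A Q < ENNReal.ofReal γ →
        ∀ a a' b : ℂ, ‖a - Q.center‖ < R * Q.side → ‖a' - Q.center‖ < R * Q.side →
          ‖b - Q.center‖ < R * Q.side → (∀ w ∈ μ.support, η * Q.side ≤ ‖w - a‖) →
          (∀ w ∈ μ.support, η * Q.side ≤ ‖w - a'‖) → (∀ w ∈ μ.support, η * Q.side ≤ ‖w - b‖) →
          ‖cauchyDiff μ a b * cauchyDiff μ a' b * (cauchyDiff μ a b - cauchyDiff μ a' b)‖ ≤ ε := by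
  set M := 8 * R * C₀ / η with hM
  set N := 8 / η ^ 2 + 32 * R * C₀ / (η * c₀) with hN
  set K := 640 * C₀ ^ 2 * R + 20 * R * C₀ ^ 2 * (3 + 8 / η) + 880 * R * C₀ ^ 2 / η with hK
  -- Coefficient of `1 / X` in the final error: `4 * M * K` from the tail of `χ_F`, the rest from
  -- truncating `cauchyDiff`. Then `X` and `γ` are chosen to spend `ε / 2` each.
  set L := 4 * M * K + 192 * M ^ 2 * R * C₀ with hL
  have hM0 : 0 < M := by positivity
  have hN0 : 0 < N := by positivity
  have hK0 : 0 < K := by positivity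
  have hL0 : 0 < L := by positivity
  set X := 5 + 2 * R + 2 * L / ε with hX
  have hLε : 0 < 2 * L / ε := by positivity
  have hX5 : 5 ≤ X := by linarith
  have hXR : 2 * R ≤ X := by linarith
  have hX0 : 0 < X := by linarith
  have hX2 : 25 ≤ X ^ 2 := by nlinarith
  set γ := ε / (8 * M * N) with hγ
  -- The test function lives in the closed ball of radius `2 * X ^ 2 * l`, on which `χ_F` must be 1;
  -- the same constant serves as `A` and `A'`.
  refine ⟨3 * X ^ 2, γ, by linarith, by positivity, fun μ hμ had Q ⟨ζ, hζ⟩ hΘ a a' b ha ha' hb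
    ha1 ha1' hb1 => ?_⟩
  obtain ⟨F, hF, hμF, hFQ, hψ⟩ := exists_set_of_cauchyTheta_lt (by positivity) hΘ
  obtain ⟨κ, hκ⟩ := hμ.exists_forall_norm_mul_sub_le had hC hc hζ hR hη hη1 hX5 hXR hF hμF hFQ hψ
    hb hb1
  have hl : 0 < Q.side := by
    rw [DyadicSquare.side]
    positivity
  set l := Q.side with hl'
  set c := Q.center with hc'
  have hηl : 0 < η * l := by positivity
  have hHM : ∀ x : ℂ, ‖x - c‖ < R * l → (∀ w ∈ μ.support, η * l ≤ ‖w - x‖) →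
      4 * C₀ / (η * l) * ‖x - b‖ ≤ M := fun x hx hx1 => by
    have hxb : ‖x - b‖ ≤ 2 * (R * l) := by
      have := norm_sub_le (x - c) (b - c)
      rw [sub_sub_sub_cancel_right] at this
      linarith
    calc _ ≤ 4 * C₀ / (η * l) * (2 * (R * l)) := by gcongr
      _ = M := by
        rw [hM]
        field_simp
        ring
  have hρ : 2 * (R * l) ≤ X ^ 2 * l := by
    rw [← mul_assoc]
    gcongr
    nlinarith
  have hall : ∀ x : ℂ, ‖x - c‖ < R * l → (∀ w ∈ μ.support, η * l ≤ ‖w - x‖) →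
      ‖cauchyDiff μ x b‖ ≤ M ∧
      ‖∫ w, (radialCutoff c (X ^ 2 * l) w : ℂ) * kernelDiff (η * l) x b w ∂μ‖ ≤ M ∧
      ‖cauchyDiff μ x b -
        ∫ w, (radialCutoff c (X ^ 2 * l) w : ℂ) * kernelDiff (η * l) x b w ∂μ‖ ≤
        32 * R * C₀ / X := fun x hx hx1 => by
    refine ⟨(hμ.1.norm_cauchyDiff_le hC hηl hx1 hb1).trans (hHM x hx hx1),
      (norm_integral_le_integral_norm _).trans
      ((hμ.1.integral_norm_cutoff_kernelDiff_le hC hηl hx1 hb1).trans (hHM x hx hx1)),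
      (hμ.1.norm_cauchyDiff_sub_cutoff_le hC hηl hx1 hb1 hx hb hρ).trans ?_⟩
    calc 32 * (R * l) * C₀ / (X ^ 2 * l) = 32 * R * C₀ / X ^ 2 := by field_simp
      _ ≤ 32 * R * C₀ / X := by
        gcongr
        nlinarith
  obtain ⟨p1, p2, p3⟩ := hall a ha ha1
  obtain ⟨q1, q2, q3⟩ := hall a' ha' ha1'
  refine (norm_mul_mul_sub_le p1 q1 p2 q2 p3 q3 (hκ a ha ha1) (hκ a' ha' ha1')).trans ?_
  have hLX : L / X ≤ ε / 2 := by
    rw [div_le_div_iff₀ hX0 two_pos]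
    have : L * 2 = 2 * L / ε * ε := by field_simp
    rw [this, mul_comm ε]
    gcongr
    linarith
  have hγN : 4 * M * (N * γ) = ε / 2 := by
    rw [hγ]
    field_simp
    norm_num
  calc _ = 4 * M * (N * γ) + L / X := by
        rw [hL]
        ring
    _ ≤ ε := by linarith

end TwoValued

/-! ### Coordinates at a support point, with real axis along `e`. -/

section Frame

/-- The coordinate of `w` in the frame with origin `p` and real axis in the direction `e`. -/
noncomputable def frameCoord (p e w : ℂ) : ℂ := (starRingEnd ℂ) e * (w - p)

variable {p e : ℂ}

theorem norm_frameCoord (he : ‖e‖ = 1) (w : ℂ) : ‖frameCoord p e w‖ = ‖w - p‖ := by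
  rw [frameCoord, norm_mul, RCLike.norm_conj, he, one_mul]

theorem mul_conj_eq_one_of_norm (he : ‖e‖ = 1) : e * (starRingEnd ℂ) e = 1 := by
  rw [Complex.mul_conj', he]
  norm_num

theorem frame_sub (he : ‖e‖ = 1) (t w : ℂ) : p + t * e - w = e * (t - frameCoord p e w) := by
  rw [frameCoord, mul_sub, ← mul_assoc, mul_conj_eq_one_of_norm he]
  ring

theorem norm_frame_sub (he : ‖e‖ = 1) (t w : ℂ) :
    ‖w - (p + t * e)‖ = ‖t - frameCoord p e w‖ := by
  rw [norm_sub_rev, frame_sub he, norm_mul, he, one_mul]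

theorem mul_inv_frame_sub (he : ‖e‖ = 1) (t w : ℂ) :
    e * (1 / (p + t * e - w)) = 1 / (t - frameCoord p e w) := by
  have : e ≠ 0 := norm_pos_iff.1 (by rw [he]; exact one_pos)
  rw [frame_sub he]
  field_simp

theorem mul_cauchyDiff_frame (he : ‖e‖ = 1) (μ : Measure ℂ) (s t : ℂ) :
    e * cauchyDiff μ (p + s * e) (p + t * e) =
      ∫ w, (1 / (s - frameCoord p e w) - 1 / (t - frameCoord p e w)) ∂μ := by
  rw [cauchyDiff, ← integral_const_mul]
  congr 1
  ext w
  rw [mul_sub, mul_inv_frame_sub he, mul_inv_frame_sub he]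

theorem continuous_frameCoord (p e : ℂ) : Continuous (frameCoord p e) := by
  unfold frameCoord
  fun_prop

end Frame

/-! ### Pointwise bounds for the kernels in these coordinates. -/

section Pointwise

theorem re_one_div (z : ℂ) : (1 / z).re = z.re / ‖z‖ ^ 2 := by
  rw [one_div, Complex.inv_re, Complex.normSq_eq_norm_sq]

/-- The inequality says that `v` is outside the open disc with diameter `[t, t + d]`, and for `t ≤ d
/ 2` this disc sits inside the empty disc of centre and radius `d`. -/
theorem neg_inv_le_re_one_div_sub {d t : ℝ} {v : ℂ} (hd : 0 < d) (ht : 0 < t) (htd : t ≤ d / 2)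
    (hv : d ≤ ‖(d : ℂ) - v‖) : -(1 / d) ≤ (1 / ((t : ℂ) - v)).re := by
  have hn : ∀ x : ℝ, ‖(x : ℂ) - v‖ ^ 2 = (x - v.re) ^ 2 + v.im ^ 2 := fun x => by
    rw [← Complex.normSq_eq_norm_sq, Complex.normSq_apply]
    simp
    ring
  have h1 : d ^ 2 ≤ (d - v.re) ^ 2 + v.im ^ 2 := by
    rw [← hn]
    gcongr
  have hre : ((t : ℂ) - v).re = t - v.re := by simp
  have h2 : 0 ≤ (t - v.re) ^ 2 + v.im ^ 2 + d * (t - v.re) := by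
    rcases le_or_gt v.re 0 with h | h
    · have : 0 ≤ d * (t - v.re) := mul_nonneg hd.le (by linarith)
      positivity
    · nlinarith [mul_nonneg h.le (by linarith : 0 ≤ d - 2 * t), mul_pos hd ht, sq_nonneg t]
  have h3 : 0 < (t - v.re) ^ 2 + v.im ^ 2 := by
    by_contra hcon
    have h4 : (t - v.re) ^ 2 = 0 := by nlinarith [sq_nonneg (t - v.re), sq_nonneg v.im]
    have h5 : v.im ^ 2 = 0 := by nlinarith [sq_nonneg (t - v.re), sq_nonneg v.im]
    have h6 : t = v.re := by nlinarith [pow_eq_zero_iff (two_ne_zero) |>.1 h4]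
    rw [h5, ← h6] at h1
    nlinarith
  rw [re_one_div, hn, hre, neg_le_iff_add_nonneg, div_add_div _ _ h3.ne' hd.ne']
  apply div_nonneg _ (by positivity)
  linarith

theorem le_re_one_div_sub {t κ r : ℝ} {v : ℂ} (hr : 0 < r) (hκ : 0 < κ) (ht : 0 < t)
    (htr : t ≤ r / 2) (hv : ‖v‖ ≤ 3 / 2 * r) (hre : v.re ≤ -(κ * r / 2)) :
    κ / (8 * r) ≤ (1 / ((t : ℂ) - v)).re := by
  have h1 : ‖(t : ℂ) - v‖ ≤ 2 * r := by
    refine (norm_sub_le _ _).trans ?_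
    rw [Complex.norm_real, Real.norm_of_nonneg ht.le]
    linarith
  have h2 : κ * r / 2 ≤ ((t : ℂ) - v).re := by
    simp
    linarith
  have h3 : 0 < ((t : ℂ) - v).re := lt_of_lt_of_le (by positivity) h2
  have h4 : 0 < ‖(t : ℂ) - v‖ := h3.trans_le (Complex.re_le_norm _)
  rw [re_one_div]
  calc κ / (8 * r) = κ * r / 2 / (2 * r) ^ 2 := by
        field_simp
        norm_num
    _ ≤ ((t : ℂ) - v).re / ‖(t : ℂ) - v‖ ^ 2 := by gcongr

theorem one_div_sub_add_one_div {s : ℝ} {v : ℂ} (h1 : (s : ℂ) - v ≠ 0) (h2 : (-s : ℂ) - v ≠ 0) :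
    1 / ((s : ℂ) - v) - 1 / ((-s : ℂ) - v) = (2 * s : ℝ) * (1 / ((s : ℂ) ^ 2 - v ^ 2)) := by
  have h3 : (s : ℂ) ^ 2 - v ^ 2 = -((s - v) * (-s - v)) := by ring
  rw [h3]
  push_cast
  field_simp
  ring

theorem norm_two_mul_one_div_le_of_small {s : ℝ} {v : ℂ} (hs : 0 < s) (hv : ‖v‖ ≤ s / 4) :
    ‖((2 * s : ℝ) : ℂ) * (1 / ((s : ℂ) ^ 2 - v ^ 2))‖ ≤ 4 / s := by
  have h1 : s ^ 2 / 2 ≤ ‖(s : ℂ) ^ 2 - v ^ 2‖ := by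
    have := norm_sub_norm_le ((s : ℂ) ^ 2) (v ^ 2)
    rw [norm_pow, norm_pow, Complex.norm_real, Real.norm_of_nonneg hs.le] at this
    nlinarith [norm_nonneg v]
  rw [norm_mul, norm_div, norm_one, Complex.norm_real, Real.norm_of_nonneg (by positivity)]
  calc _ ≤ 2 * s * (1 / (s ^ 2 / 2)) := by gcongr
    _ = _ := by
      field_simp
      norm_num

theorem norm_two_mul_one_div_le_of_large {s : ℝ} {v : ℂ} (hs : 0 < s) (hv : 4 * s ≤ ‖v‖) :
    ‖((2 * s : ℝ) : ℂ) * (1 / ((s : ℂ) ^ 2 - v ^ 2))‖ ≤ 4 * s * (1 / ‖v‖ ^ 2) := by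
  have hv0 : 0 < ‖v‖ := by linarith
  have h1 : ‖v‖ ^ 2 / 2 ≤ ‖(s : ℂ) ^ 2 - v ^ 2‖ := by
    have := norm_sub_norm_le (v ^ 2) ((s : ℂ) ^ 2)
    rw [norm_pow, norm_pow, Complex.norm_real, Real.norm_of_nonneg hs.le, norm_sub_rev] at this
    nlinarith [norm_nonneg v]
  rw [norm_mul, norm_div, norm_one, Complex.norm_real, Real.norm_of_nonneg (by positivity)]
  calc _ ≤ 2 * s * (1 / (‖v‖ ^ 2 / 2)) := by gcongr
    _ = _ := by
      field_simp
      norm_num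

/-- For `v` on the imaginary axis the quantity is twice `s / (s ^ 2 + ‖v‖ ^ 2)`, a Poisson kernel; a
narrow cone turns the argument of `s ^ 2 - v ^ 2` by `O(κ)` only. -/
theorem two_mul_one_div_of_cone {s κ : ℝ} {v : ℂ} (hs : 0 < s) (hκ0 : 0 < κ) (hκ : κ ≤ 1 / 4)
    (hv : |v.re| ≤ κ * ‖v‖) :
    s / (s ^ 2 + ‖v‖ ^ 2) ≤ (((2 * s : ℝ) : ℂ) * (1 / ((s : ℂ) ^ 2 - v ^ 2))).re ∧
      |(((2 * s : ℝ) : ℂ) * (1 / ((s : ℂ) ^ 2 - v ^ 2))).im| ≤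
        16 * κ * (s / (s ^ 2 + ‖v‖ ^ 2)) := by
  set ζ := (s : ℂ) ^ 2 - v ^ 2 with hζ
  set D := s ^ 2 + ‖v‖ ^ 2 with hD
  have hD0 : 0 < D := by positivity
  have hvn : ‖v‖ ^ 2 = v.re ^ 2 + v.im ^ 2 := by
    rw [← Complex.normSq_eq_norm_sq, Complex.normSq_apply]
    ring
  have hre : ζ.re = s ^ 2 - v.re ^ 2 + v.im ^ 2 := by
    simp [hζ, pow_two]
    ring
  have him : ζ.im = -(2 * v.re * v.im) := by
    simp [hζ, pow_two]
    ring
  have hx : v.re ^ 2 ≤ (κ * ‖v‖) ^ 2 := sq_le_sq' (by linarith [neg_abs_le v.re])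
    ((le_abs_self _).trans hv)
  have hx' : v.re ^ 2 ≤ 1 / 16 * ‖v‖ ^ 2 := by
    refine hx.trans ?_
    rw [mul_pow]
    gcongr
    nlinarith
  have h1 : D / 2 ≤ ζ.re := by
    rw [hre]
    nlinarith [sq_nonneg s, sq_nonneg ‖v‖]
  have h0 : 0 ≤ ζ.re := le_trans (by positivity) h1
  have h2 : ‖ζ‖ ≤ D := by
    refine (norm_sub_le _ _).trans ?_
    rw [norm_pow, norm_pow, Complex.norm_real, Real.norm_of_nonneg hs.le]
  have h3 : D / 2 ≤ ‖ζ‖ := h1.trans (Complex.re_le_norm _)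
  have hζ0 : 0 < ‖ζ‖ := lt_of_lt_of_le (by positivity) h3
  have h4 : |ζ.im| ≤ 2 * κ * D := by
    rw [him, abs_neg, abs_mul, abs_mul, abs_two]
    have h5 : |v.im| ≤ ‖v‖ := Complex.abs_im_le_norm v
    calc 2 * |v.re| * |v.im| ≤ 2 * (κ * ‖v‖) * ‖v‖ := by gcongr
      _ = 2 * κ * ‖v‖ ^ 2 := by ring
      _ ≤ _ := by
        gcongr
        rw [hD]
        nlinarith [sq_nonneg s]
  constructor
  · rw [Complex.re_ofReal_mul, re_one_div]
    calc s / D = 2 * s * (D / 2 / D ^ 2) := by field_simp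
      _ ≤ 2 * s * (ζ.re / ‖ζ‖ ^ 2) := by gcongr
  · rw [Complex.im_ofReal_mul, one_div, Complex.inv_im, Complex.normSq_eq_norm_sq, abs_mul, abs_div,
      abs_neg, abs_of_pos (by positivity : 0 < 2 * s), abs_of_pos (by positivity : 0 < ‖ζ‖ ^ 2)]
    calc _ ≤ 2 * s * (2 * κ * D / (D / 2) ^ 2) := by gcongr
      _ = _ := by
        field_simp
        norm_num

end Pointwise

/-! ### The jump of the Cauchy transform across a flat piece of the support. -/

section Jump

variable {μ : Measure ℂ} {C₀ c₀ : ℝ}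

theorem half_le_norm_sub_of_cone {s κ x : ℝ} {v : ℂ} (hκ : κ ≤ 1 / 4) (hx : |x| = s)
    (hv : s / 2 ≤ ‖v‖ → ‖v‖ ≤ 3 / 2 * s → |v.re| ≤ κ * ‖v‖) : s / 2 ≤ ‖(x : ℂ) - v‖ := by
  have hxn : ‖(x : ℂ)‖ = s := by rw [Complex.norm_real, Real.norm_eq_abs, hx]
  rcases lt_or_ge ‖v‖ (s / 2) with h1 | h1
  · have := norm_sub_norm_le (x : ℂ) v
    linarith
  rcases lt_or_ge (3 / 2 * s) ‖v‖ with h2 | h2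
  · have := norm_sub_norm_le v (x : ℂ)
    rw [norm_sub_rev] at this
    linarith
  have h3 := hv h1 h2
  have h4 := Complex.abs_re_le_norm ((x : ℂ) - v)
  rw [Complex.sub_re, Complex.ofReal_re] at h4
  have h5 := abs_sub_abs_le_abs_sub x v.re
  have h6 : κ * ‖v‖ ≤ 1 / 4 * (3 / 2 * s) := by
    have : 0 ≤ ‖v‖ := norm_nonneg v
    nlinarith
  linarith

/-- The kernels at `±s` differ by `2s/(s² - v²)`. In the cone range this is nearly a positive
Poisson kernel, at least `1 / (2 * s)` in real part on `B(p, s)`, whose mass is at least `c₀ * s`.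
The small inner ball and the far region contribute `O(C₀ / L)`. -/
theorem IsNiceMeasure.jump_of_cone (h : IsNiceMeasure μ C₀) (had : IsADRegularMeasure μ c₀)
    (hC : 0 < C₀) (hc : 0 < c₀) {p e : ℂ} (hp : p ∈ μ.support) (he : ‖e‖ = 1) {s κ L : ℝ}
    (hs : 0 < s) (hκ0 : 0 < κ) (hκ : κ ≤ 1 / 4) (hL : 8 ≤ L) (hL2 : 168 * C₀ / c₀ ≤ L)
    (hcone : ∀ w ∈ μ.support, 2 * s / L ≤ ‖w - p‖ → ‖w - p‖ ≤ s * L / 2 →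
      |(frameCoord p e w).re| ≤ κ * ‖w - p‖) :
    (∀ w ∈ μ.support, s / 2 ≤ ‖w - (p + (-s : ℂ) * e)‖) ∧
      c₀ / 4 ≤ (e * cauchyDiff μ (p + (s : ℂ) * e) (p + (-s : ℂ) * e)).re ∧
      |(e * cauchyDiff μ (p + (s : ℂ) * e) (p + (-s : ℂ) * e)).im| ≤
        80 * κ * C₀ + 40 * C₀ / L := by
  have hL0 : 0 < L := by linarith
  have h2L : 2 * s / L ≤ s / 4 := by
    rw [div_le_div_iff₀ hL0 four_pos]
    nlinarith
  have hsL : 4 * s ≤ s * L / 2 := by nlinarith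
  have hhole : ∀ x : ℝ, |x| = s → ∀ w ∈ μ.support, s / 2 ≤ ‖w - (p + (x : ℂ) * e)‖ := by
    intro x hx w hw
    rw [norm_frame_sub he]
    refine half_le_norm_sub_of_cone hκ hx fun h1 h2 => ?_
    rw [norm_frameCoord he] at h1 h2 ⊢
    exact hcone w hw (by linarith) (by linarith)
  have hplus := hhole s (abs_of_pos hs)
  have hminus := hhole (-s) (by rw [abs_neg, abs_of_pos hs])
  rw [Complex.ofReal_neg] at hminus
  refine ⟨hminus, ?_⟩
  have hs2 : 0 < s / 2 := by positivity
  rw [mul_cauchyDiff_frame he]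
  set v : ℂ → ℂ := frameCoord p e with hv
  set G : ℂ → ℂ := fun w => 1 / ((s : ℂ) - v w) - 1 / ((-s : ℂ) - v w) with hG
  have hGi : Integrable G μ := by
    have := (h.integrable_cauchyDiff hC hs2 hplus hminus).const_mul e
    refine this.congr (ae_of_all _ fun w => ?_)
    simp only [hG, hv, mul_sub, mul_inv_frame_sub he]
  have hGeq : ∀ w ∈ μ.support, G w = (2 * s : ℝ) * (1 / ((s : ℂ) ^ 2 - v w ^ 2)) := by
    intro w hw
    have n1 := hplus w hw
    have n2 := hminus w hw
    rw [norm_frame_sub he] at n1 n2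
    exact one_div_sub_add_one_div (norm_pos_iff.1 (hs2.trans_le n1))
      (norm_pos_iff.1 (hs2.trans_le n2))
  have hvn : ∀ w, ‖v w‖ = ‖w - p‖ := norm_frameCoord he
  set B₁ := Metric.ball p (2 * s / L) with hB₁
  set B₂ := Metric.ball p s with hB₂
  set S₂ : Set ℂ := {w | s ≤ ‖w - p‖} with hS₂
  set S₃ : Set ℂ := {w | s * L / 2 ≤ ‖w - p‖} with hS₃
  have mB₁ : MeasurableSet B₁ := Metric.isOpen_ball.measurableSet
  have mB₂ : MeasurableSet B₂ := Metric.isOpen_ball.measurableSet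
  have mS₂ : MeasurableSet S₂ := measurableSet_le_norm_sub p s
  have mS₃ : MeasurableSet S₃ := measurableSet_le_norm_sub p (s * L / 2)
  have iB : ∀ r c : ℝ, Integrable ((Metric.ball p r).indicator fun _ => c) μ := fun r c =>
    (integrable_indicator_iff Metric.isOpen_ball.measurableSet).2
      (integrableOn_const (h.measure_ball_lt_top _ _).ne)
  have iS₂ : Integrable (S₂.indicator fun w => 1 / ‖w - p‖ ^ 2) μ :=
    (integrable_indicator_iff mS₂).2 (h.integrableOn_inv_sq hC p hs)
  have iS₃ : Integrable (S₃.indicator fun w => 1 / ‖w - p‖ ^ 2) μ :=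
    (integrable_indicator_iff mS₃).2 (h.integrableOn_inv_sq hC p (by positivity))
  have eB : ∀ r c : ℝ, ∫ w, (Metric.ball p r).indicator (fun _ => c) w ∂μ =
      μ.real (Metric.ball p r) * c := fun r c => by
    rw [integral_indicator Metric.isOpen_ball.measurableSet, setIntegral_const, smul_eq_mul]
  have bB₁ : μ.real B₁ ≤ C₀ * (2 * s / L) := h.measureReal_ball_le hC p (by positivity)
  have bB₂ : μ.real B₂ ≤ C₀ * s := h.measureReal_ball_le hC p hs
  have bS₂ : ∫ w, S₂.indicator (fun w => 1 / ‖w - p‖ ^ 2) w ∂μ ≤ 4 * C₀ / s := by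
    rw [integral_indicator mS₂]
    exact h.setIntegral_inv_sq_le hC p hs
  have bS₃ : ∫ w, S₃.indicator (fun w => 1 / ‖w - p‖ ^ 2) w ∂μ ≤ 4 * C₀ / (s * L / 2) := by
    rw [integral_indicator mS₃]
    exact h.setIntegral_inv_sq_le hC p (by positivity)
  have lB₂ : c₀ * s ≤ μ.real B₂ :=
    (ENNReal.ofReal_le_iff_le_toReal (h.measure_ball_lt_top _ _).ne).1 (had p hp _ hs)
  have hmemB : ∀ (w : ℂ) (r : ℝ), w ∈ Metric.ball p r ↔ ‖w - p‖ < r := fun w r => by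
    rw [Metric.mem_ball, dist_eq_norm]
  have hind : ∀ (S : Set ℂ) (w : ℂ), 0 ≤ S.indicator (fun w => 1 / ‖w - p‖ ^ 2) w := fun S w =>
    Set.indicator_nonneg (fun _ _ => by positivity) w
  -- The kernel is at most `4 / s` on `B₁`; the constant is `5 / s` because the term on `B₂`, which
  -- contains `B₁`, has to be paid back there.
  have hcases : ∀ w ∈ μ.support,
      (B₂.indicator (fun _ => 1 / (2 * s)) w - B₁.indicator (fun _ => 5 / s) w -
        4 * s * S₃.indicator (fun w => 1 / ‖w - p‖ ^ 2) w ≤ (G w).re) ∧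
      |(G w).im| ≤ B₁.indicator (fun _ => 4 / s) w +
        4 * s * S₃.indicator (fun w => 1 / ‖w - p‖ ^ 2) w +
        (B₂.indicator (fun _ => 16 * κ / s) w +
          16 * κ * s * S₂.indicator (fun w => 1 / ‖w - p‖ ^ 2) w) := by
    intro w hw
    rw [hGeq w hw]
    rcases lt_or_ge ‖w - p‖ (2 * s / L) with h1 | h1
    · have n := norm_two_mul_one_div_le_of_small hs (v := v w) (by rw [hvn]; linarith)
      have nre := (Complex.abs_re_le_norm _).trans n
      have nim := (Complex.abs_im_le_norm _).trans n
      have a1 : w ∈ B₁ := (hmemB _ _).2 h1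
      have a2 : w ∈ B₂ := (hmemB _ _).2 (by linarith)
      have a3 : w ∉ S₃ := by
        simp only [hS₃, Set.mem_ofPred_eq, not_le]
        linarith
      rw [Set.indicator_of_mem a1, Set.indicator_of_mem a1, Set.indicator_of_mem a2,
        Set.indicator_of_mem a2, Set.indicator_of_notMem a3]
      constructor
      · have e1 : 1 / (2 * s) - 5 / s - 4 * s * 0 = -(4 / s) - 1 / (2 * s) := by
          field_simp
          norm_num
        have e2 : 0 < 1 / (2 * s) := by positivity
        rw [e1]
        linarith [(abs_le.1 nre).1]
      · have := hind S₂ w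
        have : 0 ≤ 16 * κ * s * S₂.indicator (fun w => 1 / ‖w - p‖ ^ 2) w := by positivity
        have : 0 ≤ 16 * κ / s := by positivity
        linarith
    have a1 : w ∉ B₁ := fun hm => by
      rw [hmemB] at hm
      linarith
    rw [Set.indicator_of_notMem a1, Set.indicator_of_notMem a1]
    rcases le_or_gt ‖w - p‖ (s * L / 2) with h2 | h2
    · obtain ⟨nre, nim⟩ := two_mul_one_div_of_cone (v := v w) hs hκ0 hκ (by
        rw [hvn]
        exact hcone w hw h1 h2)
      rw [hvn] at nre nim
      have n3 := hind S₃ w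
      have hD : 0 < s ^ 2 + ‖w - p‖ ^ 2 := by positivity
      have n5 : 0 ≤ 4 * s * S₃.indicator (fun w => 1 / ‖w - p‖ ^ 2) w := by positivity
      constructor
      · refine le_trans ?_ nre
        by_cases a2 : w ∈ B₂
        · rw [Set.indicator_of_mem a2]
          have hlt : ‖w - p‖ < s := (hmemB _ _).1 a2
          have : 1 / (2 * s) ≤ s / (s ^ 2 + ‖w - p‖ ^ 2) := by
            rw [div_le_div_iff₀ (by positivity) hD]
            nlinarith [norm_nonneg (w - p)]
          linarith
        · rw [Set.indicator_of_notMem a2]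
          have : 0 ≤ s / (s ^ 2 + ‖w - p‖ ^ 2) := by positivity
          linarith
      · refine nim.trans ?_
        have n4 : 16 * κ * (s / (s ^ 2 + ‖w - p‖ ^ 2)) ≤ B₂.indicator (fun _ => 16 * κ / s) w +
            16 * κ * s * S₂.indicator (fun w => 1 / ‖w - p‖ ^ 2) w := by
          rcases lt_or_ge ‖w - p‖ s with hlt | hge
          · rw [Set.indicator_of_mem ((hmemB _ _).2 hlt), Set.indicator_of_notMem (by
              simpa [hS₂] using hlt)]
            have : s / (s ^ 2 + ‖w - p‖ ^ 2) ≤ 1 / s := by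
              rw [div_le_div_iff₀ hD hs]
              nlinarith [sq_nonneg ‖w - p‖]
            calc _ ≤ 16 * κ * (1 / s) := by gcongr
              _ = _ := by ring
          · rw [Set.indicator_of_notMem (fun hm => by rw [hmemB] at hm; linarith),
              Set.indicator_of_mem (show w ∈ S₂ from hge)]
            have hpos : 0 < ‖w - p‖ := hs.trans_le hge
            have : s / (s ^ 2 + ‖w - p‖ ^ 2) ≤ s / ‖w - p‖ ^ 2 := by
              gcongr
              nlinarith [sq_nonneg s]
            calc _ ≤ 16 * κ * (s / ‖w - p‖ ^ 2) := by gcongr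
              _ = _ := by ring
        linarith
    · have n := norm_two_mul_one_div_le_of_large hs (v := v w) (by rw [hvn]; linarith)
      rw [hvn] at n
      have nre := (Complex.abs_re_le_norm _).trans n
      have nim := (Complex.abs_im_le_norm _).trans n
      have a3 : w ∈ S₃ := h2.le
      have a2 : w ∉ B₂ := fun hm => by
        rw [hmemB] at hm
        linarith
      rw [Set.indicator_of_notMem a2, Set.indicator_of_notMem a2, Set.indicator_of_mem a3]
      constructor
      · linarith [(abs_le.1 nre).1]
      · have := hind S₂ w
        have : 0 ≤ 16 * κ * s * S₂.indicator (fun w => 1 / ‖w - p‖ ^ 2) w := by positivity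
        linarith
  have hGre : (∫ w, G w ∂μ).re = ∫ w, (G w).re ∂μ := (integral_re hGi).symm
  have hGim : (∫ w, G w ∂μ).im = ∫ w, (G w).im ∂μ := (integral_im hGi).symm
  constructor
  · rw [hGre]
    have i1 := (iB s (1 / (2 * s))).sub (iB (2 * s / L) (5 / s))
    have i2 := iS₃.const_mul (4 * s)
    have hle := integral_mono_ae (i1.sub i2) hGi.re (by
      filter_upwards [Measure.support_mem_ae (μ := μ)] with w hw using (hcases w hw).1)
    rw [integral_sub' i1 i2, integral_sub' (iB _ _) (iB _ _), eB, eB, integral_const_mul] at hle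
    refine le_trans ?_ hle
    have hLc : 42 * C₀ / L ≤ c₀ / 4 := by
      rw [div_le_iff₀ hc] at hL2
      rw [div_le_div_iff₀ hL0 four_pos]
      linarith
    calc c₀ / 4 ≤ c₀ / 2 - 42 * C₀ / L := by linarith
      _ = c₀ * s * (1 / (2 * s)) - C₀ * (2 * s / L) * (5 / s) -
          4 * s * (4 * C₀ / (s * L / 2)) := by
          field_simp
          ring
      _ ≤ _ := by gcongr
  · rw [hGim]
    have i1 := iB (2 * s / L) (4 / s)
    have i2 := iS₃.const_mul (4 * s)
    have i3 := iB s (16 * κ / s)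
    have i4 := iS₂.const_mul (16 * κ * s)
    have hle := norm_integral_le_of_norm_le ((i1.add i2).add (i3.add i4))
      (f := fun w => (G w).im) (by
        filter_upwards [Measure.support_mem_ae (μ := μ)] with w hw using (hcases w hw).2)
    have e0 : ∫ w, (((Metric.ball p (2 * s / L)).indicator (fun _ => 4 / s) +
        fun w => 4 * s * S₃.indicator (fun w => 1 / ‖w - p‖ ^ 2) w) +
        ((Metric.ball p s).indicator (fun _ => 16 * κ / s) +
        fun w => 16 * κ * s * S₂.indicator (fun w => 1 / ‖w - p‖ ^ 2) w)) w ∂μ =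
        μ.real (Metric.ball p (2 * s / L)) * (4 / s) +
          4 * s * ∫ w, S₃.indicator (fun w => 1 / ‖w - p‖ ^ 2) w ∂μ +
        (μ.real (Metric.ball p s) * (16 * κ / s) +
          16 * κ * s * ∫ w, S₂.indicator (fun w => 1 / ‖w - p‖ ^ 2) w ∂μ) := by
      rw [integral_add' (i1.add i2) (i3.add i4), integral_add' i1 i2, integral_add' i3 i4, eB, eB,
        integral_const_mul, integral_const_mul]
    rw [e0] at hle
    refine hle.trans ?_
    calc _ ≤ C₀ * (2 * s / L) * (4 / s) + 4 * s * (4 * C₀ / (s * L / 2)) +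
          (C₀ * s * (16 * κ / s) + 16 * κ * s * (4 * C₀ / s)) := by gcongr
      _ = _ := by
          field_simp
          ring

end Jump

/-! ### Finding a scale at which the support is flat. -/

section Jump

variable {μ : Measure ℂ} {C₀ c₀ : ℝ}

/-- Adding `1 / d` makes the integrand non-negative on the support, so the total can be shared among
annuli. The `1` is the assumed bound on `cauchyDiff`; `8 * C₀` comes from outside the ball and `4 *
C₀` from the constant `2 / d` inside. -/
theorem IsNiceMeasure.setIntegral_re_frame_le (h : IsNiceMeasure μ C₀) (hC : 0 < C₀) {p e : ℂ}
    (he : ‖e‖ = 1) {d t : ℝ} (hd : 0 < d) (ht : 0 < t) (htd : t ≤ d / 2)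
    (hball : ∀ w ∈ μ.support, d ≤ ‖w - (p + (d : ℂ) * e)‖)
    (hH : ‖cauchyDiff μ (p + (t : ℂ) * e) (p + (d : ℂ) * e)‖ ≤ 1) :
    IntegrableOn (fun w => (1 / ((t : ℂ) - frameCoord p e w)).re + 1 / d)
      (Metric.ball p (2 * d)) μ ∧
    ∫ w in Metric.ball p (2 * d), ((1 / ((t : ℂ) - frameCoord p e w)).re + 1 / d) ∂μ ≤
      1 + 12 * C₀ := by
  set v : ℂ → ℂ := frameCoord p e with hv
  set B := Metric.ball p (2 * d) with hB
  have mB : MeasurableSet B := Metric.isOpen_ball.measurableSet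
  have hvm : Measurable v := (continuous_frameCoord p e).measurable
  have hdv : ∀ w ∈ μ.support, d ≤ ‖(d : ℂ) - v w‖ := fun w hw => by
    have := hball w hw
    rwa [norm_frame_sub he] at this
  have htv : ∀ w ∈ μ.support, t ≤ ‖(t : ℂ) - v w‖ := fun w hw => by
    have h1 := norm_add_le ((d : ℂ) - t) (t - v w)
    rw [sub_add_sub_cancel, ← Complex.ofReal_sub, Complex.norm_real,
      Real.norm_of_nonneg (by linarith)] at h1
    linarith [hdv w hw]
  have htw : ∀ w ∈ μ.support, t ≤ ‖w - (p + (t : ℂ) * e)‖ := fun w hw => by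
    rw [norm_frame_sub he]
    exact htv w hw
  set D : ℂ → ℂ := fun w => 1 / ((t : ℂ) - v w) - 1 / ((d : ℂ) - v w) with hD
  have hDi : Integrable D μ := by
    have := (h.integrable_cauchyDiff hC ht htw
      (fun w hw => (by linarith : t ≤ d).trans (hball w hw))).const_mul e
    refine this.congr (ae_of_all _ fun w => ?_)
    simp only [hD, hv, mul_sub, mul_inv_frame_sub he]
  have hDre : Integrable (fun w => (D w).re) μ := hDi.re
  have hDint : ‖∫ w, D w ∂μ‖ ≤ 1 := by
    rw [← mul_cauchyDiff_frame he, norm_mul, he, one_mul]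
    exact hH
  have hinv : ∀ x : ℝ, 0 < x → (∀ w ∈ μ.support, x ≤ ‖(x : ℂ) - v w‖) →
      IntegrableOn (fun w => 1 / ((x : ℂ) - v w)) B μ := fun x hx hxv => by
    have hm : Measurable fun w => 1 / ((x : ℂ) - v w) := by fun_prop
    refine Measure.integrableOn_of_bounded (M := 1 / x) (h.measure_ball_lt_top _ _).ne
      hm.aestronglyMeasurable (ae_restrict_of_ae ?_)
    filter_upwards [Measure.support_mem_ae (μ := μ)] with w hw
    rw [norm_div, norm_one]
    exact one_div_le_one_div_of_le hx (hxv w hw)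
  have iconst : ∀ c : ℝ, IntegrableOn (fun _ : ℂ => c) B μ := fun c =>
    integrableOn_const (h.measure_ball_lt_top _ _).ne
  have hgi : IntegrableOn (fun w => (1 / ((t : ℂ) - v w)).re + 1 / d) B μ :=
    (hinv t ht htv).re.add (iconst _)
  refine ⟨hgi, ?_⟩
  have h1 : ∫ w in B, ((1 / ((t : ℂ) - v w)).re + 1 / d) ∂μ ≤
      ∫ w in B, ((D w).re + 2 / d) ∂μ := by
    refine setIntegral_mono_on_ae hgi (hDre.integrableOn.add (iconst _)) mB ?_
    filter_upwards [Measure.support_mem_ae (μ := μ)] with w hw _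
    have h2 : (1 / ((d : ℂ) - v w)).re ≤ 1 / d := by
      refine (Complex.re_le_norm _).trans ?_
      rw [norm_div, norm_one]
      exact one_div_le_one_div_of_le hd (hdv w hw)
    have h3 : (D w).re = (1 / ((t : ℂ) - v w)).re - (1 / ((d : ℂ) - v w)).re := by
      simp only [hD, Complex.sub_re]
    have h4 : 2 / d = 1 / d + 1 / d := by ring
    linarith
  have h2 : ∫ w in B, ((D w).re + 2 / d) ∂μ = ∫ w in B, (D w).re ∂μ + μ.real B * (2 / d) := by
    rw [integral_add hDre.integrableOn (iconst _), setIntegral_const, smul_eq_mul]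
  have h3 : ∫ w in B, (D w).re ∂μ + ∫ w in Bᶜ, (D w).re ∂μ ≤ 1 := by
    have e1 : ∫ w, (D w).re ∂μ = (∫ w, D w ∂μ).re := integral_re hDi
    rw [integral_add_compl mB hDre]
    exact e1.le.trans ((Complex.re_le_norm _).trans hDint)
  have h4 : |∫ w in Bᶜ, (D w).re ∂μ| ≤ 8 * C₀ := by
    have hBc : Bᶜ = {w : ℂ | 2 * d ≤ ‖w - p‖} := by
      ext w
      simp [hB, dist_eq_norm]
    have hsq := (h.integrableOn_inv_sq hC p (by positivity : 0 < 2 * d)).const_mul (4 * d)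
    rw [← hBc] at hsq
    calc |∫ w in Bᶜ, (D w).re ∂μ| ≤ ∫ w in Bᶜ, 4 * d * (1 / ‖w - p‖ ^ 2) ∂μ := by
          refine norm_integral_le_of_norm_le (f := fun w => (D w).re) hsq ?_
          rw [ae_restrict_iff' mB.compl]
          filter_upwards [Measure.support_mem_ae (μ := μ)] with w hw hwB
          have hwB' : 2 * d ≤ ‖w - p‖ := by
            rw [hBc] at hwB
            exact hwB
          have hx : ∀ x : ℝ, 0 < x → x ≤ d → ‖w - p‖ / 2 ≤ ‖(x : ℂ) - v w‖ := fun x hx hxd => by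
            have h5 := norm_sub_norm_le (v w) (x : ℂ)
            rw [norm_sub_rev, hv, norm_frameCoord he, Complex.norm_real,
              Real.norm_of_nonneg hx.le] at h5
            linarith
          have hp0 : 0 < ‖w - p‖ := by linarith
          have hxt := hx t ht (by linarith)
          have hxd := hx d hd le_rfl
          have n1 : (t : ℂ) - v w ≠ 0 := norm_pos_iff.1 (by linarith)
          have n2 : (d : ℂ) - v w ≠ 0 := norm_pos_iff.1 (by linarith)
          have e2 : D w = ((d - t : ℝ) : ℂ) * (1 / ((t : ℂ) - v w)) * (1 / ((d : ℂ) - v w)) := by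
            simp only [hD]
            push_cast
            field_simp
            ring
          refine (Complex.abs_re_le_norm _).trans ?_
          rw [e2, norm_mul, norm_mul, norm_div, norm_div, norm_one, Complex.norm_real,
            Real.norm_of_nonneg (by linarith)]
          calc _ ≤ d * (1 / (‖w - p‖ / 2)) * (1 / (‖w - p‖ / 2)) := by
                gcongr
                linarith
            _ = _ := by
                field_simp
                norm_num
      _ = 4 * d * ∫ w in {w | 2 * d ≤ ‖w - p‖}, 1 / ‖w - p‖ ^ 2 ∂μ := by
          rw [integral_const_mul, hBc]
      _ ≤ 4 * d * (4 * C₀ / (2 * d)) := by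
          gcongr
          exact h.setIntegral_inv_sq_le hC p (by positivity)
      _ = 8 * C₀ := by
          field_simp
          norm_num
  have h5 : μ.real B * (2 / d) ≤ 4 * C₀ := by
    calc _ ≤ C₀ * (2 * d) * (2 / d) := by
          gcongr
          exact h.measureReal_ball_le hC p (by positivity)
      _ = 4 * C₀ := by
          field_simp
          norm_num
  rw [h2] at h1
  linarith [neg_abs_le (∫ w in Bᶜ, (D w).re ∂μ)]

/-- Pigeonhole: an annulus without the cone property takes a fixed share of an integral bounded by
`1 + 12 * C₀`, and there are too many annuli for all to fail. -/
theorem exists_cone_scale {C₀ c₀ κ L : ℝ} (hC : 0 < C₀) (hc : 0 < c₀) (hκ0 : 0 < κ) (hκ : κ ≤ 1)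
    (hL : 8 ≤ L) (hκL : 1 / L ^ 2 ≤ κ) :
    ∃ η : ℝ, 0 < η ∧ η ≤ 1 / 2 ∧ ∀ μ : Measure ℂ, IsNiceMeasure μ C₀ → IsADRegularMeasure μ c₀ →
      ∀ (p e : ℂ) (d : ℝ), ‖e‖ = 1 → 0 < d →
        (∀ w ∈ μ.support, d ≤ ‖w - (p + (d : ℂ) * e)‖) →
        ‖cauchyDiff μ (p + ((η * d : ℝ) : ℂ) * e) (p + (d : ℂ) * e)‖ ≤ 1 →
        ∃ s : ℝ, η * d ≤ s ∧ s ≤ d / 2 ∧ ∀ w ∈ μ.support, 2 * s / L ≤ ‖w - p‖ →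
          ‖w - p‖ ≤ s * L / 2 → |(frameCoord p e w).re| ≤ κ * ‖w - p‖ := by
  have hL0 : 0 < L := by linarith
  set q := 1 / L ^ 2 with hq
  have hq0 : 0 < q := by positivity
  have hq1 : q ≤ 1 / 64 := by
    rw [hq]
    apply one_div_le_one_div_of_le (by norm_num)
    nlinarith
  have hqL : q * L = 1 / L := by
    rw [hq]
    field_simp
  have hL8 : 1 / L ≤ 1 / 8 := one_div_le_one_div_of_le (by norm_num) hL
  -- The share of a failing annulus: the integrand is at least `κ / (8 * r)` on a ball of mass at
  -- least `c₀ * κ * r / 2`.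
  set m := c₀ * κ ^ 2 / 16 with hm
  have hm0 : 0 < m := by positivity
  obtain ⟨N, hN⟩ := exists_nat_gt ((1 + 12 * C₀) / m)
  rw [div_lt_iff₀ hm0] at hN
  have hqpow : ∀ n : ℕ, q ^ (n + 1) ≤ q := fun n => by
    rw [pow_succ]
    exact mul_le_of_le_one_left hq0.le (pow_le_one₀ hq0.le (by linarith))
  refine ⟨q ^ (N + 1), by positivity, (hqpow N).trans (by linarith), ?_⟩
  intro μ h had p e d he hd hball hH
  by_contra! hcon
  set t := q ^ (N + 1) * d with ht
  have ht0 : 0 < t := by positivity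
  have htd : t ≤ d / 2 := by
    have : t ≤ q * d := by
      rw [ht]
      gcongr
      exact hqpow N
    nlinarith
  obtain ⟨hgi, hgle⟩ := h.setIntegral_re_frame_le hC he hd ht0 htd hball hH
  set v : ℂ → ℂ := frameCoord p e with hv
  set g : ℂ → ℝ := fun w => (1 / ((t : ℂ) - v w)).re + 1 / d with hg
  set B := Metric.ball p (2 * d) with hB
  have hdv : ∀ w ∈ μ.support, d ≤ ‖(d : ℂ) - v w‖ := fun w hw => by
    have := hball w hw
    rwa [norm_frame_sub he] at this
  have hg0 : ∀ᵐ w ∂μ, 0 ≤ g w := by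
    filter_upwards [Measure.support_mem_ae (μ := μ)] with w hw
    have := neg_inv_le_re_one_div_sub hd ht0 htd (hdv w hw)
    simp only [hg]
    linarith
  set A : ℕ → Set ℂ := fun j => {w | q ^ (j + 2) * d ≤ ‖w - p‖ ∧ ‖w - p‖ < q ^ (j + 1) * d} with hA
  have hnm : Measurable fun w : ℂ => ‖w - p‖ := by fun_prop
  have mA : ∀ j, MeasurableSet (A j) := fun j =>
    (measurableSet_le measurable_const hnm).inter (measurableSet_lt hnm measurable_const)
  have hAB : ∀ j, A j ⊆ B := fun j w hw => by
    rw [hB, Metric.mem_ball, dist_eq_norm]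
    have h1 : q ^ (j + 1) * d ≤ q * d := by
      gcongr
      exact hqpow j
    have := hw.2
    nlinarith
  have hAd : ∀ i j, i < j → Disjoint (A i) (A j) := fun i j hij => by
    rw [Set.disjoint_left]
    intro w hi hj
    have h1 : q ^ (j + 1) * d ≤ q ^ (i + 2) * d := by
      gcongr ?_ * d
      exact pow_le_pow_of_le_one hq0.le (by linarith) (by omega)
    linarith [hi.1, hj.2]
  have hAd' : Set.Pairwise (↑(Finset.range N)) (Function.onFun Disjoint A) := fun i _ j _ hij => by
    rcases lt_or_gt_of_ne hij with hlt | hgt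
    · exact hAd i j hlt
    · exact (hAd j i hgt).symm
  have hlow : ∀ j ∈ Finset.range N, m ≤ ∫ w in A j, g w ∂μ := by
    intro j hj
    rw [Finset.mem_range] at hj
    have hqj : 0 < q ^ (j + 1) * d := by positivity
    have htj : t ≤ q ^ (j + 2) * d := by
      rw [ht]
      gcongr ?_ * d
      exact pow_le_pow_of_le_one hq0.le (by linarith) (by omega)
    have e1 : q ^ (j + 2) * d = q ^ (j + 1) * d / L / L := by
      rw [pow_succ, hq]
      field_simp
    -- At this scale the cone range lies in `A j` with a factor 2 to spare at either end, leaving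
    -- room for the ball `b` about `z`.
    obtain ⟨z, hz, hz1, hz2, hz3⟩ := hcon (q ^ (j + 1) * d / L)
      (htj.trans (by
        rw [e1]
        exact div_le_self (by positivity) (by linarith)))
      (by
        have h1 : q ^ (j + 1) * d ≤ q * d := by
          gcongr
          exact hqpow j
        calc q ^ (j + 1) * d / L ≤ q ^ (j + 1) * d := div_le_self hqj.le (by linarith)
          _ ≤ d / 2 := by nlinarith)
    rw [mul_div_assoc, ← e1] at hz1
    rw [div_mul_cancel₀ _ hL0.ne'] at hz2
    set r := ‖z - p‖ with hr
    have hr0 : 0 < r := lt_of_lt_of_le (by positivity) hz1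
    have hre : (v z).re < -(κ * r) := by
      rcases lt_abs.1 hz3 with h1 | h1
      -- On the side of the empty disc, real part above `κ * r` would force `r > 2 * κ * d`, beyond
      -- the annulus.
      · exfalso
        have h2 := hdv z hz
        have h3 : d ^ 2 ≤ ‖(d : ℂ) - v z‖ ^ 2 := by gcongr
        have h4 : ‖(d : ℂ) - v z‖ ^ 2 = d ^ 2 - 2 * d * (v z).re + ‖v z‖ ^ 2 := by
          rw [← Complex.normSq_eq_norm_sq, ← Complex.normSq_eq_norm_sq, Complex.normSq_apply,
            Complex.normSq_apply]
          simp
          ring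
        rw [hv, norm_frameCoord he, ← hr, ← hv] at h4
        have h5 : 2 * d * (κ * r) < r * r := by nlinarith
        have h6 : 2 * d * κ < r := by
          by_contra hcon
          have := mul_le_mul_of_nonneg_right (not_lt.1 hcon) hr0.le
          linarith
        have h7 : q ^ (j + 1) * d ≤ κ * d := by
          gcongr
          exact (hqpow j).trans hκL
        nlinarith
      · linarith
    set b := Metric.ball z (κ * r / 2) with hb
    have hbr : ∀ w ∈ b, ‖w - z‖ < κ * r / 2 := fun w hw => by
      rwa [hb, Metric.mem_ball, dist_eq_norm] at hw
    have hκr : κ * r / 2 ≤ r / 2 := by nlinarith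
    have hbA : b ⊆ A j := fun w hw => by
      have h1 := hbr w hw
      have h2 := norm_add_le (w - z) (z - p)
      have h3 := norm_sub_norm_le (z - p) (z - w)
      rw [sub_add_sub_cancel] at h2
      rw [sub_sub_sub_cancel_left, norm_sub_rev z w] at h3
      refine ⟨by linarith, by linarith⟩
    have hmb : c₀ * (κ * r / 2) ≤ μ.real b :=
      (ENNReal.ofReal_le_iff_le_toReal (h.measure_ball_lt_top _ _).ne).1
        (had z hz _ (by positivity))
    have hgiA : IntegrableOn g (A j) μ := hgi.mono_set (hAB j)
    have hgb : ∀ w ∈ b, κ / (8 * r) ≤ g w := fun w hw => by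
      have h1 := hbr w hw
      have h2 : ‖v w‖ ≤ 3 / 2 * r := by
        rw [hv, norm_frameCoord he]
        have h2 := norm_add_le (w - z) (z - p)
        rw [sub_add_sub_cancel] at h2
        linarith
      have h3 : (v w).re ≤ -(κ * r / 2) := by
        have h4 : v w - v z = (starRingEnd ℂ) e * (w - z) := by
          simp only [hv, frameCoord]
          ring
        have h5 : ‖v w - v z‖ = ‖w - z‖ := by
          rw [h4, norm_mul, RCLike.norm_conj, he, one_mul]
        have h6 := Complex.re_le_norm (v w - v z)
        rw [Complex.sub_re, h5] at h6
        linarith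
      have h4 := le_re_one_div_sub hr0 hκ0 ht0 (by linarith) h2 h3
      have : 0 < 1 / d := by positivity
      simp only [hg]
      linarith
    calc m = κ / (8 * r) * (c₀ * (κ * r / 2)) := by
          rw [hm]
          field_simp
          norm_num
      _ ≤ κ / (8 * r) * μ.real b := by gcongr
      _ = ∫ _ in b, κ / (8 * r) ∂μ := by rw [setIntegral_const, smul_eq_mul, mul_comm]
      _ ≤ ∫ w in b, g w ∂μ := setIntegral_mono_on
          (integrableOn_const (h.measure_ball_lt_top _ _).ne) (hgiA.mono_set hbA)
          Metric.isOpen_ball.measurableSet hgb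
      _ ≤ ∫ w in A j, g w ∂μ :=
          setIntegral_mono_set hgiA (ae_restrict_of_ae hg0) (ae_of_all _ hbA)
  have hsum := Finset.sum_le_sum hlow
  rw [Finset.sum_const, Finset.card_range, nsmul_eq_mul] at hsum
  have hU : ∑ j ∈ Finset.range N, ∫ w in A j, g w ∂μ = ∫ w in ⋃ j ∈ Finset.range N, A j, g w ∂μ :=
    (integral_biUnion_finset (Finset.range N) (fun j _ => mA j) hAd'
      (fun j _ => hgi.mono_set (hAB j))).symm
  have hUB : ∫ w in ⋃ j ∈ Finset.range N, A j, g w ∂μ ≤ ∫ w in B, g w ∂μ :=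
    setIntegral_mono_set hgi (ae_restrict_of_ae hg0)
      (ae_of_all _ (Set.iUnion₂_subset fun j _ => hAB j))
  linarith

theorem exists_jump {C₀ c₀ ε : ℝ} (hC : 0 < C₀) (hc : 0 < c₀) (hε : 0 < ε) :
    ∃ η : ℝ, 0 < η ∧ η ≤ 1 / 2 ∧ ∀ μ : Measure ℂ, IsNiceMeasure μ C₀ → IsADRegularMeasure μ c₀ →
      ∀ (p e : ℂ) (d : ℝ), p ∈ μ.support → ‖e‖ = 1 → 0 < d →
        (∀ w ∈ μ.support, d ≤ ‖w - (p + (d : ℂ) * e)‖) →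
        ‖cauchyDiff μ (p + ((η * d : ℝ) : ℂ) * e) (p + (d : ℂ) * e)‖ ≤ 1 →
        ∃ s : ℝ, η * d ≤ s ∧ s ≤ d / 2 ∧
          (∀ w ∈ μ.support, s / 2 ≤ ‖w - (p + (-s : ℂ) * e)‖) ∧
          c₀ / 4 ≤ (e * cauchyDiff μ (p + (s : ℂ) * e) (p + (-s : ℂ) * e)).re ∧
          |(e * cauchyDiff μ (p + (s : ℂ) * e) (p + (-s : ℂ) * e)).im| ≤ ε := by
  set κ := min (1 / 4) (ε / (160 * C₀)) with hκ
  have hκ0 : 0 < κ := by positivity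
  set L := 8 + 168 * C₀ / c₀ + 80 * C₀ / ε + 1 / κ with hL
  have p1 : 0 < 168 * C₀ / c₀ := by positivity
  have p2 : 0 < 80 * C₀ / ε := by positivity
  have p3 : 0 < 1 / κ := by positivity
  have hL8 : 8 ≤ L := by linarith
  have hL0 : 0 < L := by linarith
  have hκL : 1 / L ^ 2 ≤ κ := by
    rw [div_le_iff₀ (by positivity)]
    have h1 : 1 / κ ≤ L := by linarith
    rw [div_le_iff₀ hκ0] at h1
    nlinarith
  have hκ4 : κ ≤ 1 / 4 := min_le_left _ _
  obtain ⟨η, hη0, hη1, H⟩ := exists_cone_scale hC hc hκ0 (by linarith) hL8 hκL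
  refine ⟨η, hη0, hη1, fun μ h had p e d hp he hd hball hH => ?_⟩
  obtain ⟨s, hs1, hs2, hcone⟩ := H μ h had p e d he hd hball hH
  have hs0 : 0 < s := lt_of_lt_of_le (by positivity) hs1
  obtain ⟨j1, j2, j3⟩ := h.jump_of_cone had hC hc hp he hs0 hκ0 hκ4 hL8 (by linarith) hcone
  refine ⟨s, hs1, hs2, j1, j2, j3.trans ?_⟩
  have h1 : 80 * κ * C₀ ≤ ε / 2 := by
    have : κ ≤ ε / (160 * C₀) := min_le_right _ _
    rw [le_div_iff₀ (by positivity)] at this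
    linarith
  have h2 : 40 * C₀ / L ≤ ε / 2 := by
    rw [div_le_div_iff₀ hL0 two_pos]
    have : 80 * C₀ / ε ≤ L := by linarith
    rw [div_le_iff₀ hε] at this
    linarith
  linarith

end Jump

/-! ### Rigidity of a potential with at most one non-zero value. -/

section Rigidity

variable {D : ℂ → ℝ} {H : ℂ → ℂ} {K c₁ : ℝ}

/-- A continuous function with finitely many values is constant on a connected set, here the
zero-free ball about `x`. -/
theorem eq_on_ball_of_two_valued (hD : ∀ x y, D y ≤ D x + ‖x - y‖)
    (hlip : ∀ η x y, 0 < η → η ≤ D x → η ≤ D y → ‖H x - H y‖ ≤ K / η * ‖x - y‖)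
    (hval : ∀ x y, 0 < D x → 0 < D y → H x ≠ 0 → H y ≠ 0 → H x = H y)
    {x y : ℂ} (hxy : ‖y - x‖ < D x) : H y = H x := by
  by_cases hne : H x = 0 ∧ H y = 0
  · rw [hne.1, hne.2]
  have hpos : ∀ z ∈ Metric.ball x (D x), 0 < D z := fun z hz => by
    rw [Metric.mem_ball, dist_eq_norm] at hz
    have := hD z x
    linarith
  have hxpos : 0 < D x := (norm_nonneg _).trans_lt hxy
  have hxm : x ∈ Metric.ball x (D x) := Metric.mem_ball_self hxpos
  have hym : y ∈ Metric.ball x (D x) := by rwa [Metric.mem_ball, dist_eq_norm]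
  have hc : ContinuousOn H (Metric.ball x (D x)) := by
    intro z hz
    have hz0 := hpos z hz
    refine ContinuousAt.continuousWithinAt ?_
    have hL : LipschitzOnWith (K / (D z / 2)).toNNReal H (Metric.ball z (D z / 2)) := by
      refine LipschitzOnWith.of_dist_le' fun u hu w hw => ?_
      rw [Metric.mem_ball, dist_eq_norm] at hu hw
      rw [dist_eq_norm, dist_eq_norm]
      have h1 := hD u z
      have h2 := hD w z
      exact hlip _ u w (by positivity) (by linarith) (by linarith)
    exact hL.continuousOn.continuousAt (Metric.ball_mem_nhds z (by positivity))
  have hmaps : Set.MapsTo H (Metric.ball x (D x)) {0, H x, H y} := by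
    intro z hz
    by_cases hz0 : H z = 0
    · exact Or.inl hz0
    · rcases not_and_or.1 hne with h | h
      · exact Or.inr (Or.inl (hval z x (hpos z hz) hxpos hz0 h))
      · exact Or.inr (Or.inr (hval z y (hpos z hz) (hpos y hym) hz0 h))
  have hfin : ({0, H x, H y} : Set ℂ).Finite := by simp
  exact (convex_ball x (D x)).isPreconnected.constant_of_mapsTo hfin.isDiscrete hc hmaps hym hxm

theorem eq_norm_div_of_im_eq_zero {e k : ℂ} (he : ‖e‖ = 1) (him : (e * k).im = 0)
    (hre : 0 < (e * k).re) : e = ‖k‖ / k := by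
  have hk : k ≠ 0 := by
    rintro rfl
    simp at hre
  have h1 : e * k = ((e * k).re : ℂ) := by
    apply Complex.ext <;> simp [him]
  have h2 : ‖e * k‖ = (e * k).re := by
    rw [h1, Complex.norm_real, Real.norm_of_nonneg hre.le, Complex.ofReal_re]
  rw [norm_mul, he, one_mul] at h2
  rw [eq_div_iff hk, h1, ← h2]

/-- `e` is a unit vector pointing from a zero of `D` nearest to `x` towards `x`, across which `H`
jumps by a positive multiple of the conjugate of `e`. -/
def IsJumpDirection (D : ℂ → ℝ) (H : ℂ → ℂ) (c₁ : ℝ) (x e : ℂ) : Prop :=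
  ‖e‖ = 1 ∧ D (x - D x * e) = 0 ∧ ∀ ε > 0, ∃ y, 0 < D y ∧
    c₁ ≤ (e * (H x - H y)).re ∧ |(e * (H x - H y)).im| ≤ ε

/-- All points across a jump from `H x` carry one and the same value, whatever `ε` is. So `e` times
a fixed number `k` is real and positive, and `e = ‖k‖ / k` depends on `H x` alone. -/
theorem IsJumpDirection.unique (hc₁ : 0 < c₁)
    (hval : ∀ x y, 0 < D x → 0 < D y → H x ≠ 0 → H y ≠ 0 → H x = H y) {x x' e e' : ℂ}
    (hx : 0 < D x) (hxx : H x' = H x) (he : IsJumpDirection D H c₁ x e)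
    (he' : IsJumpDirection D H c₁ x' e') : e = e' := by
  obtain ⟨he1, -, he2⟩ := he
  obtain ⟨he1', -, he2'⟩ := he'
  rw [hxx] at he2'
  have hne : ∀ (e y : ℂ), c₁ ≤ (e * (H x - H y)).re → H x ≠ H y := fun e y h heq => by
    rw [heq, sub_self, mul_zero, Complex.zero_re] at h
    linarith
  have hsame : ∀ y y', 0 < D y → 0 < D y' → H x ≠ H y → H x ≠ H y' → H y = H y' := by
    intro y y' hy hy' h h'
    by_cases hx0 : H x = 0
    · rw [hx0] at h h'
      exact hval y y' hy hy' h.symm h'.symm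
    · have hz : ∀ u, 0 < D u → H x ≠ H u → H u = 0 := fun u hu hne => by
        by_contra h0
        exact hne (hval x u hx hu hx0 h0)
      rw [hz y hy h, hz y' hy' h']
  obtain ⟨y₀, hy₀, hr₀, -⟩ := he2 1 one_pos
  have key : ∀ e : ℂ, ‖e‖ = 1 → (∀ ε > 0, ∃ y, 0 < D y ∧
      c₁ ≤ (e * (H x - H y)).re ∧ |(e * (H x - H y)).im| ≤ ε) →
      e = ‖H x - H y₀‖ / (H x - H y₀) := by
    intro e he h
    have h' : ∀ ε > 0, c₁ ≤ (e * (H x - H y₀)).re ∧ |(e * (H x - H y₀)).im| ≤ ε := fun ε hε => by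
      obtain ⟨y, hy, hr, hi⟩ := h ε hε
      have heq := hsame y y₀ hy hy₀ (hne e y hr) (hne _ y₀ hr₀)
      rw [heq] at hr hi
      exact ⟨hr, hi⟩
    refine eq_norm_div_of_im_eq_zero he ?_ (hc₁.trans_le (h' 1 one_pos).1)
    exact abs_nonpos_iff.1 (le_of_forall_pos_le_add fun ε hε => by
      rw [zero_add]
      exact (h' ε hε).2)
  rw [key e he1 he2, key e' he1' he2']

theorem exists_half_plane (hc₁ : 0 < c₁) (hD : ∀ x y, D y ≤ D x + ‖x - y‖)
    (hlip : ∀ η x y, 0 < η → η ≤ D x → η ≤ D y → ‖H x - H y‖ ≤ K / η * ‖x - y‖)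
    (hval : ∀ x y, 0 < D x → 0 < D y → H x ≠ 0 → H y ≠ 0 → H x = H y)
    (hjump : ∀ x, 0 < D x → ∃ e, IsJumpDirection D H c₁ x e) {x : ℂ} (hx : 0 < D x) :
    ∃ e : ℂ, ∀ y, 0 ≤ ((starRingEnd ℂ) e * (y - x)).re → 0 < D y := by
  obtain ⟨e, he⟩ := hjump x hx
  have he1 : ‖e‖ = 1 := he.1
  refine ⟨e, fun y hy => ?_⟩
  have hstep : ∀ n : ℕ, D (x + (((3 / 2) ^ n - 1) * D x : ℝ) * e) = (3 / 2) ^ n * D x ∧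
      H (x + (((3 / 2) ^ n - 1) * D x : ℝ) * e) = H x := by
    intro n
    induction n with
    | zero => simp
    | succ n ih =>
      set d := (3 / 2 : ℝ) ^ n * D x with hd
      have hd0 : 0 < d := by positivity
      set u := x + (((3 / 2) ^ n - 1) * D x : ℝ) * e with hu
      have hu' : x + (((3 / 2) ^ (n + 1) - 1) * D x : ℝ) * e = u + (d / 2 : ℝ) * e := by
        rw [hu, hd]
        push_cast
        ring
      rw [hu']
      set u' := u + (d / 2 : ℝ) * e with hu'd
      have hn : ‖u' - u‖ = d / 2 := by
        rw [hu'd, add_sub_cancel_left, norm_mul, he1, mul_one, Complex.norm_real,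
          Real.norm_of_nonneg (by positivity)]
      have hHu : H u' = H x := by
        rw [← ih.2]
        exact eq_on_ball_of_two_valued hD hlip hval (by rw [hn, ih.1]; linarith)
      have hDu' : d / 2 ≤ D u' := by
        have := hD u' u
        rw [hn, ih.1] at this
        linarith
      obtain ⟨e', he'⟩ := hjump u' (by linarith)
      have hee : e = e' := he.unique hc₁ hval hx hHu he'
      rw [← hee] at he'
      have h0 := he'.2.1
      -- The zero of `D` behind `u'` is on the line through `u` in direction `e` and outside the
      -- disc of radius `d` about `u`, hence at distance at least `3 * d / 2` from `u'`.
      have h1 := hD (u' - D u' * e) u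
      have h2 : u' - D u' * e - u = ((d / 2 - D u' : ℝ) : ℂ) * e := by
        rw [hu'd]
        push_cast
        ring
      rw [h0, h2, norm_mul, he1, mul_one, Complex.norm_real, zero_add, ih.1, Real.norm_eq_abs] at h1
      have h3 := hD u u'
      rw [norm_sub_rev, hn, ih.1] at h3
      refine ⟨?_, hHu⟩
      have h4 : d + d / 2 ≤ D u' := by
        rcases le_abs.1 h1 with h | h <;> linarith
      have h5 : (3 / 2 : ℝ) ^ (n + 1) * D x = d + d / 2 := by
        rw [hd]
        ring
      rw [h5]
      exact le_antisymm h3 h4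
  set v := (starRingEnd ℂ) e * (y - x) with hv
  -- The growing discs all touch `x - D x * e` and exhaust the open half-plane beyond it. The bound
  -- is what membership of `y` in the disc of radius `T` requires.
  obtain ⟨n, hn⟩ := pow_unbounded_of_one_lt ((‖v‖ ^ 2 + 2 * D x * v.re + D x ^ 2) / (2 * D x ^ 2) + 1)
    (by norm_num : (1 : ℝ) < 3 / 2)
  obtain ⟨h1, -⟩ := hstep n
  set T := (3 / 2 : ℝ) ^ n * D x with hT
  have hT1 : D x ≤ T := le_mul_of_one_le_left hx.le (one_le_pow₀ (by norm_num))
  have hT2 : ‖v‖ ^ 2 + 2 * D x * v.re + D x ^ 2 < 2 * D x * T := by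
    have h2 : (‖v‖ ^ 2 + 2 * D x * v.re + D x ^ 2) / (2 * D x ^ 2) < (3 / 2) ^ n := by linarith
    rw [div_lt_iff₀ (by positivity)] at h2
    rw [hT]
    linarith
  have hnorm : ‖y - (x + (((3 / 2) ^ n - 1) * D x : ℝ) * e)‖ < T := by
    have e1 : ((3 / 2 : ℝ) ^ n - 1) * D x = T - D x := by
      rw [hT]
      ring
    rw [e1, norm_frame_sub he1]
    change ‖((T - D x : ℝ) : ℂ) - v‖ < T
    have e2 : ‖((T - D x : ℝ) : ℂ) - v‖ ^ 2 = (T - D x) ^ 2 - 2 * (T - D x) * v.re + ‖v‖ ^ 2 := by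
      rw [← Complex.normSq_eq_norm_sq, ← Complex.normSq_eq_norm_sq, Complex.normSq_apply,
        Complex.normSq_apply]
      simp
      ring
    refine lt_of_pow_lt_pow_left₀ 2 (by linarith) ?_
    rw [e2]
    nlinarith [mul_nonneg (by linarith : 0 ≤ T) hy]
  have h2 := hD y (x + (((3 / 2) ^ n - 1) * D x : ℝ) * e)
  rw [h1] at h2
  linarith

theorem not_mem_segment_of_half_plane {x ζ ξ : ℂ}
    (h : ∃ e : ℂ, ∀ y, 0 ≤ ((starRingEnd ℂ) e * (y - x)).re → 0 < D y)
    (hζ : D ζ = 0) (hξ : D ξ = 0) : x ∉ segment ℝ ζ ξ := by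
  rintro ⟨a, b, ha, hb, hab, rfl⟩
  obtain ⟨e, he⟩ := h
  have h1 : ∀ y, D y = 0 → ((starRingEnd ℂ) e * (y - (a • ζ + b • ξ))).re < 0 := fun y hy => by
    by_contra hcon
    have := he y (not_lt.1 hcon)
    linarith
  have h2 := h1 ζ hζ
  have h3 := h1 ξ hξ
  have h4 : a * ((starRingEnd ℂ) e * (ζ - (a • ζ + b • ξ))).re +
      b * ((starRingEnd ℂ) e * (ξ - (a • ζ + b • ξ))).re = 0 := by
    rw [← Complex.re_ofReal_mul, ← Complex.re_ofReal_mul, ← Complex.add_re]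
    obtain rfl : b = 1 - a := by linarith
    simp only [Complex.real_smul]
    push_cast
    ring_nf
    simp
  generalize ((starRingEnd ℂ) e * (ζ - (a • ζ + b • ξ))).re = X at h2 h4
  generalize ((starRingEnd ℂ) e * (ξ - (a • ζ + b • ξ))).re = Y at h3 h4
  have h5 : b * Y ≤ 0 := mul_nonpos_of_nonneg_of_nonpos hb h3.le
  rcases eq_or_lt_of_le ha with h0 | h0
  · obtain rfl : b = 1 := by linarith
    rw [← h0] at h4
    linarith
  · linarith [mul_neg_of_pos_of_neg h0 h2]

end Rigidity

/-! ### Compactness along an ultrafilter. -/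

theorem Ultrafilter.exists_tendsto_of_eventually_norm_le {ι E : Type*} [NormedAddCommGroup E]
    [ProperSpace E] (U : Ultrafilter ι) {f : ι → E} {R : ℝ} (hf : ∀ᶠ n in U, ‖f n‖ ≤ R) :
    ∃ a, ‖a‖ ≤ R ∧ Tendsto f U (𝓝 a) := by
  obtain ⟨a, ha, hle⟩ := (isCompact_closedBall (0 : E) R).ultrafilter_le_nhds (U.map f) (by
    rw [le_principal_iff]
    exact hf.mono fun n hn => by simpa using hn)
  exact ⟨a, by simpa using ha, hle⟩

theorem tendsto_apply_of_lipschitz {ι : Type*} {l : Filter ι} {D : ι → ℂ → ℝ} {y : ι → ℂ} {x : ℂ}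
    {d : ℝ} (hD : ∀ n x y, D n y ≤ D n x + ‖x - y‖) (hd : Tendsto (fun n => D n x) l (𝓝 d))
    (hy : Tendsto y l (𝓝 x)) : Tendsto (fun n => D n (y n)) l (𝓝 d) := by
  have h1 : Tendsto (fun n => ‖y n - x‖) l (𝓝 0) := tendsto_iff_norm_sub_tendsto_zero.1 hy
  refine hd.congr_dist (squeeze_zero (fun _ => dist_nonneg) (fun n => ?_) h1)
  rw [Real.dist_eq, abs_le]
  have h2 := hD n (y n) x
  have h3 := hD n x (y n)
  rw [norm_sub_rev] at h3
  constructor <;> linarith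

theorem tendsto_apply_of_locally_lipschitz {ι : Type*} {l : Filter ι} {D : ι → ℂ → ℝ}
    {H : ι → ℂ → ℂ} {K : ℝ} {y : ι → ℂ} {x k : ℂ} {d : ℝ}
    (hD : ∀ n x y, D n y ≤ D n x + ‖x - y‖)
    (hlip : ∀ n η x y, 0 < η → η ≤ D n x → η ≤ D n y → ‖H n x - H n y‖ ≤ K / η * ‖x - y‖)
    (hd0 : 0 < d) (hd : Tendsto (fun n => D n x) l (𝓝 d))
    (hk : Tendsto (fun n => H n x) l (𝓝 k)) (hy : Tendsto y l (𝓝 x)) :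
    Tendsto (fun n => H n (y n)) l (𝓝 k) := by
  have h1 : Tendsto (fun n => K / (d / 2) * ‖y n - x‖) l (𝓝 0) := by
    simpa using (tendsto_iff_norm_sub_tendsto_zero.1 hy).const_mul (K / (d / 2))
  have h2 : Tendsto (fun n => H n (y n) - H n x) l (𝓝 0) := by
    refine squeeze_zero_norm' ?_ h1
    filter_upwards [hd.eventually_const_lt (half_lt_self hd0),
      (tendsto_apply_of_lipschitz hD hd hy).eventually_const_lt (half_lt_self hd0)] with n h3 h4
    exact hlip n _ _ _ (half_pos hd0) h4.le h3.le
  simpa using h2.add hk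

/-- The compactness argument: there is no sequence of distance functions `D n` and potentials
`H n` that jump across the zeros of `D n` and take asymptotically at most one non-zero value,
such that the positivity set of `D n` contains a ball centred on a segment between
two zeros of `D n`. -/
theorem false_of_jump_sequence {D : ℕ → ℂ → ℝ} {H : ℕ → ℂ → ℂ} {x ζ ξ : ℕ → ℂ} {θ : ℝ → ℝ}
    {K c₁ τ R : ℝ} (hc₁ : 0 < c₁) (hτ : 0 < τ) (hD0 : ∀ n x, 0 ≤ D n x)
    (hD : ∀ n x y, D n y ≤ D n x + ‖x - y‖)
    (hlip : ∀ n η x y, 0 < η → η ≤ D n x → η ≤ D n y → ‖H n x - H n y‖ ≤ K / η * ‖x - y‖)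
    (hx : ∀ n, τ ≤ D n (x n)) (hHx : ∀ n, H n (x n) = 0)
    (hval : ∀ (n : ℕ) x y, ‖x‖ < n + 1 → ‖y‖ < n + 1 → 1 / (n + 1 : ℝ) ≤ D n x →
      1 / (n + 1 : ℝ) ≤ D n y → ‖H n x * H n y * (H n x - H n y)‖ ≤ 1 / (n + 1 : ℝ))
    (hθ : ∀ ε > 0, 0 < θ ε ∧ θ ε ≤ 1 / 2)
    (hjump : ∀ n x, 0 < D n x → ∃ e : ℂ, ‖e‖ = 1 ∧ D n (x - D n x * e) = 0 ∧ ∀ ε > 0,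
      ‖H n (x + ((θ ε - 1) * D n x : ℝ) * e) - H n x‖ ≤ 1 → ∃ σ : ℝ, θ ε ≤ σ ∧ σ ≤ 1 / 2 ∧
        σ * D n x / 2 ≤ D n (x - ((1 + σ) * D n x : ℝ) * e) ∧
        c₁ ≤ (e * (H n (x + ((σ - 1) * D n x : ℝ) * e) -
          H n (x - ((1 + σ) * D n x : ℝ) * e))).re ∧
        |(e * (H n (x + ((σ - 1) * D n x : ℝ) * e) -
          H n (x - ((1 + σ) * D n x : ℝ) * e))).im| ≤ ε)
    (hζ : ∀ n, ‖ζ n‖ ≤ R ∧ D n (ζ n) = 0) (hξ : ∀ n, ‖ξ n‖ ≤ R ∧ D n (ξ n) = 0)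
    (hseg : ∀ n, x n ∈ segment ℝ (ζ n) (ξ n)) : False := by
  -- Bounded sequences converge along `U`, at all points of the plane at once, without extracting
  -- subsequences.
  set U : Ultrafilter ℕ := hyperfilter ℕ
  have hU : (U : Filter ℕ) ≤ atTop := by
    rw [← Nat.cofinite_eq_atTop]
    exact hyperfilter_le_cofinite
  have hxR : ∀ n, ‖x n‖ ≤ R := fun n => by
    have h := (convex_closedBall (0 : ℂ) R).segment_subset
      (by simpa using (hζ n).1) (by simpa using (hξ n).1) (hseg n)
    simpa using h
  have hDR : ∀ n y, D n y ≤ R + ‖y‖ := fun n y => by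
    have h1 := hD n (ζ n) y
    have h2 := norm_sub_le (ζ n) y
    linarith [(hζ n).1, (hζ n).2]
  have hex : ∀ y, ∃ d, Tendsto (fun n => D n y) U (𝓝 d) := fun y => by
    obtain ⟨d, -, hd⟩ := U.exists_tendsto_of_eventually_norm_le (f := fun n => D n y)
      (R := R + ‖y‖) (.of_forall fun n => by
        rw [Real.norm_of_nonneg (hD0 n y)]
        exact hDR n y)
    exact ⟨d, hd⟩
  choose D' hD' using hex
  -- The Lipschitz bound joins any two points with clearance, even in different components, so
  -- comparison with `x n`, where `H n` vanishes, bounds `H n y`.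
  have hexH : ∀ y, ∃ k, 0 < D' y → Tendsto (fun n => H n y) U (𝓝 k) := fun y => by
    by_cases hy : 0 < D' y
    · have hm : 0 < min (D' y / 2) τ := lt_min (half_pos hy) hτ
      obtain ⟨k, -, hk⟩ := U.exists_tendsto_of_eventually_norm_le (f := fun n => H n y)
        (R := |K| / min (D' y / 2) τ * (‖y‖ + R)) (by
          filter_upwards [(hD' y).eventually_const_lt (half_lt_self hy)] with n hn
          have h := hlip n _ y (x n) hm ((min_le_left _ _).trans hn.le)
            ((min_le_right _ _).trans (hx n))
          rw [hHx, sub_zero] at h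
          refine h.trans (mul_le_mul (by gcongr; exact le_abs_self K) ?_ (norm_nonneg _)
            (by positivity))
          exact (norm_sub_le _ _).trans (by linarith [hxR n]))
      exact ⟨k, fun _ => hk⟩
    · exact ⟨0, fun h => absurd h hy⟩
  choose H' hH' using hexH
  have hDy : ∀ {y : ℕ → ℂ} {a : ℂ}, Tendsto y U (𝓝 a) →
      Tendsto (fun n => D n (y n)) U (𝓝 (D' a)) := fun h =>
    tendsto_apply_of_lipschitz hD (hD' _) h
  have hHy : ∀ {y : ℕ → ℂ} {a : ℂ}, 0 < D' a → Tendsto y U (𝓝 a) →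
      Tendsto (fun n => H n (y n)) U (𝓝 (H' a)) := fun h0 h =>
    tendsto_apply_of_locally_lipschitz hD hlip h0 (hD' _) (hH' _ h0) h
  have gD : ∀ x y, D' y ≤ D' x + ‖x - y‖ := fun x y =>
    le_of_tendsto_of_tendsto' (hD' y) ((hD' x).add_const _) fun n => hD n x y
  have glip' : ∀ η x y, 0 < η → η < D' x → η < D' y → ‖H' x - H' y‖ ≤ K / η * ‖x - y‖ := by
    intro η x y hη h1 h2
    refine le_of_tendsto ((hH' x (hη.trans h1)).sub (hH' y (hη.trans h2))).norm ?_
    filter_upwards [(hD' x).eventually_const_lt h1, (hD' y).eventually_const_lt h2] with n h3 h4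
    exact hlip n η x y hη h3.le h4.le
  -- Only strict inequalities descend to the sequence; the closed case follows by letting the
  -- clearance increase to `η`.
  have glip : ∀ η x y, 0 < η → η ≤ D' x → η ≤ D' y → ‖H' x - H' y‖ ≤ K / η * ‖x - y‖ := by
    intro η x y hη h1 h2
    have hc : Tendsto (fun s => K / s * ‖x - y‖) (𝓝[<] η) (𝓝 (K / η * ‖x - y‖)) :=
      ((tendsto_const_nhds.div (tendsto_id.mono_left nhdsWithin_le_nhds) hη.ne').mul_const _)
    refine ge_of_tendsto hc ?_
    filter_upwards [Ioo_mem_nhdsLT hη] with s hs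
    exact glip' s x y hs.1 (hs.2.trans_le h1) (hs.2.trans_le h2)
  have hinv : Tendsto (fun n : ℕ => 1 / (n + 1 : ℝ)) U (𝓝 0) :=
    tendsto_one_div_add_atTop_nhds_zero_nat.mono_left hU
  have gval : ∀ x y, 0 < D' x → 0 < D' y → H' x ≠ 0 → H' y ≠ 0 → H' x = H' y := by
    intro x y hx0 hy0 hx1 hy1
    have h1 := hH' x hx0
    have h2 := hH' y hy0
    have hbig : ∀ r : ℝ, ∀ᶠ n : ℕ in U, r < n + 1 := fun r =>
      hU ((tendsto_natCast_atTop_atTop.atTop_add tendsto_const_nhds).eventually_gt_atTop r)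
    have h3 : ‖H' x * H' y * (H' x - H' y)‖ ≤ 0 := by
      refine le_of_tendsto_of_tendsto ((h1.mul h2).mul (h1.sub h2)).norm hinv ?_
      filter_upwards [hbig ‖x‖, hbig ‖y‖, hinv.eventually_lt (hD' x) hx0,
        hinv.eventually_lt (hD' y) hy0] with n h4 h5 h6 h7
      exact hval n x y h4 h5 h6.le h7.le
    simpa [hx1, hy1, sub_eq_zero] using norm_le_zero_iff.1 h3
  have gjump : ∀ x, 0 < D' x → ∃ e, IsJumpDirection D' H' c₁ x e := by
    intro x hx0
    have hDx := hD' x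
    have hpos : ∀ᶠ n in U, 0 < D n x := hDx.eventually_const_lt hx0
    obtain ⟨e, he⟩ := (hpos.mono fun n hn => hjump n x hn).choice
    obtain ⟨e', -, he'⟩ := U.exists_tendsto_of_eventually_norm_le (f := e) (R := 1)
      (he.mono fun n hn => hn.1.le)
    have he1 : ‖e'‖ = 1 := tendsto_nhds_unique he'.norm
      (tendsto_const_nhds.congr' (he.mono fun n hn => hn.1.symm))
    have hcomb : ∀ {s : ℕ → ℝ} {t : ℝ}, Tendsto s U (𝓝 t) →
        Tendsto (fun n => ((s n * D n x : ℝ) : ℂ) * e n) U (𝓝 ((t * D' x : ℝ) * e')) :=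
      fun hs => ((Complex.continuous_ofReal.tendsto _).comp (hs.mul hDx)).mul he'
    have hball : ∀ {s : ℝ}, |s| < 1 → 0 < D' (x + (s * D' x : ℝ) * e') ∧
        H' (x + (s * D' x : ℝ) * e') = H' x := by
      intro s hs
      have hn : ‖x + (s * D' x : ℝ) * e' - x‖ < D' x := by
        rw [add_sub_cancel_left, norm_mul, he1, mul_one, Complex.norm_real, norm_mul,
          Real.norm_of_nonneg hx0.le]
        exact mul_lt_of_lt_one_left hx0 hs
      refine ⟨?_, eq_on_ball_of_two_valued gD glip gval hn⟩
      have := gD (x + (s * D' x : ℝ) * e') x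
      linarith
    refine ⟨e', he1, ?_, fun ε hε => ?_⟩
    · have h1 : Tendsto (fun n => x - D n x * e n) U (𝓝 (x - D' x * e')) := by
        simpa using (hcomb (tendsto_const_nhds (x := (1 : ℝ)))).const_sub x
      exact tendsto_nhds_unique (hDy h1) (tendsto_const_nhds.congr'
        (he.mono fun n hn => hn.2.1.symm))
    obtain ⟨hθ0, hθ1⟩ := hθ ε hε
    have hs1 : |θ ε - 1| < 1 := abs_lt.2 ⟨by linarith, by linarith⟩
    -- `H'` is constant on the disc about `x`, so the smallness condition in `hjump` holds
    -- eventually.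
    have hsmall : Tendsto (fun n => ‖H n (x + ((θ ε - 1) * D n x : ℝ) * e n) - H n x‖) U
        (𝓝 0) := by
      have h1 := hHy (hball hs1).1 ((hcomb (tendsto_const_nhds (x := θ ε - 1))).const_add x)
      rw [(hball hs1).2] at h1
      simpa using (h1.sub (hH' x hx0)).norm
    have hσ := (he.and (hsmall.eventually_lt_const one_pos)).mono fun n hn =>
      hn.1.2.2 ε hε hn.2.le
    obtain ⟨σ, hσ⟩ := hσ.choice
    obtain ⟨σ', -, hσ'⟩ := U.exists_tendsto_of_eventually_norm_le (f := σ) (R := 1 / 2)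
      (hσ.mono fun n hn => by
        rw [Real.norm_of_nonneg (hθ0.le.trans hn.1)]
        exact hn.2.1)
    have hσ1 : θ ε ≤ σ' := ge_of_tendsto hσ' (hσ.mono fun n hn => hn.1)
    have hσ2 : σ' ≤ 1 / 2 := le_of_tendsto hσ' (hσ.mono fun n hn => hn.2.1)
    have hs2 : |σ' - 1| < 1 := abs_lt.2 ⟨by linarith, by linarith⟩
    have hu := hHy (hball hs2).1 ((hcomb (hσ'.sub_const 1)).const_add x)
    rw [(hball hs2).2] at hu
    have hyt := (hcomb (hσ'.const_add 1)).const_sub x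
    have hy0 : 0 < D' (x - ((1 + σ') * D' x : ℝ) * e') := by
      have h1 : σ' * D' x / 2 ≤ D' (x - ((1 + σ') * D' x : ℝ) * e') :=
        le_of_tendsto_of_tendsto ((hσ'.mul hDx).div_const 2) (hDy hyt)
          (hσ.mono fun n hn => hn.2.2.1)
      have h2 : 0 < σ' := hθ0.trans_le hσ1
      exact lt_of_lt_of_le (by positivity) h1
    have hlim := he'.mul (hu.sub (hHy hy0 hyt))
    refine ⟨_, hy0, ?_, ?_⟩
    · exact ge_of_tendsto ((Complex.continuous_re.tendsto _).comp hlim)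
        (hσ.mono fun n hn => hn.2.2.2.1)
    · exact le_of_tendsto (((Complex.continuous_im.tendsto _).comp hlim).abs)
        (hσ.mono fun n hn => hn.2.2.2.2)
  obtain ⟨x', -, hx'⟩ := U.exists_tendsto_of_eventually_norm_le (f := x) (.of_forall hxR)
  obtain ⟨ζ', -, hζ'⟩ := U.exists_tendsto_of_eventually_norm_le (f := ζ)
    (.of_forall fun n => (hζ n).1)
  obtain ⟨ξ', -, hξ'⟩ := U.exists_tendsto_of_eventually_norm_le (f := ξ)
    (.of_forall fun n => (hξ n).1)
  choose a b ha hb hab hxe using hseg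
  obtain ⟨a', -, ha'⟩ := U.exists_tendsto_of_eventually_norm_le (f := a) (R := 1)
    (.of_forall fun n => by
      rw [Real.norm_of_nonneg (ha n)]
      linarith [hb n, hab n])
  have hb' : Tendsto b U (𝓝 (1 - a')) :=
    (ha'.const_sub 1).congr fun n => by linarith [hab n]
  have hmem : x' ∈ segment ℝ ζ' ξ' := by
    refine ⟨a', 1 - a', ge_of_tendsto' ha' ha, ge_of_tendsto' hb' hb, by ring, ?_⟩
    exact tendsto_nhds_unique ((ha'.smul hζ').add (hb'.smul hξ')) (hx'.congr fun n => (hxe n).symm)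
  have hx0 : 0 < D' x' := hτ.trans_le (ge_of_tendsto' (hDy hx') hx)
  refine not_mem_segment_of_half_plane (exists_half_plane hc₁ gD glip gval gjump hx0) ?_ ?_ hmem
  · exact tendsto_nhds_unique (hDy hζ') (by simp [(hζ _).2])
  · exact tendsto_nhds_unique (hDy hξ') (by simp [(hξ _).2])

/-! ### Rescaling to unit size. -/

theorem IsNiceMeasure.cauchyDiff_sub_of_notMem {μ : Measure ℂ} {C₀ : ℝ} (h : IsNiceMeasure μ C₀)
    (hC : 0 < C₀) (hne : μ.support.Nonempty) {a b c : ℂ} (ha : a ∉ μ.support)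
    (hb : b ∉ μ.support) (hc : c ∉ μ.support) :
    cauchyDiff μ a c - cauchyDiff μ b c = cauchyDiff μ a b := by
  have hpos : ∀ x ∉ μ.support, 0 < Metric.infDist x μ.support := fun x hx =>
    (μ.isClosed_support.notMem_iff_infDist_pos hne).1 hx
  have hle : ∀ x, ∀ w ∈ μ.support, Metric.infDist x μ.support ≤ ‖w - x‖ := fun x w hw => by
    rw [← dist_eq_norm, dist_comm]
    exact Metric.infDist_le_dist_of_mem hw
  refine h.cauchyDiff_sub hC (lt_min (lt_min (hpos a ha) (hpos b hb)) (hpos c hc))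
    (fun w hw => ?_) (fun w hw => ?_) (fun w hw => ?_)
  · exact ((min_le_left _ _).trans (min_le_left _ _)).trans (hle a w hw)
  · exact ((min_le_left _ _).trans (min_le_right _ _)).trans (hle b w hw)
  · exact (min_le_right _ _).trans (hle c w hw)

/-- The distance to the support of `μ`, in the coordinate `y` with `w = c + l y`. -/
noncomputable def rescaledDist (μ : Measure ℂ) (c : ℂ) (l : ℝ) (y : ℂ) : ℝ :=
  Metric.infDist (c + l * y) μ.support / l

theorem rescaledDist_nonneg {μ : Measure ℂ} {c : ℂ} {l : ℝ} (hl : 0 < l) (y : ℂ) :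
    0 ≤ rescaledDist μ c l y :=
  div_nonneg Metric.infDist_nonneg hl.le

theorem rescaledDist_le_add {μ : Measure ℂ} {c : ℂ} {l : ℝ} (hl : 0 < l) (x y : ℂ) :
    rescaledDist μ c l y ≤ rescaledDist μ c l x + ‖x - y‖ := by
  have h1 := Metric.infDist_le_infDist_add_dist (s := μ.support) (x := c + l * y) (y := c + l * x)
  rw [dist_eq_norm, add_sub_add_left_eq_sub, ← mul_sub, norm_mul, Complex.norm_real,
    Real.norm_of_nonneg hl.le, norm_sub_rev] at h1
  rw [rescaledDist, rescaledDist, div_add' _ _ _ hl.ne']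
  gcongr
  linarith

theorem le_rescaledDist_iff {μ : Measure ℂ} {c : ℂ} {l η : ℝ} (hl : 0 < l)
    (hne : μ.support.Nonempty) {y : ℂ} :
    η ≤ rescaledDist μ c l y ↔ ∀ w ∈ μ.support, η * l ≤ ‖w - (c + l * y)‖ := by
  rw [rescaledDist, le_div_iff₀ hl, Metric.le_infDist hne]
  refine forall₂_congr fun w _ => ?_
  rw [dist_comm, dist_eq_norm]

theorem rescaledDist_eq_zero_of_mem {μ : Measure ℂ} {c : ℂ} {l : ℝ} {y : ℂ}
    (hy : c + l * y ∈ μ.support) : rescaledDist μ c l y = 0 := by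
  rw [rescaledDist, Metric.infDist_zero_of_mem hy, zero_div]

theorem notMem_support_of_rescaledDist_pos {μ : Measure ℂ} {c : ℂ} {l : ℝ} {y : ℂ}
    (hy : 0 < rescaledDist μ c l y) : c + l * y ∉ μ.support := fun h =>
  hy.ne' (rescaledDist_eq_zero_of_mem h)

theorem IsNiceMeasure.rescaled_lipschitz {μ : Measure ℂ} {C₀ : ℝ} (h : IsNiceMeasure μ C₀)
    (hC : 0 < C₀) (hne : μ.support.Nonempty) {c b : ℂ} {l : ℝ} (hl : 0 < l) (hb : b ∉ μ.support)
    {η : ℝ} (hη : 0 < η) {x y : ℂ} (hx : η ≤ rescaledDist μ c l x)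
    (hy : η ≤ rescaledDist μ c l y) :
    ‖cauchyDiff μ (c + l * x) b - cauchyDiff μ (c + l * y) b‖ ≤ 4 * C₀ / η * ‖x - y‖ := by
  rw [h.cauchyDiff_sub_of_notMem hC hne (notMem_support_of_rescaledDist_pos (hη.trans_le hx))
    (notMem_support_of_rescaledDist_pos (hη.trans_le hy)) hb]
  refine (h.norm_cauchyDiff_le hC (mul_pos hη hl) ((le_rescaledDist_iff hl hne).1 hx)
    ((le_rescaledDist_iff hl hne).1 hy)).trans_eq ?_
  rw [add_sub_add_left_eq_sub, ← mul_sub, norm_mul, Complex.norm_real, Real.norm_of_nonneg hl.le]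
  field_simp

/-- Only the points are rescaled. With `p` nearest to `c + l * x`, the points in the statement are
multiples of `e` away from `p`, and the base point `b` cancels in differences. `θ` depends on `ε`
but not on the measure. -/
theorem exists_rescaled_jump {C₀ c₀ : ℝ} (hC : 0 < C₀) (hc : 0 < c₀) :
    ∃ θ : ℝ → ℝ, (∀ ε > 0, 0 < θ ε ∧ θ ε ≤ 1 / 2) ∧
      ∀ μ : Measure ℂ, IsNiceMeasure μ C₀ → IsADRegularMeasure μ c₀ → μ.support.Nonempty →
      ∀ (c b : ℂ) (l : ℝ), 0 < l → b ∉ μ.support → ∀ x, 0 < rescaledDist μ c l x →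
      ∃ e : ℂ, ‖e‖ = 1 ∧ rescaledDist μ c l (x - rescaledDist μ c l x * e) = 0 ∧ ∀ ε > 0,
      ‖cauchyDiff μ (c + l * (x + ((θ ε - 1) * rescaledDist μ c l x : ℝ) * e)) b -
        cauchyDiff μ (c + l * x) b‖ ≤ 1 → ∃ σ : ℝ, θ ε ≤ σ ∧ σ ≤ 1 / 2 ∧
        σ * rescaledDist μ c l x / 2 ≤
          rescaledDist μ c l (x - ((1 + σ) * rescaledDist μ c l x : ℝ) * e) ∧
        c₀ / 4 ≤ (e * (cauchyDiff μ (c + l * (x + ((σ - 1) * rescaledDist μ c l x : ℝ) * e)) b -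
          cauchyDiff μ (c + l * (x - ((1 + σ) * rescaledDist μ c l x : ℝ) * e)) b)).re ∧
        |(e * (cauchyDiff μ (c + l * (x + ((σ - 1) * rescaledDist μ c l x : ℝ) * e)) b -
          cauchyDiff μ (c + l * (x - ((1 + σ) * rescaledDist μ c l x : ℝ) * e)) b)).im| ≤ ε := by
  choose! θ hθ0 hθ1 hθ using fun (ε : ℝ) (hε : 0 < ε) => exists_jump hC hc hε
  refine ⟨θ, fun ε hε => ⟨hθ0 ε hε, hθ1 ε hε⟩, fun μ h hAD hne c b l hl hb x hx => ?_⟩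
  obtain ⟨p, hp, hpd⟩ := μ.isClosed_support.exists_infDist_eq_dist hne (c + l * x)
  set d := Metric.infDist (c + l * x) μ.support with hd
  have hDd : rescaledDist μ c l x = d / l := rfl
  rw [hDd] at hx ⊢
  have hd0 : 0 < d := by simpa [hl] using (div_pos_iff_of_pos_right hl).1 hx
  have hdc : (d : ℂ) ≠ 0 := by exact_mod_cast hd0.ne'
  have hlc : (l : ℂ) ≠ 0 := by exact_mod_cast hl.ne'
  set e := (c + l * x - p) / d with he
  have hpe : c + l * x = p + d * e := by
    rw [he]
    field_simp
    ring
  have he1 : ‖e‖ = 1 := by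
    rw [he, norm_div, ← dist_eq_norm, ← hpd, Complex.norm_real, Real.norm_of_nonneg hd0.le,
      div_self hd0.ne']
  have hpt : ∀ t : ℝ, c + l * (x + (t * (d / l) : ℝ) * e) = p + ((1 + t) * d : ℝ) * e := fun t => by
    have h1 : c + l * (x + (t * (d / l) : ℝ) * e) = c + l * x + (t * d : ℝ) * e := by
      push_cast
      field_simp
      ring
    rw [h1, hpe]
    push_cast
    ring
  have hptn : ∀ t : ℝ, c + l * (x - (t * (d / l) : ℝ) * e) = p + ((1 - t) * d : ℝ) * e :=
    fun t => by
    have h1 := hpt (-t)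
    rw [show x - ((t * (d / l) : ℝ) : ℂ) * e = x + ((-t * (d / l) : ℝ) : ℂ) * e by
      push_cast
      ring, h1, ← sub_eq_add_neg]
  have hfar : ∀ w ∈ μ.support, d ≤ ‖w - (p + d * e)‖ := fun w hw => by
    rw [← hpe, ← dist_eq_norm, dist_comm]
    exact Metric.infDist_le_dist_of_mem hw
  have hnot : ∀ s : ℝ, 0 < s → s ≤ d → p + (s : ℂ) * e ∉ μ.support := fun s hs hsd hmem => by
    have h1 := hfar _ hmem
    rw [add_sub_add_left_eq_sub, ← sub_mul, norm_mul, he1, mul_one, ← Complex.ofReal_sub,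
      Complex.norm_real, Real.norm_eq_abs, abs_of_nonpos (by linarith)] at h1
    linarith
  refine ⟨e, he1, ?_, fun ε hε hle => ?_⟩
  · refine rescaledDist_eq_zero_of_mem ?_
    have h1 := hptn 1
    rw [one_mul, sub_self, zero_mul, Complex.ofReal_zero, zero_mul, add_zero] at h1
    rwa [h1]
  have hθd : θ ε * d ≤ d := mul_le_of_le_one_left hd0.le (by linarith [hθ1 ε hε])
  rw [hpt, hpe, add_sub_cancel, h.cauchyDiff_sub_of_notMem hC hne
    (hnot _ (mul_pos (hθ0 ε hε) hd0) hθd) (hnot d hd0 le_rfl) hb] at hle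
  obtain ⟨s, hs1, hs2, hs3, hs4, hs5⟩ := hθ ε hε μ h hAD p e d hp he1 hd0 hfar hle
  have hs0 : 0 < s := (mul_pos (hθ0 ε hε) hd0).trans_le hs1
  refine ⟨s / d, (le_div_iff₀ hd0).2 hs1, (div_le_iff₀ hd0).2 (by linarith), ?_, ?_⟩
  · rw [le_rescaledDist_iff hl hne, hptn]
    have e1 : (1 - (1 + s / d)) * d = -s := by
      field_simp
      ring
    have e2 : s / d * (d / l) / 2 * l = s / 2 := by field_simp
    rw [e1, e2, Complex.ofReal_neg]
    exact hs3
  · have e1 : (1 - (1 + s / d)) * d = -s := by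
      field_simp
      ring
    have e2 : (1 + (s / d - 1)) * d = s := by
      field_simp
      ring
    have hn : p + (-s : ℂ) * e ∉ μ.support := fun hmem => by
      have h1 := hs3 _ hmem
      rw [sub_self, norm_zero] at h1
      linarith
    rw [hpt, hptn, e1, e2, Complex.ofReal_neg, h.cauchyDiff_sub_of_notMem hC hne
      (hnot s hs0 (by linarith)) hn hb]
    exact ⟨hs4, hs5⟩

/-! ### Conclusion by contradiction. -/

theorem mainTheorem3 (C₀ c₀ τ : ℝ) (hC₀ : 0 < C₀) (hc₀ : 0 < c₀) (hτ₀ : 0 < τ) (hτ₁ : τ < 1) :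
    ∃ A A' γ : ℝ, 1 < A ∧ 1 < A' ∧ A ≤ A' ∧ 0 < γ ∧
      ∀ μ : MeasureTheory.Measure ℂ, IsGoodMeasure μ C₀ → IsADRegularMeasure μ c₀ →
        ∀ Q : DyadicSquare, IsBadSquare μ τ Q →
          ENNReal.ofReal γ ≤ cauchyTheta μ A A' Q := by
  by_contra! hcon
  have hm : ∀ n : ℕ, 0 < min τ (1 / (n + 1 : ℝ)) := fun n => lt_min hτ₀ (by positivity)
  -- The `n`-th counterexample is tested on points within `n + 1` sides of the centre, with
  -- clearance and error `1 / (n + 1)`. The radius `n + 11` also covers the base point `b n`, within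
  -- 10 sides, and the minimum with `τ` covers its clearance.
  choose A γ hA hγ hsmall using fun n : ℕ => exists_cauchyTheta_threshold hC₀ hc₀
    (by positivity : 0 < (n + 11 : ℝ)) (hm n) ((min_le_left _ _).trans hτ₁.le)
    (by positivity : 0 < 1 / (n + 1 : ℝ))
  choose μ hgood hAD Q hbad hΘ using fun n => hcon (A n) (A n) (γ n) (hA n) (hA n) le_rfl (hγ n)
  choose ζ hζ ξ hξ _ b hb hball using hbad
  obtain ⟨θ, hθ, hjump⟩ := exists_rescaled_jump hC₀ hc₀
  have hl : ∀ n, 0 < (Q n).side := fun n => zpow_pos two_pos _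
  have hlc : ∀ n, ((Q n).side : ℂ) ≠ 0 := fun n => by exact_mod_cast (hl n).ne'
  have hne : ∀ n, (μ n).support.Nonempty := fun n => ⟨_, (hζ n).2⟩
  have hbd : ∀ n, ∀ w ∈ (μ n).support, τ * (Q n).side ≤ ‖w - b n‖ := fun n w hw => by
    by_contra! hlt
    have : w ∈ Metric.ball (b n) (τ * (Q n).side) ∩ (μ n).support :=
      ⟨by rwa [Metric.mem_ball, dist_eq_norm], hw⟩
    rw [hball n] at this
    exact this
  have hbS : ∀ n, b n ∉ (μ n).support := fun n hmem => by
    have := hbd n _ hmem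
    rw [sub_self, norm_zero] at this
    linarith [mul_pos hτ₀ (hl n)]
  have hbc : ∀ n, b n ∈ Metric.ball (Q n).center (10 * (Q n).side) := fun n =>
    (convex_ball _ _).segment_subset (hζ n).1 (hξ n).1 (hb n)
  have hco : ∀ n w, (Q n).center + (Q n).side * ((w - (Q n).center) / (Q n).side) = w :=
    fun n w => by
    have := hlc n
    field_simp
    ring
  have hpt : ∀ n, ∀ w ∈ Metric.ball (Q n).center (10 * (Q n).side) ∩ (μ n).support,
      ‖(w - (Q n).center) / (Q n).side‖ ≤ 10 ∧
      rescaledDist (μ n) (Q n).center (Q n).side ((w - (Q n).center) / (Q n).side) = 0 := by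
    intro n w hw
    refine ⟨?_, rescaledDist_eq_zero_of_mem ?_⟩
    · rw [norm_div, Complex.norm_real, Real.norm_of_nonneg (hl n).le, div_le_iff₀ (hl n),
        ← dist_eq_norm]
      exact hw.1.le
    · rw [hco]
      exact hw.2
  -- `b n` is both the base point of `H n` and the point of the segment, so `H n` vanishes there.
  refine false_of_jump_sequence (D := fun n => rescaledDist (μ n) (Q n).center (Q n).side)
    (H := fun n y => cauchyDiff (μ n) ((Q n).center + (Q n).side * y) (b n))
    (x := fun n => (b n - (Q n).center) / (Q n).side)
    (ζ := fun n => (ζ n - (Q n).center) / (Q n).side)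
    (ξ := fun n => (ξ n - (Q n).center) / (Q n).side)
    (c₁ := c₀ / 4) (by positivity) hτ₀ (fun n => rescaledDist_nonneg (hl n))
    (fun n => rescaledDist_le_add (hl n))
    (fun n η x y hη => (hgood n).1.rescaled_lipschitz hC₀ (hne n) (hl n) (hbS n) hη)
    (fun n => ?_) (fun n => ?_) (fun n x y hx hy hDx hDy => ?_) hθ
    (fun n => hjump (μ n) (hgood n).1 (hAD n) (hne n) _ _ _ (hl n) (hbS n))
    (fun n => hpt n _ (hζ n)) (fun n => hpt n _ (hξ n)) fun n => ?_
  · rw [le_rescaledDist_iff (hl n) (hne n), hco]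
    exact hbd n
  · rw [hco, cauchyDiff_self]
  · have hnear : ∀ u : ℂ, ‖u‖ < n + 1 →
        ‖(Q n).center + (Q n).side * u - (Q n).center‖ < (n + 11) * (Q n).side := fun u hu => by
      rw [add_sub_cancel_left, norm_mul, Complex.norm_real, Real.norm_of_nonneg (hl n).le, mul_comm]
      exact mul_lt_mul_of_pos_right (by linarith) (hl n)
    have hnb : ‖b n - (Q n).center‖ < (n + 11) * (Q n).side := by
      rw [← dist_eq_norm]
      refine (hbc n).trans_le (mul_le_mul_of_nonneg_right ?_ (hl n).le)
      linarith [n.cast_nonneg (α := ℝ)]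
    have h := hsmall n (μ n) (hgood n) (hAD n) (Q n) ⟨_, hζ n⟩ (hΘ n) _ _ (b n)
      (hnear x hx) (hnear y hy) hnb
      ((le_rescaledDist_iff (hl n) (hne n)).1 ((min_le_right _ _).trans hDx))
      ((le_rescaledDist_iff (hl n) (hne n)).1 ((min_le_right _ _).trans hDy))
      (fun w hw => (mul_le_mul_of_nonneg_right (min_le_left _ _) (hl n).le).trans (hbd n w hw))
    exact h
  · obtain ⟨s, t, hs, ht, hst, hbe⟩ := hb n
    refine ⟨s, t, hs, ht, hst, ?_⟩
    have h1 : (s : ℂ) + t = 1 := by exact_mod_cast hst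
    rw [← hbe, Complex.real_smul, Complex.real_smul, Complex.real_smul, Complex.real_smul]
    have := hlc n
    field_simp
    linear_combination (-(Q n).center) * h1
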